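/- **Setting.** Let $\mathbf M$ and $\mathbf Q$ be small symmetric monoidal categories with the same objects, the same tensor unit $I$ and the same tensor product of objects, and let $J:\mathbf M\to\mathbf Q$ be a strict symmetric monoidal functor that is the identity on objects. Let $\mathrm{Bit}$ be an object and $\mathrm{zero},\mathrm{one}:I\to\mathrm{Bit}$ morphisms of $\mathbf M$ such that $J(\mathrm{zero}),J(\mathrm{one})$ make $\mathrm{Bit}$ a coproduct $I+I$ in $\mathbf Q$. Assume that in $\mathbf Q$ the tensor product distributes over binary coproducts: whenever $X\to Z\leftarrow Y$ is a coproduct diagram in $\mathbf Q$, so is $W\otimes X\to W\otimes Z\leftarrow W\otimes Y$, for every $W$. Assume that $\mathbf Q$ is *enriched in convex spaces*: each hom-set carries a convex sum $(p,q,f,g)\mapsto pf+qg$, for $p,q\in[0,1]$ with $p+q=1$, satisfying * $pf+qf=f$, $\ pf+qg=qg+pf$, $\ 0f+1g=g$; * $(a+b)\bigl(\tfrac{a}{a+b}x+\tfrac{b}{a+b}y\bigr)+(c+d)\bigl(\tfrac{c}{c+d}z+\tfrac{d}{c+d}w\bigr)=(a+c)\bigl(\tfrac{a}{a+c}x+\tfrac{c}{a+c}z\bigr)+(b+d)\bigl(\tfrac{b}{b+d}y+\tfrac{d}{b+d}w\bigr)$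 for $a,b,c,d\ge 0$ with $a+b+c+d=1$ and all denominators nonzero; and composition in $\mathbf Q$ preserves convex sums in each argument. **Bisets.** A *biset* is a triple $(X_0,X_1,\ X_1\to X_0)$ of two sets and a function; a morphism is a pair of functions $X_0\to Y_0$, $X_1\to Y_1$ making the square commute. The category $\mathcal V$ of bisets (the category $\mathbf{Set}^{\mathbf 2^{op}}$) is cartesian closed with coproducts, with exponential $(X\Rightarrow Y)=(\mathbf{Set}(X_0,Y_0),\ \mathcal V(X,Y),\ h\mapsto h_0)$. It is regarded as a $\mathcal V$-category by this exponential. For a $\mathcal V$-category $\mathcal A$, let $V(\mathcal A)$ be its underlying category; a *map* $X\to Y$ in $\mathcal A$ is a morphism $1\to\mathcal A(X,Y)$ in $\mathcal V$, i.e. a morphism of $V(\mathcal A)$. **The category $\widetilde{\mathbf C}$.** Let $\mathbf C$ be the $\mathcal V$-category with the objects of $\mathbf M$ and $\mathbf Q$ and hom-bisets $\mathbf C(A,B)=(\mathbf Q(A,B),\ \mathbf M(A,B),\ J)$. A *$\mathcal V$-presheaf* on $\mathbf C$ is a $\mathcal V$-functor $F:\mathbf C^{op}\to\mathcal V$. The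 sets $(FA)_0$ form a functor $F^0:\mathbf Q^{op}\to\mathbf{Set}$. The presheaves form a $\mathcal V$-category in which the hom-biset from $F$ to $G$ is the end of the bisets $FA\Rightarrow GA$: its $0$-elements are the natural transformations $F^0\to G^0$ over $\mathbf Q$, and its $1$-elements are the families of biset morphisms $FA\to GA$ that are natural with respect to $\mathbf M$ and whose $0$-components are natural with respect to $\mathbf Q$. Call $F$ *smooth* if $F^0$ is product-preserving, i.e. for every binary coproduct diagram $X\to Z\leftarrow Y$ in $\mathbf Q$ the function $F^0(Z)\to F^0(X)\times F^0(Y)$ is a bijection. Let $\widetilde{\mathbf C}$ be the full $\mathcal V$-subcategory of smooth $\mathcal V$-presheaves on $\mathbf C$. **Theorem.** The $\mathcal V$-category $\mathcal A=\widetilde{\mathbf C}$ is a model for Proto-Quipper with dynamic lifting: it admits structure as follows. (a) $\mathcal A$ is a symmetric monoidal closed $\mathcal V$-category: it has a unit $I$, a tensor product $\otimes$ of objects with a $\mathcal V$-functorial action $\mathcal A(X_1,Y_1)\times\mathcal A(X_2,Y_2)\to\mathcal A(X_1\otimes X_2,Y_1\otimes Y_2)$, and $\mathcal V$-natural unit,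 associativity and symmetry isomorphisms satisfying the usual axioms; and for each object $X$ there are a $\mathcal V$-functor $X\multimap-$ and a $\mathcal V$-adjunction $-\otimes X\dashv X\multimap-$. (b) $\mathcal A$ has coproducts: for every small family $(X_i)$ there are an object $P$ and maps $X_i\to P$ such that, for every $Z$, the induced morphisms $\mathcal A(P,Z)\to\mathcal A(X_i,Z)$ exhibit $\mathcal A(P,Z)$ as the product of the $\mathcal A(X_i,Z)$ in $\mathcal V$. (c) There is a $\mathcal V$-adjunction $p\dashv\flat$ with $p:\mathcal V\to\mathcal A$ and $\flat:\mathcal A\to\mathcal V$, where $p$ is a strong monoidal $\mathcal V$-functor. (d) There is a commutative strong $\mathcal V$-monad $(T,\eta,\mu)$ on $\mathcal A$: a $\mathcal V$-monad with a $\mathcal V$-natural strength $t_{X,Y}:X\otimes TY\to T(X\otimes Y)$, compatible with $\eta$, $\mu$, the associator and the left unitor, such that for the costrength $s_{X,Y}:TX\otimes Y\to T(X\otimes Y)$ obtained from $t$ by the symmetry, the two composites $\mu\circ Tt\circ s$ and $\mu\circ Ts\circ t$ from $TX\otimes TY$ to $T(X\otimes Y)$ agree. (e) Let $VT$ be the underlying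 monad of $T$ on $V(\mathcal A)$. Its Kleisli category $\mathrm{Kl}_{VT}(V(\mathcal A))$ is enriched in convex spaces, in the sense explained for $\mathbf Q$. (f) There are fully faithful strong monoidal functors $\psi:\mathbf M\to V(\mathcal A)$ and $\phi:\mathbf Q\to\mathrm{Kl}_{VT}(V(\mathcal A))$, where the Kleisli category has the tensor product of $\mathcal A$ on objects and $f\otimes g$ of Kleisli maps given by $\mu\circ Tt\circ s\circ(f\otimes g)$. The functor $\phi$ preserves convex sums, and $\phi\circ J=E\circ\psi$, where $E:V(\mathcal A)\to\mathrm{Kl}_{VT}(V(\mathcal A))$ is the functor with $E(X)=X$ and $E(f)=\eta\circ f$. (g) For all objects $S,U$ of $\mathcal A$ in the image of $\psi$ there is an isomorphism $\flat(S\multimap U)\cong\mathcal A(S,U)$ in $\mathcal V$. (h) Let $\mathrm{Bool}=I+I$ be a coproduct in $\mathcal A$ as in (b), and write $\mathrm{Bit}$ for the object $\psi(\mathrm{Bit})$. There are maps $\mathrm{init}:\mathrm{Bool}\to\mathrm{Bit}$ and $\mathrm{Dyn}:\mathrm{Bit}\to T\,\mathrm{Bool}$ in $\mathcal A$ with $\mathrm{Dyn}\circ\mathrm{init}=\eta_{\mathrm{Bool}}$.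 -/

import Mathlib

open CategoryTheory MonoidalCategory CategoryTheory.Limits
open scoped MonoidalClosed

namespace ProtoQuipper

section Bisets

universe u

/-- A biset: two sets and a function `obj₁ → obj₀`. -/
structure Biset : Type (u + 1) where
  obj₀ : Type u
  obj₁ : Type u
  map : obj₁ → obj₀

namespace Biset

@[ext]
structure Hom (A B : Biset.{u}) : Type u where
  h₀ : A.obj₀ → B.obj₀
  h₁ : A.obj₁ → B.obj₁
  comm : ∀ x, B.map (h₁ x) = h₀ (A.map x)

instance : Category.{u} Biset.{u} where
  Hom := Hom
  id A := ⟨fun x => x, fun x => x, fun _ => rfl⟩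
  comp f g := ⟨fun x => g.h₀ (f.h₀ x), fun x => g.h₁ (f.h₁ x), fun x => by
    rw [g.comm, f.comm]⟩

@[ext]
theorem hom_ext {A B : Biset.{u}} {f g : A ⟶ B} (h₀ : ∀ x, f.h₀ x = g.h₀ x)
    (h₁ : ∀ x, f.h₁ x = g.h₁ x) : f = g :=
  Hom.ext (funext h₀) (funext h₁)

@[simp] theorem id_h₀ (A : Biset.{u}) (x : A.obj₀) : Hom.h₀ (𝟙 A) x = x := rfl
@[simp] theorem id_h₁ (A : Biset.{u}) (x : A.obj₁) : Hom.h₁ (𝟙 A) x = x := rfl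
@[simp] theorem comp_h₀ {A B C : Biset.{u}} (f : A ⟶ B) (g : B ⟶ C) (x : A.obj₀) :
    (f ≫ g).h₀ x = g.h₀ (f.h₀ x) := rfl
@[simp] theorem comp_h₁ {A B C : Biset.{u}} (f : A ⟶ B) (g : B ⟶ C) (x : A.obj₁) :
    (f ≫ g).h₁ x = g.h₁ (f.h₁ x) := rfl

/-- The terminal biset. -/
def one : Biset.{u} := ⟨PUnit, PUnit, fun x => x⟩

/-- The product of two bisets. -/
def prod (A B : Biset.{u}) : Biset.{u} :=
  ⟨A.obj₀ × B.obj₀, A.obj₁ × B.obj₁, fun x => (A.map x.1, B.map x.2)⟩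

/-- The product of two morphisms of bisets. -/
def prodMap {A A' B B' : Biset.{u}} (f : A ⟶ A') (g : B ⟶ B') : prod A B ⟶ prod A' B' where
  h₀ x := (f.h₀ x.1, g.h₀ x.2)
  h₁ x := (f.h₁ x.1, g.h₁ x.2)
  comm x := Prod.ext (f.comm x.1) (g.comm x.2)

instance : MonoidalCategory Biset.{u} where
  tensorObj := prod
  tensorUnit := one
  tensorHom := prodMap
  whiskerLeft A _ _ g := prodMap (𝟙 A) g
  whiskerRight f B := prodMap f (𝟙 B)
  associator A B C :=
    { hom := ⟨fun x => (x.1.1, x.1.2, x.2), fun x => (x.1.1, x.1.2, x.2), fun _ => rfl⟩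
      inv := ⟨fun x => ((x.1, x.2.1), x.2.2), fun x => ((x.1, x.2.1), x.2.2), fun _ => rfl⟩ }
  leftUnitor A :=
    { hom := ⟨fun x => x.2, fun x => x.2, fun _ => rfl⟩
      inv := ⟨fun x => (PUnit.unit, x), fun x => (PUnit.unit, x), fun _ => rfl⟩ }
  rightUnitor A :=
    { hom := ⟨fun x => x.1, fun x => x.1, fun _ => rfl⟩
      inv := ⟨fun x => (x, PUnit.unit), fun x => (x, PUnit.unit), fun _ => rfl⟩ }
  tensorHom_def _ _ := rfl
  id_tensorHom_id _ _ := rfl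
  tensorHom_comp_tensorHom _ _ _ _ := rfl
  whiskerLeft_id _ _ := rfl
  id_whiskerRight _ _ := rfl
  associator_naturality _ _ _ := rfl
  leftUnitor_naturality _ := rfl
  rightUnitor_naturality _ := rfl
  pentagon _ _ _ _ := rfl
  triangle _ _ := rfl

instance : CartesianMonoidalCategory Biset.{u} where
  isTerminalTensorUnit := IsTerminal.ofUniqueHom
    (fun _ => ⟨fun _ => PUnit.unit, fun _ => PUnit.unit, fun _ => rfl⟩) (fun _ _ => rfl)
  fst _ _ := ⟨Prod.fst, Prod.fst, fun _ => rfl⟩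
  snd _ _ := ⟨Prod.snd, Prod.snd, fun _ => rfl⟩
  tensorProductIsBinaryProduct A B := BinaryFan.isLimitMk
    (fun s => ⟨fun x => (Hom.h₀ s.fst x, Hom.h₀ s.snd x), fun x => (Hom.h₁ s.fst x, Hom.h₁ s.snd x),
      fun x => Prod.ext (Hom.comm s.fst x) (Hom.comm s.snd x)⟩)
    (fun _ => rfl) (fun _ => rfl)
    (fun s m h h' => by rw [← h, ← h']; rfl)
  fst_def _ _ := rfl
  snd_def _ _ := rfl

instance : BraidedCategory Biset.{u} where
  braiding A B :=
    { hom := ⟨fun x => (x.2, x.1), fun x => (x.2, x.1), fun _ => rfl⟩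
      inv := ⟨fun x => (x.2, x.1), fun x => (x.2, x.1), fun _ => rfl⟩ }

/-- The exponential `A ⇒ B`. -/
def exp (A B : Biset.{u}) : Biset.{u} := ⟨A.obj₀ → B.obj₀, A ⟶ B, fun h => h.h₀⟩

instance : MonoidalClosed Biset.{u} where
  closed A :=
    { rightAdj :=
        { obj := exp A
          map := fun g => ⟨fun k x => g.h₀ (k x), fun k => k ≫ g, fun _ => rfl⟩ }
      adj := Adjunction.mkOfHomEquiv
        { homEquiv := fun X Y =>
            { toFun := fun f =>
                ⟨fun x a => f.h₀ (a, x),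
                 fun x => ⟨fun a => f.h₀ (a, X.map x), fun a => f.h₁ (a, x),
                   fun a => f.comm (a, x)⟩, fun _ => rfl⟩
              invFun := fun g =>
                ⟨fun x => g.h₀ x.2 x.1, fun x => Hom.h₁ (g.h₁ x.2) x.1, fun x => by
                  have h : Hom.h₀ (g.h₁ x.2) = g.h₀ (X.map x.2) := g.comm x.2
                  exact (Hom.comm (g.h₁ x.2) x.1).trans (congrFun h _)⟩
              left_inv := fun _ => rfl
              right_inv := fun g => by
                apply hom_ext
                · intro x; rfl
                · intro x
                  apply hom_ext
                  · intro a
                    exact congrFun (g.comm x).symm a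
                  · intro a; rfl } } }

instance : HasCoproducts.{u} Biset.{u} := fun ι => by
  refine hasCoproducts_of_colimit_cofans (fun f => Cofan.mk (⟨Σ i, (f i).obj₀, Σ i, (f i).obj₁,
    fun x => ⟨x.1, (f x.1).map x.2⟩⟩ : Biset.{u})
    (fun i => Hom.mk (fun x => ⟨i, x⟩) (fun x => ⟨i, x⟩) (fun _ => rfl))) (fun f =>
      Cofan.IsColimit.mk _
      (fun s => Hom.mk (fun x => (s.inj x.1).h₀ x.2) (fun x => (s.inj x.1).h₁ x.2)
        (fun x => (s.inj x.1).comm x.2)) (fun _ _ => rfl) (fun s m h => ?_)) ι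
  apply hom_ext
  · intro x
    exact congrFun (congrArg Hom.h₀ (h x.1)) x.2
  · intro x
    exact congrFun (congrArg Hom.h₁ (h x.1)) x.2

end Biset

end Bisets

section Maps

universe v w a
variable (V : Type w) [Category.{v} V] [MonoidalCategory V] {A : Type a} [EnrichedCategory V A]

/-- A map `X → Y` in a `V`-category, i.e. a morphism `I → A(X, Y)` in `V`. -/
abbrev EMap (X Y : A) := 𝟙_ V ⟶ EnrichedCategory.Hom (V := V) X Y

variable {V}

/-- Composition of maps (diagrammatic order). -/
def EMap.comp {X Y Z : A} (f : EMap V X Y) (g : EMap V Y Z) : EMap V X Z :=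
  (λ_ (𝟙_ V)).inv ≫ (f ⊗ₘ g) ≫ eComp V X Y Z

/-- Postcomposition `A(X, Y) → A(X, Z)` with a map `Y → Z`. -/
def EMap.post (X : A) {Y Z : A} (g : EMap V Y Z) :
    EnrichedCategory.Hom (V := V) X Y ⟶ EnrichedCategory.Hom (V := V) X Z :=
  (ρ_ _).inv ≫ (_ ◁ g) ≫ eComp V X Y Z

/-- Precomposition `A(Y, Z) → A(X, Z)` with a map `X → Y`. -/
def EMap.pre {X Y : A} (f : EMap V X Y) (Z : A) :
    EnrichedCategory.Hom (V := V) Y Z ⟶ EnrichedCategory.Hom (V := V) X Z :=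
  (λ_ _).inv ≫ (f ▷ _) ≫ eComp V X Y Z

variable (V) in
/-- An isomorphism in a `V`-category. -/
structure EIso (X Y : A) where
  hom : EMap V X Y
  inv : EMap V Y X
  hom_inv_id : hom.comp inv = eId V X
  inv_hom_id : inv.comp hom = eId V Y

/-- The isomorphism of the underlying category given by an isomorphism in a `V`-category. -/
def EIso.toIso {X Y : A} (e : EIso V X Y) :
    ForgetEnrichment.of V X ≅ ForgetEnrichment.of V Y where
  hom := ForgetEnrichment.homOf V e.hom
  inv := ForgetEnrichment.homOf V e.inv
  hom_inv_id := by
    rw [← ForgetEnrichment.homOf_comp, ← ForgetEnrichment.homOf_eId]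
    exact congrArg _ e.hom_inv_id
  inv_hom_id := by
    rw [← ForgetEnrichment.homOf_comp, ← ForgetEnrichment.homOf_eId]
    exact congrArg _ e.inv_hom_id

theorem EMap.comp_eq_post {X Y Z : A} (f : EMap V X Y) (g : EMap V Y Z) :
    f.comp g = f ≫ g.post X := by
  simp only [EMap.comp, EMap.post, MonoidalCategory.tensorHom_def, Category.assoc, unitors_inv_equal]
  rw [rightUnitor_inv_naturality_assoc]

theorem EMap.comp_eq_pre {X Y Z : A} (f : EMap V X Y) (g : EMap V Y Z) :
    f.comp g = g ≫ f.pre Z := by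
  simp only [EMap.comp, EMap.pre, MonoidalCategory.tensorHom_def', Category.assoc]
  rw [leftUnitor_inv_naturality_assoc]

/-- The image of a map under a `V`-functor. -/
def EMap.image {B : Type*} [EnrichedCategory V B] (F : EnrichedFunctor V A B) {X Y : A}
    (f : EMap V X Y) : EMap V (F.obj X) (F.obj Y) :=
  f ≫ F.map X Y

theorem eId_eq_comp (Y : A) :
    (λ_ (𝟙_ V)).inv ≫ (eId V Y ⊗ₘ eId V Y) ≫ eComp V Y Y Y = eId V Y := by
  rw [MonoidalCategory.tensorHom_def', Category.assoc, ← leftUnitor_inv_naturality_assoc,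
    e_id_comp, Category.comp_id]

end Maps

section Adjunctions

universe v w a b
variable {V : Type w} [Category.{v} V] [MonoidalCategory V]
variable {A : Type a} [EnrichedCategory V A] {B : Type b} [EnrichedCategory V B]

/-- A `V`-adjunction `L ⊣ R`: isomorphisms `B(L X, Y) ≅ A(X, R Y)` in `V`, `V`-natural in `X`
and in `Y`. -/
structure EnrichedAdjunction (L : EnrichedFunctor V A B) (R : EnrichedFunctor V B A) where
  homIso : ∀ (X : A) (Y : B),
    EnrichedCategory.Hom (V := V) (L.obj X) Y ≅ EnrichedCategory.Hom (V := V) X (R.obj Y)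
  naturality_right : ∀ (X : A) (Y Y' : B),
    eComp V (L.obj X) Y Y' ≫ (homIso X Y').hom =
      ((homIso X Y).hom ⊗ₘ R.map Y Y') ≫ eComp V X (R.obj Y) (R.obj Y')
  naturality_left : ∀ (X X' : A) (Y : B),
    (L.map X X' ▷ _) ≫ eComp V (L.obj X) (L.obj X') Y ≫ (homIso X Y).hom =
      (_ ◁ (homIso X' Y).hom) ≫ eComp V X X' (R.obj Y)

end Adjunctions

section Coproducts

universe v w a
variable {V : Type w} [Category.{v} V] [MonoidalCategory V] {A : Type a} [EnrichedCategory V A]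

/-- The maps `inj i : X i → P` exhibit `P` as the (enriched) coproduct of the family `X`:
for every `Z`, the morphisms `A(P, Z) → A(X i, Z)` exhibit `A(P, Z)` as the product in `V` of
the objects `A(X i, Z)`. -/
def IsEnrichedCoproduct {ι : Type*} (X : ι → A) (P : A) (inj : ∀ i, EMap V (X i) P) : Prop :=
  ∀ Z : A, Nonempty (IsLimit (Fan.mk (f := fun i => EnrichedCategory.Hom (V := V) (X i) Z)
    (EnrichedCategory.Hom (V := V) P Z) (fun i => (inj i).pre Z)))

variable (V A) in
/-- Every small family of objects has an enriched coproduct. -/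
def HasEnrichedCoproducts : Prop :=
  ∀ (ι : Type v) (X : ι → A), ∃ (P : A) (inj : ∀ i, EMap V (X i) P), IsEnrichedCoproduct X P inj

end Coproducts

section Monoidal

universe v w a b
variable (V : Type w) [Category.{v} V] [MonoidalCategory V] [BraidedCategory V]
variable (A : Type a) [EnrichedCategory V A]

/-- The data of a symmetric monoidal structure on a `V`-category. -/
structure EnrichedMonoidalData where
  unit : A
  obj : A → A → A
  tensor : ∀ X₁ Y₁ X₂ Y₂ : A,
    EnrichedCategory.Hom (V := V) X₁ Y₁ ⊗ EnrichedCategory.Hom (V := V) X₂ Y₂ ⟶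
      EnrichedCategory.Hom (V := V) (obj X₁ X₂) (obj Y₁ Y₂)
  left : ∀ X : A, EIso V (obj unit X) X
  right : ∀ X : A, EIso V (obj X unit) X
  swap : ∀ X Y : A, EIso V (obj X Y) (obj Y X)
  assoc : ∀ X Y Z : A, EIso V (obj (obj X Y) Z) (obj X (obj Y Z))

variable {V A} in
/-- The tensor product `f ⊗ g` of two maps. -/
def EnrichedMonoidalData.map (S : EnrichedMonoidalData V A) {X₁ Y₁ X₂ Y₂ : A}
    (f : EMap V X₁ Y₁) (g : EMap V X₂ Y₂) : EMap V (S.obj X₁ X₂) (S.obj Y₁ Y₂) :=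
  (λ_ (𝟙_ V)).inv ≫ (f ⊗ₘ g) ≫ S.tensor X₁ Y₁ X₂ Y₂

/-- A symmetric monoidal `V`-category. -/
structure EnrichedSymmetricMonoidal extends EnrichedMonoidalData V A where
  tensor_id : ∀ X Y : A, toEnrichedMonoidalData.map (eId V X) (eId V Y) = eId V (obj X Y)
  tensor_comp : ∀ X₁ X₂ Y₁ Y₂ Z₁ Z₂ : A,
    tensorμ (EnrichedCategory.Hom (V := V) X₁ Y₁) (EnrichedCategory.Hom X₂ Y₂)
        (EnrichedCategory.Hom Y₁ Z₁) (EnrichedCategory.Hom Y₂ Z₂) ≫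
      (eComp V X₁ Y₁ Z₁ ⊗ₘ eComp V X₂ Y₂ Z₂) ≫ tensor X₁ Z₁ X₂ Z₂ =
    (tensor X₁ Y₁ X₂ Y₂ ⊗ₘ tensor Y₁ Z₁ Y₂ Z₂) ≫ eComp V (obj X₁ X₂) (obj Y₁ Y₂) (obj Z₁ Z₂)
  left_naturality : ∀ X Y : A,
    (λ_ _).inv ≫ (eId V unit ▷ _) ≫ tensor unit unit X Y ≫ (left Y).hom.post _ =
      (left X).hom.pre Y
  right_naturality : ∀ X Y : A,
    (ρ_ _).inv ≫ (_ ◁ eId V unit) ≫ tensor X Y unit unit ≫ (right Y).hom.post _ =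
      (right X).hom.pre Y
  swap_naturality : ∀ X₁ Y₁ X₂ Y₂ : A,
    tensor X₁ Y₁ X₂ Y₂ ≫ (swap Y₁ Y₂).hom.post _ =
      (β_ _ _).hom ≫ tensor X₂ Y₂ X₁ Y₁ ≫ (swap X₁ X₂).hom.pre _
  assoc_naturality : ∀ X₁ Y₁ X₂ Y₂ X₃ Y₃ : A,
    (tensor X₁ Y₁ X₂ Y₂ ▷ _) ≫ tensor (obj X₁ X₂) (obj Y₁ Y₂) X₃ Y₃ ≫
        (assoc Y₁ Y₂ Y₃).hom.post _ =
      (α_ _ _ _).hom ≫ (_ ◁ tensor X₂ Y₂ X₃ Y₃) ≫ tensor X₁ Y₁ (obj X₂ X₃) (obj Y₂ Y₃) ≫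
        (assoc X₁ X₂ X₃).hom.pre _
  pentagon : ∀ W X Y Z : A,
    (toEnrichedMonoidalData.map (assoc W X Y).hom (eId V Z)).comp
        ((assoc W (obj X Y) Z).hom.comp
          (toEnrichedMonoidalData.map (eId V W) (assoc X Y Z).hom)) =
      (assoc (obj W X) Y Z).hom.comp (assoc W X (obj Y Z)).hom
  triangle : ∀ X Y : A,
    (assoc X unit Y).hom.comp (toEnrichedMonoidalData.map (eId V X) (left Y).hom) =
      toEnrichedMonoidalData.map (right X).hom (eId V Y)
  hexagon : ∀ X Y Z : A,
    (assoc X Y Z).hom.comp ((swap X (obj Y Z)).hom.comp (assoc Y Z X).hom) =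
      (toEnrichedMonoidalData.map (swap X Y).hom (eId V Z)).comp
        ((assoc Y X Z).hom.comp (toEnrichedMonoidalData.map (eId V Y) (swap X Z).hom))
  symmetry : ∀ X Y : A, (swap X Y).hom.comp (swap Y X).hom = eId V (obj X Y)

variable {V A}

theorem rightUnitor_inv_tensor_tensorμ (X Y : V) :
    ((ρ_ X).inv ⊗ₘ (ρ_ Y).inv) ≫ tensorμ X (𝟙_ V) Y (𝟙_ V) =
      (ρ_ (X ⊗ Y)).inv ≫ ((X ⊗ Y) ◁ (λ_ (𝟙_ V)).inv) := by
  have h := rightUnitor_monoidal X Y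
  rw [← cancel_mono (((X ⊗ Y) ◁ (λ_ (𝟙_ V)).hom) ≫ (ρ_ (X ⊗ Y)).hom), Category.assoc, ← h]
  simp

/-- The `V`-functor `- ⊗ Y`. -/
def EnrichedSymmetricMonoidal.tensorRight (S : EnrichedSymmetricMonoidal V A) (Y : A) :
    EnrichedFunctor V A A where
  obj X := S.obj X Y
  map X X' := (ρ_ _).inv ≫ (_ ◁ eId V Y) ≫ S.tensor X X' Y Y
  map_id X := by
    rw [← S.tensor_id, EnrichedMonoidalData.map, MonoidalCategory.tensorHom_def, unitors_inv_equal,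
      Category.assoc, rightUnitor_inv_naturality_assoc]
  map_comp X X' X'' := by
    rw [← tensorHom_comp_tensorHom, ← tensorHom_comp_tensorHom, Category.assoc, Category.assoc,
      ← S.tensor_comp]
    simp only [← id_tensorHom]
    rw [tensorμ_natural_assoc, reassoc_of% rightUnitor_inv_tensor_tensorμ (V := V),
      tensorHom_comp_tensorHom_assoc, id_tensorHom_id, Category.id_comp, ← id_tensorHom,
      tensorHom_comp_tensorHom_assoc, Category.id_comp, eId_eq_comp,
      rightUnitor_inv_naturality_assoc, ← tensorHom_id, tensorHom_comp_tensorHom_assoc,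
      Category.id_comp, Category.comp_id]

end Monoidal

section StrongMonoidal

universe v w a b
variable {V : Type w} [Category.{v} V] [MonoidalCategory V] [BraidedCategory V]
variable {A : Type a} [EnrichedCategory V A] {B : Type b} [EnrichedCategory V B]

/-- A strong monoidal structure on a `V`-functor. -/
structure EnrichedStrongMonoidal (S : EnrichedMonoidalData V A) (R : EnrichedMonoidalData V B)
    (F : EnrichedFunctor V A B) where
  ε : EIso V R.unit (F.obj S.unit)
  μ : ∀ X Y : A, EIso V (R.obj (F.obj X) (F.obj Y)) (F.obj (S.obj X Y))
  μ_naturality : ∀ X₁ Y₁ X₂ Y₂ : A,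
    (F.map X₁ Y₁ ⊗ₘ F.map X₂ Y₂) ≫ R.tensor _ _ _ _ ≫ (μ Y₁ Y₂).hom.post _ =
      S.tensor X₁ Y₁ X₂ Y₂ ≫ F.map _ _ ≫ (μ X₁ X₂).hom.pre _
  associativity : ∀ X Y Z : A,
    (R.map (μ X Y).hom (eId V (F.obj Z))).comp
        ((μ (S.obj X Y) Z).hom.comp ((S.assoc X Y Z).hom.image F)) =
      (R.assoc (F.obj X) (F.obj Y) (F.obj Z)).hom.comp
        ((R.map (eId V (F.obj X)) (μ Y Z).hom).comp (μ X (S.obj Y Z)).hom)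
  left_unitality : ∀ X : A,
    (R.left (F.obj X)).hom =
      (R.map ε.hom (eId V (F.obj X))).comp ((μ S.unit X).hom.comp ((S.left X).hom.image F))
  right_unitality : ∀ X : A,
    (R.right (F.obj X)).hom =
      (R.map (eId V (F.obj X)) ε.hom).comp ((μ X S.unit).hom.comp ((S.right X).hom.image F))

/-- A strong monoidal structure on an ordinary functor. -/
structure StrongMonoidal {C : Type*} [Category C] (S : MonoidalCategoryStruct C)
    {D : Type*} [Category D] (R : MonoidalCategoryStruct D) (F : C ⥤ D) where
  ε : R.tensorUnit ≅ F.obj S.tensorUnit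
  μ : ∀ X Y : C, R.tensorObj (F.obj X) (F.obj Y) ≅ F.obj (S.tensorObj X Y)
  μ_naturality : ∀ {X₁ Y₁ X₂ Y₂ : C} (f : X₁ ⟶ Y₁) (g : X₂ ⟶ Y₂),
    R.tensorHom (F.map f) (F.map g) ≫ (μ Y₁ Y₂).hom = (μ X₁ X₂).hom ≫ F.map (S.tensorHom f g)
  associativity : ∀ X Y Z : C,
    R.tensorHom (μ X Y).hom (𝟙 (F.obj Z)) ≫ (μ (S.tensorObj X Y) Z).hom ≫
        F.map (S.associator X Y Z).hom =
      (R.associator (F.obj X) (F.obj Y) (F.obj Z)).hom ≫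
        R.tensorHom (𝟙 (F.obj X)) (μ Y Z).hom ≫ (μ X (S.tensorObj Y Z)).hom
  left_unitality : ∀ X : C,
    (R.leftUnitor (F.obj X)).hom =
      R.tensorHom ε.hom (𝟙 (F.obj X)) ≫ (μ S.tensorUnit X).hom ≫ F.map (S.leftUnitor X).hom
  right_unitality : ∀ X : C,
    (R.rightUnitor (F.obj X)).hom =
      R.tensorHom (𝟙 (F.obj X)) ε.hom ≫ (μ X S.tensorUnit).hom ≫ F.map (S.rightUnitor X).hom

/-- The tensor product, unit and structural isomorphisms that a monoidal structure on a
`V`-category induces on the underlying category. -/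
abbrev EnrichedMonoidalData.underlying (S : EnrichedMonoidalData V A) :
    MonoidalCategoryStruct (ForgetEnrichment V A) where
  tensorObj X Y := ForgetEnrichment.of V (S.obj (ForgetEnrichment.to V X) (ForgetEnrichment.to V Y))
  tensorUnit := ForgetEnrichment.of V S.unit
  tensorHom f g :=
    ForgetEnrichment.homOf V (S.map (ForgetEnrichment.homTo V f) (ForgetEnrichment.homTo V g))
  whiskerLeft X _ _ g :=
    ForgetEnrichment.homOf V
      (S.map (eId V (ForgetEnrichment.to V X)) (ForgetEnrichment.homTo V g))
  whiskerRight f Y :=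
    ForgetEnrichment.homOf V
      (S.map (ForgetEnrichment.homTo V f) (eId V (ForgetEnrichment.to V Y)))
  associator X Y Z :=
    (S.assoc (ForgetEnrichment.to V X) (ForgetEnrichment.to V Y) (ForgetEnrichment.to V Z)).toIso
  leftUnitor X := (S.left (ForgetEnrichment.to V X)).toIso
  rightUnitor X := (S.right (ForgetEnrichment.to V X)).toIso

end StrongMonoidal

section Self

universe v w
variable (V : Type w) [Category.{v} V] [MonoidalCategory V] [BraidedCategory V] [MonoidalClosed V]

variable {V} in
/-- An isomorphism of `V`, as an isomorphism in the `V`-category `V`. -/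
def EIso.ofIso {X Y : V} (e : X ≅ Y) : EIso V X Y where
  hom := MonoidalClosed.curry' e.hom
  inv := MonoidalClosed.curry' e.inv
  hom_inv_id := by
    refine (MonoidalClosed.curry'_comp e.hom e.inv).symm.trans ?_
    rw [e.hom_inv_id]
    exact MonoidalClosed.curry'_id X
  inv_hom_id := by
    refine (MonoidalClosed.curry'_comp e.inv e.hom).symm.trans ?_
    rw [e.inv_hom_id]
    exact MonoidalClosed.curry'_id Y

/-- The symmetric monoidal structure of `V`, regarded as a `V`-category. -/
def selfMonoidalData : EnrichedMonoidalData V V where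
  unit := 𝟙_ V
  obj X Y := X ⊗ Y
  tensor X₁ Y₁ X₂ Y₂ := MonoidalClosed.curry
    (tensorμ X₁ X₂ ((ihom X₁).obj Y₁) ((ihom X₂).obj Y₂) ≫
      ((ihom.ev X₁).app Y₁ ⊗ₘ (ihom.ev X₂).app Y₂))
  left X := EIso.ofIso (λ_ X)
  right X := EIso.ofIso (ρ_ X)
  swap X Y := EIso.ofIso (β_ X Y)
  assoc X Y Z := EIso.ofIso (α_ X Y Z)

end Self

section Monads

universe v w a
variable (V : Type w) [Category.{v} V] [MonoidalCategory V] (A : Type a) [EnrichedCategory V A]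

/-- A `V`-monad on a `V`-category. -/
structure EnrichedMonad where
  T : EnrichedFunctor V A A
  η : ∀ X : A, EMap V X (T.obj X)
  μ : ∀ X : A, EMap V (T.obj (T.obj X)) (T.obj X)
  η_naturality : ∀ X Y : A, (η Y).post X = T.map X Y ≫ (η X).pre (T.obj Y)
  μ_naturality : ∀ X Y : A,
    T.map X Y ≫ T.map _ _ ≫ (μ Y).post (T.obj (T.obj X)) = T.map X Y ≫ (μ X).pre (T.obj Y)
  assoc : ∀ X : A, ((μ X).image T).comp (μ X) = (μ (T.obj X)).comp (μ X)
  left_unit : ∀ X : A, (η (T.obj X)).comp (μ X) = eId V (T.obj X)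
  right_unit : ∀ X : A, ((η X).image T).comp (μ X) = eId V (T.obj X)

variable {V A}

theorem EnrichedMonad.comp_η (M : EnrichedMonad V A) {X Y : A} (f : EMap V X Y) :
    f.comp (M.η Y) = (M.η X).comp (f.image M.T) := by
  rw [EMap.comp_eq_post, M.η_naturality, EMap.comp_eq_pre, EMap.image, Category.assoc]

theorem EnrichedMonad.comp_μ (M : EnrichedMonad V A) {X Y : A} (f : EMap V X Y) :
    ((f.image M.T).image M.T).comp (M.μ Y) = (M.μ X).comp (f.image M.T) := by
  rw [EMap.comp_eq_post, EMap.comp_eq_pre, EMap.image, EMap.image, Category.assoc,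
    Category.assoc, Category.assoc, M.μ_naturality]

/-- The monad on the underlying category given by a `V`-monad. -/
def EnrichedMonad.underlying (M : EnrichedMonad V A) : Monad (ForgetEnrichment V A) where
  toFunctor := M.T.forget
  η :=
    { app := fun X => ForgetEnrichment.homOf V (M.η (ForgetEnrichment.to V X))
      naturality := fun _ _ f => (ForgetEnrichment.homOf_comp V _ _).symm.trans
        ((congrArg (ForgetEnrichment.homOf V) (M.comp_η (ForgetEnrichment.homTo V f))).trans
          (ForgetEnrichment.homOf_comp V _ _)) }
  μ :=
    { app := fun X => ForgetEnrichment.homOf V (M.μ (ForgetEnrichment.to V X))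
      naturality := fun _ _ f => (ForgetEnrichment.homOf_comp V _ _).symm.trans
        ((congrArg (ForgetEnrichment.homOf V) (M.comp_μ (ForgetEnrichment.homTo V f))).trans
          (ForgetEnrichment.homOf_comp V _ _)) }
  assoc X := (ForgetEnrichment.homOf_comp V _ _).symm.trans
    ((congrArg (ForgetEnrichment.homOf V) (M.assoc (ForgetEnrichment.to V X))).trans
      (ForgetEnrichment.homOf_comp V _ _))
  left_unit X := (ForgetEnrichment.homOf_comp V _ _).symm.trans
    ((congrArg (ForgetEnrichment.homOf V) (M.left_unit (ForgetEnrichment.to V X))).trans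
      (ForgetEnrichment.homOf_eId V _))
  right_unit X := (ForgetEnrichment.homOf_comp V _ _).symm.trans
    ((congrArg (ForgetEnrichment.homOf V) (M.right_unit (ForgetEnrichment.to V X))).trans
      (ForgetEnrichment.homOf_eId V _))

/-- A family of maps `t_{X,Y} : X ⊗ TY → T(X ⊗ Y)`. -/
abbrev StrengthData (S : EnrichedMonoidalData V A) (M : EnrichedMonad V A) :=
  ∀ X Y : A, EMap V (S.obj X (M.T.obj Y)) (M.T.obj (S.obj X Y))

/-- The costrength `TX ⊗ Y → Y ⊗ TX → T(Y ⊗ X) → T(X ⊗ Y)` of a strength `t`. -/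
def costrength {S : EnrichedMonoidalData V A} {M : EnrichedMonad V A} (t : StrengthData S M)
    (X Y : A) : EMap V (S.obj (M.T.obj X) Y) (M.T.obj (S.obj X Y)) :=
  (S.swap (M.T.obj X) Y).hom.comp ((t Y X).comp ((S.swap Y X).hom.image M.T))

/-- `t` is a strength for the `V`-monad `M`, and `M` is commutative with respect to it. -/
structure IsCommutativeStrength (S : EnrichedMonoidalData V A) (M : EnrichedMonad V A)
    (t : StrengthData S M) : Prop where
  naturality : ∀ X₁ Y₁ X₂ Y₂ : A,
    (_ ◁ M.T.map X₂ Y₂) ≫ S.tensor X₁ Y₁ (M.T.obj X₂) (M.T.obj Y₂) ≫ (t Y₁ Y₂).post _ =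
      S.tensor X₁ Y₁ X₂ Y₂ ≫ M.T.map _ _ ≫ (t X₁ X₂).pre _
  unit : ∀ X Y : A, (S.map (eId V X) (M.η Y)).comp (t X Y) = M.η (S.obj X Y)
  mult : ∀ X Y : A,
    (S.map (eId V X) (M.μ Y)).comp (t X Y) =
      (t X (M.T.obj Y)).comp (((t X Y).image M.T).comp (M.μ (S.obj X Y)))
  assoc : ∀ X Y Z : A,
    (t (S.obj X Y) Z).comp ((S.assoc X Y Z).hom.image M.T) =
      (S.assoc X Y (M.T.obj Z)).hom.comp ((S.map (eId V X) (t Y Z)).comp (t X (S.obj Y Z)))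
  left : ∀ X : A, (t S.unit X).comp ((S.left X).hom.image M.T) = (S.left (M.T.obj X)).hom
  comm : ∀ X Y : A,
    (costrength t X (M.T.obj Y)).comp (((t X Y).image M.T).comp (M.μ (S.obj X Y))) =
      (t (M.T.obj X) Y).comp (((costrength t X Y).image M.T).comp (M.μ (S.obj X Y)))

/-- The tensor product of two Kleisli maps:
`X₁ ⊗ X₂ → TY₁ ⊗ TY₂ → T(Y₁ ⊗ TY₂) → TT(Y₁ ⊗ Y₂) → T(Y₁ ⊗ Y₂)`. -/
def kleisliTensor {S : EnrichedMonoidalData V A} {M : EnrichedMonad V A} (t : StrengthData S M)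
    {X₁ Y₁ X₂ Y₂ : A} (f : EMap V X₁ (M.T.obj Y₁)) (g : EMap V X₂ (M.T.obj Y₂)) :
    EMap V (S.obj X₁ X₂) (M.T.obj (S.obj Y₁ Y₂)) :=
  (S.map f g).comp ((costrength t Y₁ (M.T.obj Y₂)).comp
    (((t Y₁ Y₂).image M.T).comp (M.μ (S.obj Y₁ Y₂))))

/-- The tensor product, unit and structural isomorphisms on the Kleisli category of the
underlying monad. -/
abbrev kleisliMonoidal {S : EnrichedMonoidalData V A} {M : EnrichedMonad V A}
    (t : StrengthData S M) : MonoidalCategoryStruct (Kleisli M.underlying) where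
  tensorObj X Y := Kleisli.mk _ (S.underlying.tensorObj X.of Y.of)
  tensorUnit := Kleisli.mk _ S.underlying.tensorUnit
  tensorHom f g := Kleisli.Hom.mk (ForgetEnrichment.homOf V
    (kleisliTensor t (ForgetEnrichment.homTo V f.of) (ForgetEnrichment.homTo V g.of)))
  whiskerLeft X _ _ g := Kleisli.Hom.mk (ForgetEnrichment.homOf V
    (kleisliTensor t (M.η (ForgetEnrichment.to V X.of)) (ForgetEnrichment.homTo V g.of)))
  whiskerRight f Y := Kleisli.Hom.mk (ForgetEnrichment.homOf V
    (kleisliTensor t (ForgetEnrichment.homTo V f.of) (M.η (ForgetEnrichment.to V Y.of))))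
  associator X Y Z :=
    (Kleisli.Adjunction.toKleisli M.underlying).mapIso (S.underlying.associator X.of Y.of Z.of)
  leftUnitor X :=
    (Kleisli.Adjunction.toKleisli M.underlying).mapIso (S.underlying.leftUnitor X.of)
  rightUnitor X :=
    (Kleisli.Adjunction.toKleisli M.underlying).mapIso (S.underlying.rightUnitor X.of)

end Monads

section Convexity

/-- A convexity structure on a set: `sum p q _ _ _ x y` is the convex sum `p x + q y`, for
`p, q ∈ [0, 1]` with `p + q = 1`. -/
structure ConvexStructure (X : Type*) where
  sum : ∀ p q : ℝ, 0 ≤ p → 0 ≤ q → p + q = 1 → X → X → X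
  sum_self : ∀ p q hp hq h (x : X), sum p q hp hq h x x = x
  sum_comm : ∀ p q hp hq h (x y : X),
    sum p q hp hq h x y = sum q p hq hp ((add_comm q p).trans h) y x
  zero_one : ∀ x y : X, sum 0 1 le_rfl zero_le_one (zero_add 1) x y = y
  interchange : ∀ (a b c d : ℝ) (ha : 0 ≤ a) (hb : 0 ≤ b) (hc : 0 ≤ c) (hd : 0 ≤ d)
    (h : a + b + c + d = 1) (hab : a + b ≠ 0) (hcd : c + d ≠ 0) (hac : a + c ≠ 0)
    (hbd : b + d ≠ 0) (x y z w : X),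
    sum (a + b) (c + d) (add_nonneg ha hb) (add_nonneg hc hd) (by linarith)
        (sum (a / (a + b)) (b / (a + b)) (div_nonneg ha (add_nonneg ha hb))
          (div_nonneg hb (add_nonneg ha hb)) (by rw [← add_div, div_self hab]) x y)
        (sum (c / (c + d)) (d / (c + d)) (div_nonneg hc (add_nonneg hc hd))
          (div_nonneg hd (add_nonneg hc hd)) (by rw [← add_div, div_self hcd]) z w) =
      sum (a + c) (b + d) (add_nonneg ha hc) (add_nonneg hb hd) (by linarith)
        (sum (a / (a + c)) (c / (a + c)) (div_nonneg ha (add_nonneg ha hc))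
          (div_nonneg hc (add_nonneg ha hc)) (by rw [← add_div, div_self hac]) x z)
        (sum (b / (b + d)) (d / (b + d)) (div_nonneg hb (add_nonneg hb hd))
          (div_nonneg hd (add_nonneg hb hd)) (by rw [← add_div, div_self hbd]) y w)

/-- An enrichment of a category in convex spaces: convexity structures on the hom-sets for which
composition is bilinear. -/
structure ConvexEnrichment (C : Type*) [Category C] where
  conv : ∀ X Y : C, ConvexStructure (X ⟶ Y)
  sum_comp : ∀ (p q : ℝ) (hp : 0 ≤ p) (hq : 0 ≤ q) (h : p + q = 1) {X Y Z : C}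
    (f g : X ⟶ Y) (k : Y ⟶ Z),
    (conv X Y).sum p q hp hq h f g ≫ k = (conv X Z).sum p q hp hq h (f ≫ k) (g ≫ k)
  comp_sum : ∀ (p q : ℝ) (hp : 0 ≤ p) (hq : 0 ≤ q) (h : p + q = 1) {X Y Z : C}
    (k : X ⟶ Y) (f g : Y ⟶ Z),
    k ≫ (conv Y Z).sum p q hp hq h f g = (conv X Z).sum p q hp hq h (k ≫ f) (k ≫ g)

end Convexity

section Setting

universe u

/-- A small symmetric monoidal category with set of objects `Ob`, tensor unit `I` and tensor
product of objects `t`. -/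
structure SymmetricMonoidalOn (Ob : Type u) (I : Ob) (t : Ob → Ob → Ob) where
  Hom : Ob → Ob → Type u
  id : ∀ X, Hom X X
  comp : ∀ {X Y Z}, Hom X Y → Hom Y Z → Hom X Z
  id_comp : ∀ {X Y} (f : Hom X Y), comp (id X) f = f
  comp_id : ∀ {X Y} (f : Hom X Y), comp f (id Y) = f
  comp_assoc : ∀ {W X Y Z} (f : Hom W X) (g : Hom X Y) (h : Hom Y Z),
    comp (comp f g) h = comp f (comp g h)
  tensor : ∀ {X₁ Y₁ X₂ Y₂}, Hom X₁ Y₁ → Hom X₂ Y₂ → Hom (t X₁ X₂) (t Y₁ Y₂)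
  tensor_id : ∀ X Y, tensor (id X) (id Y) = id (t X Y)
  tensor_comp : ∀ {X₁ Y₁ Z₁ X₂ Y₂ Z₂} (f₁ : Hom X₁ Y₁) (f₂ : Hom X₂ Y₂) (g₁ : Hom Y₁ Z₁)
    (g₂ : Hom Y₂ Z₂), comp (tensor f₁ f₂) (tensor g₁ g₂) = tensor (comp f₁ g₁) (comp f₂ g₂)
  left : ∀ X, Hom (t I X) X
  leftInv : ∀ X, Hom X (t I X)
  right : ∀ X, Hom (t X I) X
  rightInv : ∀ X, Hom X (t X I)
  assoc : ∀ X Y Z, Hom (t (t X Y) Z) (t X (t Y Z))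
  assocInv : ∀ X Y Z, Hom (t X (t Y Z)) (t (t X Y) Z)
  swap : ∀ X Y, Hom (t X Y) (t Y X)
  left_inv : ∀ X, comp (left X) (leftInv X) = id _
  inv_left : ∀ X, comp (leftInv X) (left X) = id _
  right_inv : ∀ X, comp (right X) (rightInv X) = id _
  inv_right : ∀ X, comp (rightInv X) (right X) = id _
  assoc_inv : ∀ X Y Z, comp (assoc X Y Z) (assocInv X Y Z) = id _
  inv_assoc : ∀ X Y Z, comp (assocInv X Y Z) (assoc X Y Z) = id _
  symmetry : ∀ X Y, comp (swap X Y) (swap Y X) = id _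
  left_naturality : ∀ {X Y} (f : Hom X Y), comp (tensor (id I) f) (left Y) = comp (left X) f
  right_naturality : ∀ {X Y} (f : Hom X Y), comp (tensor f (id I)) (right Y) = comp (right X) f
  assoc_naturality : ∀ {X₁ X₂ X₃ Y₁ Y₂ Y₃} (f₁ : Hom X₁ Y₁) (f₂ : Hom X₂ Y₂) (f₃ : Hom X₃ Y₃),
    comp (tensor (tensor f₁ f₂) f₃) (assoc Y₁ Y₂ Y₃) =
      comp (assoc X₁ X₂ X₃) (tensor f₁ (tensor f₂ f₃))
  swap_naturality : ∀ {X₁ Y₁ X₂ Y₂} (f₁ : Hom X₁ Y₁) (f₂ : Hom X₂ Y₂),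
    comp (tensor f₁ f₂) (swap Y₁ Y₂) = comp (swap X₁ X₂) (tensor f₂ f₁)
  pentagon : ∀ W X Y Z,
    comp (tensor (assoc W X Y) (id Z)) (comp (assoc W (t X Y) Z) (tensor (id W) (assoc X Y Z))) =
      comp (assoc (t W X) Y Z) (assoc W X (t Y Z))
  triangle : ∀ X Y,
    comp (assoc X I Y) (tensor (id X) (left Y)) = tensor (right X) (id Y)
  hexagon : ∀ X Y Z,
    comp (assoc X Y Z) (comp (swap X (t Y Z)) (assoc Y Z X)) =
      comp (tensor (swap X Y) (id Z)) (comp (assoc Y X Z) (tensor (id Y) (swap X Z)))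

namespace SymmetricMonoidalOn

variable {Ob : Type u} {I : Ob} {t : Ob → Ob → Ob}

/-- The objects of the category `M`, as a type of its own. -/
def Carrier (_M : SymmetricMonoidalOn Ob I t) : Type u := Ob

instance (M : SymmetricMonoidalOn Ob I t) : Category.{u} M.Carrier where
  Hom := M.Hom
  id := M.id
  comp := M.comp
  id_comp := M.id_comp
  comp_id := M.comp_id
  assoc := M.comp_assoc

instance (M : SymmetricMonoidalOn Ob I t) : MonoidalCategoryStruct M.Carrier where
  tensorObj := t
  tensorUnit := I
  tensorHom := M.tensor
  whiskerLeft X _ _ f := M.tensor (M.id X) f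
  whiskerRight f Y := M.tensor f (M.id Y)
  associator X Y Z := ⟨M.assoc X Y Z, M.assocInv X Y Z, M.assoc_inv X Y Z, M.inv_assoc X Y Z⟩
  leftUnitor X := ⟨M.left X, M.leftInv X, M.left_inv X, M.inv_left X⟩
  rightUnitor X := ⟨M.right X, M.rightInv X, M.right_inv X, M.inv_right X⟩

instance (M : SymmetricMonoidalOn Ob I t) : MonoidalCategory M.Carrier :=
  MonoidalCategory.ofTensorHom M.tensor_id (fun _ _ _ _ => rfl) (fun _ _ => rfl)
    M.tensor_comp M.assoc_naturality M.left_naturality M.right_naturality M.pentagon M.triangle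

end SymmetricMonoidalOn

/-- A strict symmetric monoidal functor that is the identity on objects. -/
structure StrictMonoidal {Ob : Type u} {I : Ob} {t : Ob → Ob → Ob}
    (M Q : SymmetricMonoidalOn Ob I t) where
  map : ∀ {X Y}, M.Hom X Y → Q.Hom X Y
  map_id : ∀ X, map (M.id X) = Q.id X
  map_comp : ∀ {X Y Z} (f : M.Hom X Y) (g : M.Hom Y Z), map (M.comp f g) = Q.comp (map f) (map g)
  map_tensor : ∀ {X₁ Y₁ X₂ Y₂} (f : M.Hom X₁ Y₁) (g : M.Hom X₂ Y₂),
    map (M.tensor f g) = Q.tensor (map f) (map g)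
  map_left : ∀ X, map (M.left X) = Q.left X
  map_right : ∀ X, map (M.right X) = Q.right X
  map_assoc : ∀ X Y Z, map (M.assoc X Y Z) = Q.assoc X Y Z
  map_swap : ∀ X Y, map (M.swap X Y) = Q.swap X Y

/-- `X → Z ← Y` is a coproduct diagram. -/
def IsBinaryCoproduct {C : Type*} [Category C] {X Y Z : C} (i : X ⟶ Z) (j : Y ⟶ Z) : Prop :=
  Nonempty (IsColimit (BinaryCofan.mk i j))

/-- The data over which the construction is carried out: small symmetric monoidal categories `M`
(circuits) and `Q` (quantum operations) with the same objects and tensor products of objects,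
an interpretation functor `J : M → Q`, an object `Bit = I + I` of `Q`, and convex sums in `Q`. -/
structure CircuitSetting where
  Ob : Type u
  I : Ob
  tensorObj : Ob → Ob → Ob
  M : SymmetricMonoidalOn Ob I tensorObj
  Q : SymmetricMonoidalOn Ob I tensorObj
  J : StrictMonoidal M Q
  Bit : Ob
  zero : M.Hom I Bit
  one : M.Hom I Bit
  bit_coproduct : IsBinaryCoproduct (C := Q.Carrier) (J.map zero) (J.map one)
  distributive : ∀ {X Y Z : Q.Carrier} (i : X ⟶ Z) (j : Y ⟶ Z), IsBinaryCoproduct i j →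
    ∀ W : Q.Carrier, IsBinaryCoproduct (W ◁ i) (W ◁ j)
  convex : ConvexEnrichment Q.Carrier

/-- The interpretation functor, as a functor. -/
def CircuitSetting.interp (𝒮 : CircuitSetting.{u}) : 𝒮.M.Carrier ⥤ 𝒮.Q.Carrier where
  obj X := X
  map f := 𝒮.J.map f
  map_id := 𝒮.J.map_id
  map_comp := 𝒮.J.map_comp

end Setting

section Model

universe u v w a

/-- A `V`-category `A` being a model for Proto-Quipper with dynamic lifting. -/
structure ProtoQuipperModel (𝒮 : CircuitSetting.{u})
    (V : Type w) [Category.{v} V] [CartesianMonoidalCategory V] [BraidedCategory V]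
    [MonoidalClosed V] [HasCoproducts.{v} V]
    (A : Type a) [EnrichedCategory V A] where
  /-- (a) `A` is symmetric monoidal closed. -/
  monoidal : EnrichedSymmetricMonoidal V A
  hom : A → EnrichedFunctor V A A
  homAdj : ∀ X : A, EnrichedAdjunction (monoidal.tensorRight X) (hom X)
  /-- (b) `A` has coproducts. -/
  coproducts : HasEnrichedCoproducts V A
  /-- (c) The linear-non-linear adjunction. -/
  p : EnrichedFunctor V V A
  flat : EnrichedFunctor V A V
  adj : EnrichedAdjunction p flat
  pMonoidal : EnrichedStrongMonoidal (selfMonoidalData V) monoidal.toEnrichedMonoidalData p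
  /-- (d) The commutative strong monad. -/
  monad : EnrichedMonad V A
  strength : StrengthData monoidal.toEnrichedMonoidalData monad
  commutativeStrong : IsCommutativeStrength monoidal.toEnrichedMonoidalData monad strength
  /-- (e) The Kleisli category of the underlying monad is enriched in convex spaces. -/
  convex : ConvexEnrichment (Kleisli monad.underlying)
  /-- (f) The embeddings of `M` and `Q`. -/
  ψ : 𝒮.M.Carrier ⥤ ForgetEnrichment V A
  ψFullyFaithful : ψ.FullyFaithful
  ψMonoidal : StrongMonoidal inferInstance monoidal.underlying ψ
  φ : 𝒮.Q.Carrier ⥤ Kleisli monad.underlying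
  φFullyFaithful : φ.FullyFaithful
  φMonoidal : StrongMonoidal inferInstance (kleisliMonoidal strength) φ
  φ_sum : ∀ (p q : ℝ) (hp : 0 ≤ p) (hq : 0 ≤ q) (h : p + q = 1) {S U : 𝒮.Q.Carrier} (f g : S ⟶ U),
    φ.map ((𝒮.convex.conv S U).sum p q hp hq h f g) =
      (convex.conv (φ.obj S) (φ.obj U)).sum p q hp hq h (φ.map f) (φ.map g)
  interp_comp_φ : 𝒮.interp ⋙ φ = ψ ⋙ Kleisli.Adjunction.toKleisli monad.underlying
  /-- (g) The box/unbox isomorphism. -/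
  box : ∀ S U : 𝒮.M.Carrier,
    flat.obj ((hom (ForgetEnrichment.to V (ψ.obj S))).obj (ForgetEnrichment.to V (ψ.obj U))) ≅
      EnrichedCategory.Hom (V := V) (ForgetEnrichment.to V (ψ.obj S))
        (ForgetEnrichment.to V (ψ.obj U))
  /-- (h) Dynamic lifting, where `Bool = I + I` and `Bit = ψ Bit`. -/
  dynamicLifting : ∀ (𝔹 : A) (inj : Bool → EMap V monoidal.unit 𝔹),
    IsEnrichedCoproduct (fun _ => monoidal.unit) 𝔹 inj →
    ∃ (init : EMap V 𝔹 (ForgetEnrichment.to V (ψ.obj 𝒮.Bit)))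
      (dyn : EMap V (ForgetEnrichment.to V (ψ.obj 𝒮.Bit)) (monad.T.obj 𝔹)),
      init.comp dyn = monad.η 𝔹

end Model

section Presheaves

universe u
variable (𝒮 : CircuitSetting.{u})

/-- The objects of the biset-enriched category `C`. -/
abbrev CircuitSetting.C : Type u := 𝒮.Ob

/-- The biset-enriched category `C`, with `C(A, B) = (Q(A, B), M(A, B), J)`. -/
instance : EnrichedCategory Biset.{u} 𝒮.C where
  Hom A B := ⟨𝒮.Q.Hom A B, 𝒮.M.Hom A B, 𝒮.J.map⟩
  id A := ⟨fun _ => 𝒮.Q.id A, fun _ => 𝒮.M.id A, fun _ => 𝒮.J.map_id A⟩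
  comp _ _ _ := ⟨fun x => 𝒮.Q.comp x.1 x.2, fun x => 𝒮.M.comp x.1 x.2,
    fun x => 𝒮.J.map_comp x.1 x.2⟩
  id_comp _ _ := Biset.hom_ext (fun f => 𝒮.Q.id_comp f) (fun f => 𝒮.M.id_comp f)
  comp_id _ _ := Biset.hom_ext (fun f => 𝒮.Q.comp_id f) (fun f => 𝒮.M.comp_id f)
  assoc _ _ _ _ := Biset.hom_ext (fun x => 𝒮.Q.comp_assoc x.1 x.2.1 x.2.2)
    (fun x => 𝒮.M.comp_assoc x.1 x.2.1 x.2.2)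

/-- Biset-enriched presheaves on `C`: biset-enriched functors from the opposite of `C` to the
biset-enriched category of bisets. -/
abbrev CircuitSetting.Presheaf := EnrichedFunctor Biset.{u} 𝒮.Cᵒᵖ Biset.{u}

variable {𝒮}

namespace CircuitSetting.Presheaf

/-- The action of a morphism of `Q` on the level-zero sets of a presheaf. -/
def act₀ (F : 𝒮.Presheaf) {A B : 𝒮.C} (f : 𝒮.Q.Hom B A) :
    (F.obj (Opposite.op A)).obj₀ → (F.obj (Opposite.op B)).obj₀ :=
  (F.map (Opposite.op A) (Opposite.op B)).h₀ f

/-- The action of a morphism of `M` on the values of a presheaf. -/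
def act₁ (F : 𝒮.Presheaf) {A B : 𝒮.C} (f : 𝒮.M.Hom B A) :
    F.obj (Opposite.op A) ⟶ F.obj (Opposite.op B) :=
  (F.map (Opposite.op A) (Opposite.op B)).h₁ f

/-- The presheaf of sets `F⁰` on `Q` underlying a biset-enriched presheaf `F` on `C`. -/
def levelZero (F : 𝒮.Presheaf) : 𝒮.Q.Carrierᵒᵖ ⥤ Type u where
  obj A := (F.obj (Opposite.op (A.unop : 𝒮.Ob))).obj₀
  map f := ↾(F.act₀ f.unop)
  map_id A := by
    ext x
    exact congrFun (congrFun (congrArg Biset.Hom.h₀ (F.map_id (Opposite.op (A.unop : 𝒮.Ob))))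
      PUnit.unit) x
  map_comp {X Y Z} f g := by
    ext x
    exact congrFun (congrFun (congrArg Biset.Hom.h₀ (F.map_comp (Opposite.op (X.unop : 𝒮.Ob))
      (Opposite.op (Y.unop : 𝒮.Ob)) (Opposite.op (Z.unop : 𝒮.Ob)))) (f.unop, g.unop)) x

/-- The biset of natural transformations between two presheaves: the end of the bisets
`F A ⇒ G A`. -/
def natBiset (F G : 𝒮.Presheaf) : Biset.{u} where
  obj₀ := { β : ∀ A : 𝒮.C, (F.obj (Opposite.op A)).obj₀ → (G.obj (Opposite.op A)).obj₀ //
    ∀ (A B : 𝒮.C) (g : 𝒮.Q.Hom B A) (x : (F.obj (Opposite.op A)).obj₀),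
      β B (F.act₀ g x) = G.act₀ g (β A x) }
  obj₁ := { α : ∀ A : 𝒮.C, F.obj (Opposite.op A) ⟶ G.obj (Opposite.op A) //
    (∀ (A B : 𝒮.C) (f : 𝒮.M.Hom B A), F.act₁ f ≫ α B = α A ≫ G.act₁ f) ∧
    ∀ (A B : 𝒮.C) (g : 𝒮.Q.Hom B A) (x : (F.obj (Opposite.op A)).obj₀),
      (α B).h₀ (F.act₀ g x) = G.act₀ g ((α A).h₀ x) }
  map α := ⟨fun A => (α.1 A).h₀, α.2.2⟩

end CircuitSetting.Presheaf

/-- The biset-enriched category of presheaves on `C`. -/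
instance : EnrichedCategory Biset.{u} 𝒮.Presheaf where
  Hom F G := F.natBiset G
  id F := ⟨fun _ => ⟨fun _ x => x, fun _ _ _ _ => rfl⟩,
    fun _ => ⟨fun _ => 𝟙 _, ⟨fun _ _ _ => rfl, fun _ _ _ _ => rfl⟩⟩, fun _ => rfl⟩
  comp _ _ _ := ⟨fun x => ⟨fun A y => x.2.1 A (x.1.1 A y), fun A B g y =>
      (congrArg (x.2.1 B) (x.1.2 A B g y)).trans (x.2.2 A B g (x.1.1 A y))⟩,
    fun x => ⟨fun A => x.1.1 A ≫ x.2.1 A, ⟨fun A B f => by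
      rw [← Category.assoc, x.1.2.1, Category.assoc, x.2.2.1, Category.assoc], fun A B g y => by
      rw [Biset.comp_h₀, x.1.2.2, x.2.2.2, Biset.comp_h₀]⟩⟩, fun _ => rfl⟩
  id_comp _ _ := rfl
  comp_id _ _ := rfl
  assoc _ _ _ _ := rfl

/-- A presheaf `F` is smooth if `F⁰ : Qᵒᵖ → Set` is product-preserving: it sends the coproducts
`X → Z ← Y` of `Q` to products. -/
def CircuitSetting.Presheaf.IsSmooth (F : 𝒮.Presheaf) : Prop :=
  ∀ {X Y Z : 𝒮.Q.Carrier} (i : X ⟶ Z) (j : Y ⟶ Z), IsBinaryCoproduct i j →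
    Function.Bijective fun x : F.levelZero.obj (Opposite.op Z) =>
      (F.levelZero.map i.op x, F.levelZero.map j.op x)

variable (𝒮) in
/-- The objects of `C̃`: the smooth presheaves. -/
structure CircuitSetting.SmoothPresheaf where
  presheaf : 𝒮.Presheaf
  smooth : presheaf.IsSmooth

/-- `C̃`, the full biset-enriched subcategory of smooth presheaves. -/
instance : EnrichedCategory Biset.{u} 𝒮.SmoothPresheaf where
  Hom F G := EnrichedCategory.Hom F.presheaf G.presheaf
  id F := EnrichedCategory.id F.presheaf
  comp F G H := EnrichedCategory.comp F.presheaf G.presheaf H.presheaf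
  id_comp F G := EnrichedCategory.id_comp F.presheaf G.presheaf
  comp_id F G := EnrichedCategory.comp_id F.presheaf G.presheaf
  assoc F G H K := EnrichedCategory.assoc F.presheaf G.presheaf H.presheaf K.presheaf

end Presheaves

end ProtoQuipper

universe u

/-! A smooth presheaf amounts to three things: a presheaf of sets `lev₀` on `Q` that sends binary
coproducts to products, a presheaf `lev₁` on `M`, and a comparison `lmap` from `lev₁` to the
restriction of `lev₀` along `J`. A 0-element of a hom-biset is a natural transformation between the
`lev₀` parts. A 1-element is a pair of transformations compatible with the comparisons. Nearly every
construction and every equation is therefore handled one level at a time, followed by a check of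
compatibility.

Both levels are instances of one notion: a `Sheaf` for a `CoverClass`, that is, for a class of
coproduct cocones stable under tensoring. On `Q` the class consists of all binary coproducts, and
stability is the distributivity hypothesis; on `M` the class is empty. For any such class, sheaves
are symmetric monoidal closed. The tensor product is the reflection of Day convolution, and
stability makes `A ↦ Z (C ⊗ A)` a sheaf again, which yields the internal hom. Reflections are built
syntactically: `Presentation.sheaf` is the free sheaf on generators and relations, with restriction
and gluing as operations, and its universal property is `Presentation.desc` together with
`Presentation.hom_ext`. Tensor products, copowers `S · I` and coproducts all arise in this way, and
equations between maps out of them are checked on generators.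

The functor `p` is the levelwise copower of the unit, and `♭` is evaluation at `I`. The monad `T`
replaces level one by level zero. A map into `T Y` is thus the same as a transformation on level
zero (`emap_ext_liftObj`, `kleisliEquiv`), so the Kleisli category is a full subcategory of sheaves
on `Q`, and the laws of the commutative strong monad are equations about identities and a doubled
swap. Both embeddings are Yoneda embeddings.

Convex sums come from `A ⊗ Bit = A + A` in `Q`. Two elements `x`, `y` of `F A` glue to one element
of `F (A ⊗ Bit)`, and `p x + q y` is its restriction along `p inl + q inr`. Since several elements
are always restrictions of a single one, the laws follow from those of `Q` through
`res_convexSum_hom`. Dynamic lifting has the same origin: a smooth presheaf at `Bit = I + I` is the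
square of its value at `I`, so the two injections into `Bool` glue to a level-zero map out of `Bit`.
-/

namespace ProtoQuipper

/-! ### Sheaves for a tensor-stable class of binary coproduct cocones. -/

section Sheaves

variable {Ob : Type u} {I : Ob} {t : Ob → Ob → Ob}

/-- A class of coproduct cocones `X → Z ← Y` that is stable under tensoring with objects. -/
structure CoverClass (K : SymmetricMonoidalOn Ob I t) where
  cov : ∀ {X Y Z : Ob}, K.Hom X Z → K.Hom Y Z → Prop
  tensor_left : ∀ {X Y Z : Ob} {i : K.Hom X Z} {j : K.Hom Y Z}, cov i j →
    ∀ W : Ob, cov (K.tensor (K.id W) i) (K.tensor (K.id W) j)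
  tensor_right : ∀ {X Y Z : Ob} {i : K.Hom X Z} {j : K.Hom Y Z}, cov i j →
    ∀ W : Ob, cov (K.tensor i (K.id W)) (K.tensor j (K.id W))
  desc : ∀ {X Y Z : Ob} {i : K.Hom X Z} {j : K.Hom Y Z}, cov i j → ∀ B : Ob,
    Function.Bijective fun f : K.Hom Z B => (K.comp i f, K.comp j f)

/-- The empty class of cocones. -/
def CoverClass.empty (K : SymmetricMonoidalOn Ob I t) : CoverClass K where
  cov _ _ := False
  tensor_left h := h.elim
  tensor_right h := h.elim
  desc h := h.elim

variable {K : SymmetricMonoidalOn Ob I t}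

/-- A presheaf of sets on `K` that sends the chosen cocones to products. -/
structure Sheaf (W : CoverClass K) where
  obj : Ob → Type u
  res : ∀ {A B : Ob}, K.Hom B A → obj A → obj B
  res_id : ∀ (A : Ob) (x : obj A), res (K.id A) x = x
  res_comp : ∀ {A B C : Ob} (f : K.Hom B A) (g : K.Hom C B) (x : obj A),
    res (K.comp g f) x = res g (res f x)
  bij : ∀ {X Y Z : Ob} (i : K.Hom X Z) (j : K.Hom Y Z), W.cov i j →
    Function.Bijective fun x : obj Z => (res i x, res j x)

namespace Sheaf

variable {W : CoverClass K}

attribute [simp] Sheaf.res_id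

@[simp]
theorem res_res (F : Sheaf W) {A B C : Ob} (f : K.Hom B A) (g : K.Hom C B) (x : F.obj A) :
    F.res g (F.res f x) = F.res (K.comp g f) x :=
  (F.res_comp f g x).symm

theorem cov_ext (F : Sheaf W) {X Y Z : Ob} {i : K.Hom X Z} {j : K.Hom Y Z} (h : W.cov i j)
    {x y : F.obj Z} (hi : F.res i x = F.res i y) (hj : F.res j x = F.res j y) : x = y :=
  (F.bij i j h).1 (Prod.ext hi hj)

/-- The element glued from its restrictions along a chosen cocone. -/
noncomputable def glue (F : Sheaf W) {X Y Z : Ob} {i : K.Hom X Z} {j : K.Hom Y Z}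
    (h : W.cov i j) (x : F.obj X) (y : F.obj Y) : F.obj Z :=
  ((F.bij i j h).2 (x, y)).choose

@[simp]
theorem res_glue_left (F : Sheaf W) {X Y Z : Ob} {i : K.Hom X Z} {j : K.Hom Y Z}
    (h : W.cov i j) (x : F.obj X) (y : F.obj Y) : F.res i (F.glue h x y) = x :=
  congrArg Prod.fst ((F.bij i j h).2 (x, y)).choose_spec

@[simp]
theorem res_glue_right (F : Sheaf W) {X Y Z : Ob} {i : K.Hom X Z} {j : K.Hom Y Z}
    (h : W.cov i j) (x : F.obj X) (y : F.obj Y) : F.res j (F.glue h x y) = y :=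
  congrArg Prod.snd ((F.bij i j h).2 (x, y)).choose_spec

/-- Natural transformations. -/
abbrev Hom (F G : Sheaf W) : Type u :=
  { β : ∀ A : Ob, F.obj A → G.obj A //
    ∀ (A B : Ob) (g : K.Hom B A) (x : F.obj A), β B (F.res g x) = G.res g (β A x) }

namespace Hom

variable {F G H : Sheaf W}

@[simp]
theorem app_res (α : Hom F G) {A B : Ob} (g : K.Hom B A) (x : F.obj A) :
    α.1 B (F.res g x) = G.res g (α.1 A x) :=
  α.2 A B g x

theorem ext {α β : Hom F G} (h : ∀ A x, α.1 A x = β.1 A x) : α = β :=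
  Subtype.ext (funext fun A => funext fun x => h A x)

def id (F : Sheaf W) : Hom F F := ⟨fun _ x => x, fun _ _ _ _ => rfl⟩

def comp (α : Hom F G) (β : Hom G H) : Hom F H :=
  ⟨fun A x => β.1 A (α.1 A x), fun A B g x =>
    (congrArg (β.1 B) (α.2 A B g x)).trans (β.2 A B g (α.1 A x))⟩

@[simp] theorem id_app (A : Ob) (x : F.obj A) : (id F).1 A x = x := rfl
@[simp] theorem comp_app (α : Hom F G) (β : Hom G H) (A : Ob) (x : F.obj A) :
    (comp α β).1 A x = β.1 A (α.1 A x) := rfl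

/-- A glued element is characterised by its two restrictions, and naturality preserves these. -/
theorem app_glue (α : Hom F G) {X Y Z : Ob} {i : K.Hom X Z} {j : K.Hom Y Z}
    (h : W.cov i j) (x : F.obj X) (y : F.obj Y) :
    α.1 Z (F.glue h x y) = G.glue h (α.1 X x) (α.1 Y y) := by
  apply G.cov_ext h <;> simp [← app_res]

end Hom

/-- The sheaf `A ↦ F (A ⊗ C)`. -/
abbrev shiftRight (F : Sheaf W) (C : Ob) : Sheaf W where
  obj A := F.obj (t A C)
  res f x := F.res (K.tensor f (K.id C)) x
  res_id A x := by rw [K.tensor_id, F.res_id]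
  res_comp f g x := by rw [F.res_res, K.tensor_comp, K.id_comp]
  bij i j h := F.bij _ _ (W.tensor_right h C)

/-- The sheaf `A ↦ F (C ⊗ A)`. -/
abbrev shiftLeft (F : Sheaf W) (C : Ob) : Sheaf W where
  obj A := F.obj (t C A)
  res f x := F.res (K.tensor (K.id C) f) x
  res_id A x := by rw [K.tensor_id, F.res_id]
  res_comp f g x := by rw [F.res_res, K.tensor_comp, K.id_comp]
  bij i j h := F.bij _ _ (W.tensor_left h C)

end Sheaf

/-! ### Free sheaves on generators and relations. -/

/-- A presentation of a sheaf by generators `g`, living over `sort g`, and relations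
`res hom src = tgt`. -/
structure Presentation (K : SymmetricMonoidalOn Ob I t) where
  Gen : Type u
  sort : Gen → Ob
  Rel : Type u
  src : Rel → Gen
  tgt : Rel → Gen
  hom : ∀ r, K.Hom (sort (tgt r)) (sort (src r))

namespace Presentation

variable (P : Presentation K) (W : CoverClass K)

/-- Formal expressions for the elements of the presented sheaf. -/
inductive Term : Ob → Type u
  | gen (g : P.Gen) : Term (P.sort g)
  | res {A B : Ob} (f : K.Hom B A) (x : Term A) : Term B
  | glue {X Y Z : Ob} (i : K.Hom X Z) (j : K.Hom Y Z) (h : W.cov i j) (x : Term X)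
      (y : Term Y) : Term Z

/-- Provable equality of formal expressions. -/
inductive Eqv : ∀ {A : Ob}, Term P W A → Term P W A → Prop
  | refl {A : Ob} (x : Term P W A) : Eqv x x
  | symm {A : Ob} {x y : Term P W A} : Eqv x y → Eqv y x
  | trans {A : Ob} {x y z : Term P W A} : Eqv x y → Eqv y z → Eqv x z
  | res {A B : Ob} (f : K.Hom B A) {x y : Term P W A} : Eqv x y → Eqv (.res f x) (.res f y)
  | glue {X Y Z : Ob} (i : K.Hom X Z) (j : K.Hom Y Z) (h : W.cov i j) {x x' : Term P W X}
      {y y' : Term P W Y} : Eqv x x' → Eqv y y' → Eqv (.glue i j h x y) (.glue i j h x' y')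
  | res_id {A : Ob} (x : Term P W A) : Eqv (.res (K.id A) x) x
  | res_comp {A B C : Ob} (f : K.Hom B A) (g : K.Hom C B) (x : Term P W A) :
      Eqv (.res (K.comp g f) x) (.res g (.res f x))
  | rel (r : P.Rel) : Eqv (.res (P.hom r) (.gen (P.src r))) (.gen (P.tgt r))
  | glue_left {X Y Z : Ob} (i : K.Hom X Z) (j : K.Hom Y Z) (h : W.cov i j) (x : Term P W X)
      (y : Term P W Y) : Eqv (.res i (.glue i j h x y)) x
  | glue_right {X Y Z : Ob} (i : K.Hom X Z) (j : K.Hom Y Z) (h : W.cov i j) (x : Term P W X)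
      (y : Term P W Y) : Eqv (.res j (.glue i j h x y)) y
  | cov_ext {X Y Z : Ob} (i : K.Hom X Z) (j : K.Hom Y Z) (h : W.cov i j) {x y : Term P W Z} :
      Eqv (.res i x) (.res i y) → Eqv (.res j x) (.res j y) → Eqv x y

def termSetoid (A : Ob) : Setoid (Term P W A) :=
  ⟨Eqv P W, Eqv.refl, Eqv.symm, Eqv.trans⟩

/-- The sheaf with the given presentation. -/
def sheaf : Sheaf W where
  obj A := Quotient (P.termSetoid W A)
  res f := Quotient.map (Term.res f) fun _ _ h => Eqv.res f h
  res_id A := by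
    rintro ⟨x⟩
    exact Quotient.sound (Eqv.res_id x)
  res_comp f g := by
    rintro ⟨x⟩
    exact Quotient.sound (Eqv.res_comp f g x)
  bij i j h := by
    constructor
    · rintro ⟨x⟩ ⟨y⟩ hxy
      exact Quotient.sound (Eqv.cov_ext i j h (Quotient.exact (congrArg Prod.fst hxy))
        (Quotient.exact (congrArg Prod.snd hxy)))
    · rintro ⟨⟨x⟩, ⟨y⟩⟩
      exact ⟨Quotient.mk _ (Term.glue i j h x y), Prod.ext
        (Quotient.sound (Eqv.glue_left i j h x y)) (Quotient.sound (Eqv.glue_right i j h x y))⟩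

variable {P W}

/-- The element denoted by a formal expression. -/
def ofTerm {A : Ob} (x : Term P W A) : (P.sheaf W).obj A :=
  Quotient.mk (P.termSetoid W A) x

/-- The elements given by the generators. -/
def gen (g : P.Gen) : (P.sheaf W).obj (P.sort g) :=
  ofTerm (Term.gen g)

theorem res_gen (r : P.Rel) :
    (P.sheaf W).res (P.hom r) (gen (P.src r)) = gen (P.tgt r) :=
  Quotient.sound (Eqv.rel r)

variable {Z : Sheaf W}

/-- The value of a formal expression. -/
noncomputable def Term.eval (v : ∀ g : P.Gen, Z.obj (P.sort g)) : ∀ {A : Ob}, Term P W A → Z.obj A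
  | _, .gen g => v g
  | _, .res f x => Z.res f (x.eval v)
  | _, .glue _ _ h x y => Z.glue h (x.eval v) (y.eval v)

/-- Soundness of the calculus: each rule of `Eqv` is a law valid in every sheaf in which the
prescribed values satisfy the relations. This is what lets evaluation descend to the quotient. -/
theorem Eqv.eval_eq {v : ∀ g : P.Gen, Z.obj (P.sort g)}
    (hv : ∀ r, Z.res (P.hom r) (v (P.src r)) = v (P.tgt r)) {A : Ob} {x y : Term P W A}
    (h : Eqv P W x y) : x.eval v = y.eval v := by
  induction h with
  | refl x => rfl
  | symm _ ih => exact ih.symm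
  | trans _ _ ih ih' => exact ih.trans ih'
  | res f _ ih => simp only [Term.eval, ih]
  | glue i j h _ _ ih ih' => simp only [Term.eval, ih, ih']
  | res_id x => simp only [Term.eval, Sheaf.res_id]
  | res_comp f g x => simp only [Term.eval, Sheaf.res_res]
  | rel r => exact hv r
  | glue_left i j h x y => simp only [Term.eval, Sheaf.res_glue_left]
  | glue_right i j h x y => simp only [Term.eval, Sheaf.res_glue_right]
  | cov_ext i j h _ _ ih ih' => exact Z.cov_ext h ih ih'

/-- The morphism out of a presented sheaf with prescribed values on generators. -/
noncomputable def desc (v : ∀ g : P.Gen, Z.obj (P.sort g))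
    (hv : ∀ r, Z.res (P.hom r) (v (P.src r)) = v (P.tgt r)) : (P.sheaf W).Hom Z :=
  ⟨fun _ => Quotient.lift (Term.eval v) fun _ _ h => h.eval_eq hv, by
    rintro A B g ⟨x⟩
    rfl⟩

/-- The generators generate under restriction and gluing, and natural transformations respect both
operations; hence induction on formal expressions. -/
theorem hom_ext {α β : (P.sheaf W).Hom Z} (h : ∀ g, α.1 _ (gen g) = β.1 _ (gen g)) : α = β := by
  apply Sheaf.Hom.ext
  rintro A ⟨x⟩
  change α.1 A (ofTerm x) = β.1 A (ofTerm x)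
  induction x with
  | gen g => exact h g
  | @res A B f x ih =>
    change α.1 B ((P.sheaf W).res f (ofTerm x)) = β.1 B ((P.sheaf W).res f (ofTerm x))
    rw [α.app_res, β.app_res, ih (ofTerm x)]
  | @glue X Y T i j h x y ihx ihy =>
    -- The restrictions of a formal gluing are its two constituents, to which the induction
    -- hypotheses apply.
    apply Z.cov_ext h
    · have e : (P.sheaf W).res i (ofTerm (Term.glue i j h x y)) = ofTerm x :=
        Quotient.sound (Eqv.glue_left i j h x y)
      rw [← α.app_res, ← β.app_res, e, ihx (ofTerm x)]
    · have e : (P.sheaf W).res j (ofTerm (Term.glue i j h x y)) = ofTerm y :=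
        Quotient.sound (Eqv.glue_right i j h x y)
      rw [← α.app_res, ← β.app_res, e, ihy (ofTerm y)]

end Presentation

/-! ### The tensor product of sheaves and its universal property. -/

namespace Sheaf

variable {W : CoverClass K}

/-- The presentation of the tensor product of two sheaves by pure tensors. -/
def tensorPresentation (F G : Sheaf W) : Presentation K where
  Gen := Σ B C, F.obj B × G.obj C
  sort g := t g.1 g.2.1
  Rel := Σ B C B' C', (F.obj B × G.obj C) × K.Hom B' B × K.Hom C' C
  src r := ⟨r.1, r.2.1, r.2.2.2.2.1⟩
  tgt r := ⟨r.2.2.1, r.2.2.2.1, F.res r.2.2.2.2.2.1 r.2.2.2.2.1.1,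
    G.res r.2.2.2.2.2.2 r.2.2.2.2.1.2⟩
  hom r := K.tensor r.2.2.2.2.2.1 r.2.2.2.2.2.2

/-- The tensor product of sheaves (the sheafified Day convolution). -/
def tensor (F G : Sheaf W) : Sheaf W := (tensorPresentation F G).sheaf W

variable {F G H : Sheaf W}

/-- Pure tensors. -/
def tmul {B C : Ob} (x : F.obj B) (y : G.obj C) : (tensor F G).obj (t B C) :=
  Presentation.gen (P := tensorPresentation F G) ⟨B, C, x, y⟩

theorem tmul_res_res {B C B' C' : Ob} (f : K.Hom B' B) (g : K.Hom C' C) (x : F.obj B)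
    (y : G.obj C) :
    tmul (F.res f x) (G.res g y) = (tensor F G).res (K.tensor f g) (tmul x y) :=
  (Presentation.res_gen (P := tensorPresentation F G) ⟨B, C, B', C', (x, y), f, g⟩).symm

@[simp]
theorem tmul_res_left {B C B' : Ob} (f : K.Hom B' B) (x : F.obj B) (y : G.obj C) :
    tmul (F.res f x) y = (tensor F G).res (K.tensor f (K.id C)) (tmul x y) := by
  rw [← tmul_res_res, res_id]

@[simp]
theorem tmul_res_right {B C C' : Ob} (g : K.Hom C' C) (x : F.obj B) (y : G.obj C) :
    tmul x (G.res g y) = (tensor F G).res (K.tensor (K.id B) g) (tmul x y) := by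
  rw [← tmul_res_res, res_id]

/-- The morphism out of a tensor product with prescribed values on pure tensors. -/
noncomputable def lift {Z : Sheaf W} (v : ∀ {B C : Ob}, F.obj B → G.obj C → Z.obj (t B C))
    (hv : ∀ {B C B' C' : Ob} (f : K.Hom B' B) (g : K.Hom C' C) (x : F.obj B) (y : G.obj C),
      v (F.res f x) (G.res g y) = Z.res (K.tensor f g) (v x y)) : (tensor F G).Hom Z :=
  Presentation.desc (P := tensorPresentation F G) (fun g => v g.2.2.1 g.2.2.2)
    (fun r => (hv r.2.2.2.2.2.1 r.2.2.2.2.2.2 _ _).symm)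

theorem tensor_ext {Z : Sheaf W} {α β : (tensor F G).Hom Z}
    (h : ∀ {B C : Ob} (x : F.obj B) (y : G.obj C), α.1 _ (tmul x y) = β.1 _ (tmul x y)) :
    α = β :=
  Presentation.hom_ext (P := tensorPresentation F G) fun g => h g.2.2.1 g.2.2.2

/-- The morphism `F → Z (- ⊗ C)` obtained by fixing the second factor. -/
def fixRight {Z : Sheaf W} (α : (tensor F G).Hom Z) {C : Ob} (y : G.obj C) :
    F.Hom (Z.shiftRight C) :=
  ⟨fun _ x => α.1 _ (tmul x y), fun A B g x => by
    simp⟩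

/-- The morphism `G → Z (B ⊗ -)` obtained by fixing the first factor. -/
def fixLeft {Z : Sheaf W} (α : (tensor F G).Hom Z) {B : Ob} (x : F.obj B) :
    G.Hom (Z.shiftLeft B) :=
  ⟨fun _ y => α.1 _ (tmul x y), fun A B g x => by
    simp⟩

variable {L : Sheaf W}

/-- Elements of the inner tensor product need not be pure. With the outer factor fixed, both sides
become morphisms from the inner tensor product into a shifted sheaf, where `tensor_ext` applies
again. That the shift is a sheaf is where stability of the cocones under tensoring enters. -/
theorem tensor_ext₃ {Z : Sheaf W} {α β : (tensor (tensor F G) H).Hom Z}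
    (h : ∀ {B C D : Ob} (x : F.obj B) (y : G.obj C) (z : H.obj D),
      α.1 _ (tmul (tmul x y) z) = β.1 _ (tmul (tmul x y) z)) : α = β :=
  tensor_ext fun u z => congrFun (congrFun (congrArg Subtype.val
    (tensor_ext (α := fixRight α z) (β := fixRight β z) fun x y => h x y z)) _) u

theorem tensor_ext₃' {Z : Sheaf W} {α β : (tensor F (tensor G H)).Hom Z}
    (h : ∀ {B C D : Ob} (x : F.obj B) (y : G.obj C) (z : H.obj D),
      α.1 _ (tmul x (tmul y z)) = β.1 _ (tmul x (tmul y z))) : α = β :=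
  tensor_ext fun x u => congrFun (congrFun (congrArg Subtype.val
    (tensor_ext (α := fixLeft α x) (β := fixLeft β x) fun y z => h x y z)) _) u

theorem tensor_ext₄ {Z : Sheaf W} {α β : (tensor (tensor (tensor F G) H) L).Hom Z}
    (h : ∀ {B C D E : Ob} (x : F.obj B) (y : G.obj C) (z : H.obj D) (w : L.obj E),
      α.1 _ (tmul (tmul (tmul x y) z) w) = β.1 _ (tmul (tmul (tmul x y) z) w)) : α = β :=
  tensor_ext fun u w => congrFun (congrFun (congrArg Subtype.val
    (tensor_ext₃ (α := fixRight α w) (β := fixRight β w) fun x y z => h x y z w)) _) u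

/-- The morphism out of a triple tensor product with prescribed values on pure tensors. -/
noncomputable def lift₃ {Z : Sheaf W}
    (v : ∀ {B C D : Ob}, F.obj B → G.obj C → H.obj D → Z.obj (t (t B C) D))
    (hv : ∀ {B C D B' C' D' : Ob} (f : K.Hom B' B) (g : K.Hom C' C) (h : K.Hom D' D)
      (x : F.obj B) (y : G.obj C) (z : H.obj D),
      v (F.res f x) (G.res g y) (H.res h z) =
        Z.res (K.tensor (K.tensor f g) h) (v x y z)) : (tensor (tensor F G) H).Hom Z :=
  lift (fun {_ D} u z => (lift (Z := Z.shiftRight D) (fun x y => v x y z) (fun f g x y => by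
      have := hv f g (K.id D) x y z
      rwa [H.res_id] at this)).1 _ u) (fun {B C B' C'} f g u z => by
    rw [Hom.app_res]
    -- Naturality in the outer variable: restricting `z` first and then lifting equals lifting and
    -- then restricting along `id ⊗ g`. Both are morphisms out of a tensor product, so pure tensors
    -- suffice.
    have e : (lift (Z := Z.shiftRight C') (fun x y => v x y (H.res g z))
        (fun {B C B' C'} f g' x y => by
        have := hv f g' (K.id _) x y (H.res g z)
        rwa [H.res_id] at this)) = Hom.comp (lift (Z := Z.shiftRight C) (fun x y => v x y z)
        (fun f g x y => by
          have := hv f g (K.id _) x y z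
          rwa [H.res_id] at this)) (⟨fun A x => Z.res (K.tensor (K.id A) g) x, fun A B f x => by
          simp [K.tensor_comp, K.id_comp, K.comp_id]⟩ :
            Hom (Z.shiftRight C) (Z.shiftRight C')) := by
      apply tensor_ext
      intro B' C'' x y
      have := hv (K.id _) (K.id _) g x y z
      rw [F.res_id, G.res_id, K.tensor_id] at this
      exact this
    rw [e]
    simp [K.tensor_comp, K.id_comp, K.comp_id])

/-- The morphism out of a triple tensor product with prescribed values on pure tensors. -/
noncomputable def lift₃' {Z : Sheaf W}
    (v : ∀ {B C D : Ob}, F.obj B → G.obj C → H.obj D → Z.obj (t B (t C D)))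
    (hv : ∀ {B C D B' C' D' : Ob} (f : K.Hom B' B) (g : K.Hom C' C) (h : K.Hom D' D)
      (x : F.obj B) (y : G.obj C) (z : H.obj D),
      v (F.res f x) (G.res g y) (H.res h z) =
        Z.res (K.tensor f (K.tensor g h)) (v x y z)) : (tensor F (tensor G H)).Hom Z :=
  lift (fun {B _} x u => (lift (Z := Z.shiftLeft B) (fun y z => v x y z) (fun g h y z => by
      have := hv (K.id B) g h x y z
      rwa [F.res_id] at this)).1 _ u) (fun {B C B' C'} f g x u => by
    rw [Hom.app_res]
    have e : (lift (Z := Z.shiftLeft B') (fun y z => v (F.res f x) y z) (fun g h y z => by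
        have := hv (K.id _) g h (F.res f x) y z
        rwa [F.res_id] at this)) = Hom.comp (lift (Z := Z.shiftLeft B) (fun y z => v x y z)
        (fun g h y z => by
          have := hv (K.id _) g h x y z
          rwa [F.res_id] at this)) (⟨fun A x => Z.res (K.tensor f (K.id A)) x, fun A B g x => by
          simp [K.tensor_comp, K.id_comp, K.comp_id]⟩ :
            Hom (Z.shiftLeft B) (Z.shiftLeft B')) := by
      apply tensor_ext
      intro C' D' y z
      have := hv f (K.id _) (K.id _) x y z
      rw [G.res_id, H.res_id, K.tensor_id] at this
      exact this
    rw [e]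
    simp [K.tensor_comp, K.id_comp, K.comp_id])

end Sheaf

end Sheaves

/-! ### The symmetric monoidal closed structure on sheaves. -/

section SheafMonoidal

variable {Ob : Type u} {I : Ob} {t : Ob → Ob → Ob} {K : SymmetricMonoidalOn Ob I t}

attribute [simp] SymmetricMonoidalOn.id_comp SymmetricMonoidalOn.comp_id
  SymmetricMonoidalOn.tensor_id SymmetricMonoidalOn.tensor_comp SymmetricMonoidalOn.comp_assoc

namespace SymmetricMonoidalOn

theorem leftInv_naturality (K : SymmetricMonoidalOn Ob I t) {X Y : Ob} (f : K.Hom X Y) :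
    K.comp (K.leftInv X) (K.tensor (K.id I) f) = K.comp f (K.leftInv Y) := by
  rw [← K.comp_id (K.comp (K.leftInv X) _), ← K.left_inv, ← K.comp_assoc,
    K.comp_assoc _ _ (K.left Y),
    K.left_naturality, ← K.comp_assoc (K.leftInv X), K.inv_left, K.id_comp]

theorem rightInv_naturality (K : SymmetricMonoidalOn Ob I t) {X Y : Ob} (f : K.Hom X Y) :
    K.comp (K.rightInv X) (K.tensor f (K.id I)) = K.comp f (K.rightInv Y) := by
  rw [← K.comp_id (K.comp (K.rightInv X) _), ← K.right_inv, ← K.comp_assoc,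
    K.comp_assoc _ _ (K.right Y),
    K.right_naturality, ← K.comp_assoc (K.rightInv X), K.inv_right, K.id_comp]

theorem assocInv_naturality (K : SymmetricMonoidalOn Ob I t) {X₁ X₂ X₃ Y₁ Y₂ Y₃ : Ob}
    (f₁ : K.Hom X₁ Y₁) (f₂ : K.Hom X₂ Y₂) (f₃ : K.Hom X₃ Y₃) :
    K.comp (K.tensor f₁ (K.tensor f₂ f₃)) (K.assocInv Y₁ Y₂ Y₃) =
      K.comp (K.assocInv X₁ X₂ X₃) (K.tensor (K.tensor f₁ f₂) f₃) := by
  rw [← K.comp_id (K.comp (K.assocInv X₁ X₂ X₃) _), ← K.assoc_inv, ← K.comp_assoc,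
    K.comp_assoc _ _ (K.assoc Y₁ Y₂ Y₃), K.assoc_naturality, ← K.comp_assoc (K.assocInv _ _ _),
    K.inv_assoc, K.id_comp]

end SymmetricMonoidalOn

namespace Sheaf

variable {W : CoverClass K}

/-- Representable sheaves. -/
abbrev rep (W : CoverClass K) (A : Ob) : Sheaf W where
  obj B := K.Hom B A
  res f x := K.comp f x
  res_id _ x := K.id_comp x
  res_comp f g x := K.comp_assoc g f x
  bij _ _ h := W.desc h A

/-- The Yoneda lemma. -/
def yoneda {F : Sheaf W} {A : Ob} (x : F.obj A) : (rep W A).Hom F :=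
  ⟨fun _ f => F.res f x, fun _ _ _ _ => F.res_comp _ _ _⟩

@[simp] theorem yoneda_app {F : Sheaf W} {A B : Ob} (x : F.obj A) (f : K.Hom B A) :
    (yoneda x).1 B f = F.res f x := rfl

theorem rep_ext {F : Sheaf W} {A : Ob} {α β : (rep W A).Hom F}
    (h : α.1 A (K.id A) = β.1 A (K.id A)) : α = β := by
  apply Hom.ext
  intro B f
  have e : f = (rep W A).res f (K.id A) := (K.comp_id f).symm
  rw [e, α.app_res, β.app_res, h]

/-- The functorial action of `rep`. -/
def repMap {A B : Ob} (f : K.Hom A B) : (rep W A).Hom (rep W B) := yoneda (F := rep W B) f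

@[simp] theorem repMap_app {A B C : Ob} (f : K.Hom A B) (g : K.Hom C A) :
    (repMap (W := W) f).1 C g = K.comp g f := rfl

variable {F G H L F' G' H' F'' G'' : Sheaf W}

/-- The tensor product of two morphisms. -/
noncomputable def tensorHom (α : F.Hom F') (β : G.Hom G') : (tensor F G).Hom (tensor F' G') :=
  lift (fun x y => tmul (α.1 _ x) (β.1 _ y)) fun f g x y => by simp

@[simp]
theorem tensorHom_tmul (α : F.Hom F') (β : G.Hom G') {B C : Ob} (x : F.obj B) (y : G.obj C) :
    (tensorHom α β).1 _ (tmul x y) = tmul (α.1 _ x) (β.1 _ y) := rfl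

theorem tensorHom_id (F G : Sheaf W) : tensorHom (Hom.id F) (Hom.id G) = Hom.id _ :=
  tensor_ext fun _ _ => rfl

theorem tensorHom_comp (α : F.Hom F') (β : G.Hom G') (α' : F'.Hom F'') (β' : G'.Hom G'') :
    tensorHom (α.comp α') (β.comp β') = (tensorHom α β).comp (tensorHom α' β') :=
  tensor_ext fun _ _ => rfl

/-- The left unitor. -/
noncomputable def left (F : Sheaf W) : (tensor (rep W I) F).Hom F :=
  lift (fun f x => F.res (K.comp (K.tensor f (K.id _)) (K.left _)) x) fun f g x y => by
    simp [← K.left_naturality, ← K.comp_assoc]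

@[simp]
theorem left_tmul {B C : Ob} (f : K.Hom B I) (x : F.obj C) :
    (left F).1 _ (tmul (F := rep W I) f x) = F.res (K.comp (K.tensor f (K.id _)) (K.left _)) x :=
  rfl

noncomputable def leftInv (F : Sheaf W) : F.Hom (tensor (rep W I) F) :=
  ⟨fun A x => (tensor _ _).res (K.leftInv A) (tmul (F := rep W I) (K.id I) x), fun A B f x => by
    simp [K.leftInv_naturality]⟩

theorem leftInv_app {A : Ob} (x : F.obj A) :
    (leftInv F).1 A x = (tensor _ _).res (K.leftInv A) (tmul (F := rep W I) (K.id I) x) := rfl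

theorem leftInv_left (F : Sheaf W) : (leftInv F).comp (left F) = Hom.id F :=
  Hom.ext fun A x => by simp [leftInv_app, K.inv_left]

/-- Every element of a representable is a restriction of the identity, so pure tensors with a
representable factor reduce to those containing an identity. This is the content of `left_leftInv`.
-/
theorem tmul_hom_left {A B C : Ob} (f : K.Hom B A) (x : F.obj C) :
    tmul (F := rep W A) f x = (tensor _ _).res (K.tensor f (K.id C))
      (tmul (F := rep W A) (K.id A) x) := by
  rw [← tmul_res_left]
  exact congrArg (fun g => tmul (F := rep W A) g x) (K.comp_id f).symm

theorem tmul_hom_right {A B C : Ob} (f : K.Hom B A) (x : F.obj C) :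
    tmul (G := rep W A) x f = (tensor _ _).res (K.tensor (K.id C) f)
      (tmul (G := rep W A) x (K.id A)) := by
  rw [← tmul_res_right]
  exact congrArg (fun g => tmul (G := rep W A) x g) (K.comp_id f).symm

theorem left_leftInv (F : Sheaf W) : (left F).comp (leftInv F) = Hom.id _ :=
  tensor_ext fun {B C} f x => by
    rw [Hom.comp_app, left_tmul, leftInv_app, tmul_res_right, res_res, K.leftInv_naturality,
      K.comp_assoc, K.left_inv, K.comp_id]
    exact (tmul_hom_left f x).symm

/-- The right unitor. -/
noncomputable def right (F : Sheaf W) : (tensor F (rep W I)).Hom F :=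
  lift (fun x f => F.res (K.comp (K.tensor (K.id _) f) (K.right _)) x) fun f g x y => by
    simp [← K.right_naturality, ← K.comp_assoc]

@[simp]
theorem right_tmul {B C : Ob} (f : K.Hom B I) (x : F.obj C) :
    (right F).1 _ (tmul (G := rep W I) x f) = F.res (K.comp (K.tensor (K.id _) f) (K.right _)) x :=
  rfl

noncomputable def rightInv (F : Sheaf W) : F.Hom (tensor F (rep W I)) :=
  ⟨fun A x => (tensor _ _).res (K.rightInv A) (tmul (G := rep W I) x (K.id I)), fun A B f x => by
    simp [K.rightInv_naturality]⟩

theorem rightInv_app {A : Ob} (x : F.obj A) :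
    (rightInv F).1 A x = (tensor _ _).res (K.rightInv A) (tmul (G := rep W I) x (K.id I)) := rfl

theorem rightInv_right (F : Sheaf W) : (rightInv F).comp (right F) = Hom.id F :=
  Hom.ext fun A x => by simp [rightInv_app, K.inv_right]

theorem right_rightInv (F : Sheaf W) : (right F).comp (rightInv F) = Hom.id _ :=
  tensor_ext fun {B C} x f => by
    rw [Hom.comp_app, right_tmul, rightInv_app, tmul_res_left, res_res, K.rightInv_naturality,
      K.comp_assoc, K.right_inv, K.comp_id]
    exact (tmul_hom_right f x).symm

/-- The associator. -/
noncomputable def assoc (F G H : Sheaf W) :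
    (tensor (tensor F G) H).Hom (tensor F (tensor G H)) :=
  lift₃ (fun x y z => (tensor _ _).res (K.assoc _ _ _) (tmul x (tmul y z)))
    fun f g h x y z => by simp [K.assoc_naturality]

@[simp]
theorem assoc_tmul {B C D : Ob} (x : F.obj B) (y : G.obj C) (z : H.obj D) :
    (assoc F G H).1 _ (tmul (tmul x y) z) =
      (tensor _ _).res (K.assoc _ _ _) (tmul x (tmul y z)) := rfl

noncomputable def assocInv (F G H : Sheaf W) :
    (tensor F (tensor G H)).Hom (tensor (tensor F G) H) :=
  lift₃' (fun x y z => (tensor _ _).res (K.assocInv _ _ _) (tmul (tmul x y) z))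
    fun f g h x y z => by simp [K.assocInv_naturality]

@[simp]
theorem assocInv_tmul {B C D : Ob} (x : F.obj B) (y : G.obj C) (z : H.obj D) :
    (assocInv F G H).1 _ (tmul x (tmul y z)) =
      (tensor _ _).res (K.assocInv _ _ _) (tmul (tmul x y) z) := rfl

theorem assoc_assocInv (F G H : Sheaf W) : (assoc F G H).comp (assocInv F G H) = Hom.id _ :=
  tensor_ext₃ fun x y z => by simp [K.assoc_inv]

theorem assocInv_assoc (F G H : Sheaf W) : (assocInv F G H).comp (assoc F G H) = Hom.id _ :=
  tensor_ext₃' fun x y z => by simp [K.inv_assoc]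

/-- The symmetry. -/
noncomputable def swap (F G : Sheaf W) : (tensor F G).Hom (tensor G F) :=
  lift (fun x y => (tensor _ _).res (K.swap _ _) (tmul y x)) fun f g x y => by
    simp [K.swap_naturality]

@[simp]
theorem swap_tmul {B C : Ob} (x : F.obj B) (y : G.obj C) :
    (swap F G).1 _ (tmul x y) = (tensor _ _).res (K.swap _ _) (tmul y x) := rfl

theorem swap_swap (F G : Sheaf W) : (swap F G).comp (swap G F) = Hom.id _ :=
  tensor_ext fun x y => by simp [K.symmetry]

theorem left_naturality (α : F.Hom G) :
    (tensorHom (Hom.id (rep W I)) α).comp (left G) = (left F).comp α :=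
  tensor_ext fun f x => by simp

theorem right_naturality (α : F.Hom G) :
    (tensorHom α (Hom.id (rep W I))).comp (right G) = (right F).comp α :=
  tensor_ext fun f x => by simp

theorem swap_naturality (α : F.Hom F') (β : G.Hom G') :
    (tensorHom α β).comp (swap F' G') = (swap F G).comp (tensorHom β α) :=
  tensor_ext fun x y => by simp

theorem assoc_naturality (α : F.Hom F') (β : G.Hom G') (γ : H.Hom H') :
    (tensorHom (tensorHom α β) γ).comp (assoc F' G' H') =
      (assoc F G H).comp (tensorHom α (tensorHom β γ)) :=
  tensor_ext₃ fun x y z => by simp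

theorem pentagon (F G H L : Sheaf W) :
    (tensorHom (assoc F G H) (Hom.id L)).comp
        ((assoc F (tensor G H) L).comp (tensorHom (Hom.id F) (assoc G H L))) =
      (assoc (tensor F G) H L).comp (assoc F G (tensor H L)) :=
  tensor_ext₄ fun x y z w => by simp [K.pentagon]

theorem triangle (F G : Sheaf W) :
    (assoc F (rep W I) G).comp (tensorHom (Hom.id F) (left G)) =
      tensorHom (right F) (Hom.id G) :=
  tensor_ext₃ fun {B C D} x f y => by
    -- On a pure tensor both sides are restrictions of `x ⊗ y`. Sliding `f` through the associator
    -- leaves exactly the triangle identity of the base category.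
    have h := K.assoc_naturality (K.id B) f (K.id D)
    simp only [Hom.comp_app, assoc_tmul, Hom.app_res, tensorHom_tmul, Hom.id_app, left_tmul,
      right_tmul, tmul_res_left, tmul_res_right, res_res]
    rw [← K.id_comp (K.id B), ← K.tensor_comp, ← K.comp_assoc, K.id_comp, ← h, K.comp_assoc,
      K.triangle, K.tensor_comp, K.id_comp]

theorem hexagon (F G H : Sheaf W) :
    (assoc F G H).comp ((swap F (tensor G H)).comp (assoc G H F)) =
      (tensorHom (swap F G) (Hom.id H)).comp
        ((assoc G F H).comp (tensorHom (Hom.id G) (swap F H))) :=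
  tensor_ext₃ fun x y z => by simp [K.hexagon]

/-! ### Internal homs and currying. -/

/-- The internal hom. -/
abbrev ihom (G Z : Sheaf W) : Sheaf W where
  obj A := G.Hom (Z.shiftLeft A)
  res {A B} f β := ⟨fun C x => Z.res (K.tensor f (K.id C)) (β.1 C x), fun C D g x => by
    simp⟩
  res_id A β := Hom.ext fun C x => by simp
  res_comp f g β := Hom.ext fun C x => by simp
  bij {X Y T} i j h := by
    constructor
    · intro β γ e
      apply Hom.ext
      intro C x
      apply Z.cov_ext (W.tensor_right h C)
      · exact congrFun (congrFun (congrArg (fun p => p.1.1) e) C) x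
      · exact congrFun (congrFun (congrArg (fun p => p.2.1) e) C) x
    · rintro ⟨β, γ⟩
      -- Transformations are glued pointwise, over the cocone tensored on the right with each `C`.
      -- Naturality of the result is tested after restricting along both legs tensored with `D`.
      refine ⟨⟨fun C x => Z.glue (W.tensor_right h C) (β.1 C x) (γ.1 C x), fun C D g x => ?_⟩,
        Prod.ext (Hom.ext fun C x => ?_) (Hom.ext fun C x => ?_)⟩
      · apply Z.cov_ext (W.tensor_right h D)
        · have e := Z.res_glue_left (W.tensor_right h C) (β.1 C x) (γ.1 C x)
          rw [Z.res_glue_left, Hom.app_res]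
          refine (congrArg (Z.res (K.tensor (K.id X) g)) e.symm).trans ?_
          simp only [res_res, K.tensor_comp, K.id_comp, K.comp_id]
        · have e := Z.res_glue_right (W.tensor_right h C) (β.1 C x) (γ.1 C x)
          rw [Z.res_glue_right, Hom.app_res]
          refine (congrArg (Z.res (K.tensor (K.id Y) g)) e.symm).trans ?_
          simp only [res_res, K.tensor_comp, K.id_comp, K.comp_id]
      · exact Z.res_glue_left (W.tensor_right h C) _ _
      · exact Z.res_glue_right (W.tensor_right h C) _ _

/-- Currying. -/
def curry {Z : Sheaf W} (α : (tensor F G).Hom Z) : F.Hom (ihom G Z) :=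
  ⟨fun _ x => fixLeft α x, fun A B f x => Hom.ext fun C y => by
    change α.1 _ (tmul _ _) = Z.res _ (α.1 _ (tmul _ _))
    simp⟩

noncomputable def uncurry {Z : Sheaf W} (β : F.Hom (ihom G Z)) : (tensor F G).Hom Z :=
  lift (fun x y => (β.1 _ x).1 _ y) fun f g x y => by simp

theorem uncurry_curry {Z : Sheaf W} (α : (tensor F G).Hom Z) : uncurry (curry α) = α :=
  tensor_ext fun _ _ => rfl

/-! ### Representables, copowers of the unit, and coproducts. -/

/-- The comparison `rep A ⊗ rep B → rep (A ⊗ B)`. -/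
noncomputable def repTensor (A B : Ob) : (tensor (rep W A) (rep W B)).Hom (rep W (t A B)) :=
  lift (fun f g => K.tensor f g) fun _ _ _ _ => (K.tensor_comp _ _ _ _).symm

@[simp]
theorem repTensor_tmul {A B C D : Ob} (f : K.Hom C A) (g : K.Hom D B) :
    (repTensor (W := W) A B).1 _ (tmul (F := rep W A) (G := rep W B) f g) = K.tensor f g := rfl

/-- By Yoneda it suffices to choose an element over `A ⊗ B`, namely the universal pure tensor. -/
noncomputable def repTensorInv (A B : Ob) : (rep W (t A B)).Hom (tensor (rep W A) (rep W B)) :=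
  yoneda (tmul (F := rep W A) (G := rep W B) (K.id A) (K.id B))

theorem repTensor_inv (A B : Ob) :
    (repTensor (W := W) A B).comp (repTensorInv A B) = Hom.id _ :=
  tensor_ext fun f g => by
    simp [repTensorInv, ← tmul_res_res]

theorem repTensorInv_repTensor (A B : Ob) :
    (repTensorInv (W := W) A B).comp (repTensor A B) = Hom.id _ :=
  rep_ext (by simp [repTensorInv])

theorem repTensor_naturality {A B A' B' : Ob} (f : K.Hom A A') (g : K.Hom B B') :
    (tensorHom (repMap (W := W) f) (repMap g)).comp (repTensor A' B') =
      (repTensor A B).comp (repMap (K.tensor f g)) :=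
  tensor_ext fun x y => by simp

theorem repTensor_assoc (A B C : Ob) :
    (tensorHom (repTensor (W := W) A B) (Hom.id _)).comp
        ((repTensor (t A B) C).comp (repMap (K.assoc A B C))) =
      (assoc _ _ _).comp ((tensorHom (Hom.id _) (repTensor B C)).comp (repTensor A (t B C))) :=
  tensor_ext₃ fun x y z => by simp [K.assoc_naturality]

theorem left_rep (A : Ob) :
    left (rep W A) = (repTensor I A).comp (repMap (K.left A)) :=
  tensor_ext fun f x => by
    simp [← K.left_naturality, ← K.comp_assoc]

theorem right_rep (A : Ob) :
    right (rep W A) = (repTensor A I).comp (repMap (K.right A)) :=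
  tensor_ext fun f x => by
    simp [← K.right_naturality, ← K.comp_assoc]

/-- The presentation of the copower `S · I` of the tensor unit by a set `S`. -/
def copowerPresentation (K : SymmetricMonoidalOn Ob I t) (S : Type u) : Presentation K where
  Gen := S
  sort _ := I
  Rel := PEmpty
  src r := r.elim
  tgt r := r.elim
  hom r := r.elim

/-- The copower `S · I` of the tensor unit by a set `S`. -/
def copower (W : CoverClass K) (S : Type u) : Sheaf W := (copowerPresentation K S).sheaf W

def copower.gen {S : Type u} (s : S) : (copower W S).obj I :=
  Presentation.gen (P := copowerPresentation K S) s

noncomputable def copower.desc {S : Type u} (v : S → F.obj I) : (copower W S).Hom F :=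
  Presentation.desc (P := copowerPresentation K S) v nofun

@[simp]
theorem copower.desc_gen {S : Type u} (v : S → F.obj I) (s : S) :
    (copower.desc v).1 I (copower.gen s) = v s := rfl

theorem copower.hom_ext {S : Type u} {α β : (copower W S).Hom F}
    (h : ∀ s, α.1 I (copower.gen s) = β.1 I (copower.gen s)) : α = β :=
  Presentation.hom_ext (P := copowerPresentation K S) h

/-- The presentation of the coproduct of a family of sheaves. -/
def coprodPresentation {ι : Type u} (X : ι → Sheaf W) : Presentation K where
  Gen := Σ (i : ι) (A : Ob), (X i).obj A
  sort g := g.2.1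
  Rel := Σ (i : ι) (A B : Ob), K.Hom B A × (X i).obj A
  src r := ⟨r.1, r.2.1, r.2.2.2.2⟩
  tgt r := ⟨r.1, r.2.2.1, (X r.1).res r.2.2.2.1 r.2.2.2.2⟩
  hom r := r.2.2.2.1

/-- The coproduct of a family of sheaves. -/
def coprod {ι : Type u} (X : ι → Sheaf W) : Sheaf W := (coprodPresentation X).sheaf W

def coprod.inj {ι : Type u} (X : ι → Sheaf W) (i : ι) : (X i).Hom (coprod X) :=
  ⟨fun A x => Presentation.gen (P := coprodPresentation X) ⟨i, A, x⟩, fun A B f x =>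
    (Presentation.res_gen (P := coprodPresentation X) ⟨i, A, B, f, x⟩).symm⟩

noncomputable def coprod.desc {ι : Type u} {X : ι → Sheaf W} (v : ∀ i, (X i).Hom F) :
    (coprod X).Hom F :=
  Presentation.desc (P := coprodPresentation X) (fun g => (v g.1).1 _ g.2.2)
    fun _ => ((v _).app_res _ _).symm

theorem coprod.hom_ext {ι : Type u} {X : ι → Sheaf W} {α β : (coprod X).Hom F}
    (h : ∀ i, (coprod.inj X i).comp α = (coprod.inj X i).comp β) : α = β :=
  Presentation.hom_ext (P := coprodPresentation X) fun g =>
    congrFun (congrFun (congrArg Subtype.val (h g.1)) _) g.2.2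

end Sheaf

end SheafMonoidal

/-! ### Decomposition of smooth presheaves into their two levels. -/

section Levels

variable {𝒮 : CircuitSetting.{u}}

/-- Injectivity is uniqueness of the induced morphism and surjectivity its existence. In this form
cocones can be transported along isomorphisms by composing bijections. -/
theorem isBinaryCoproduct_iff {C : Type*} [Category C] {X Y Z : C} (i : X ⟶ Z) (j : Y ⟶ Z) :
    IsBinaryCoproduct i j ↔
      ∀ B : C, Function.Bijective fun f : Z ⟶ B => (i ≫ f, j ≫ f) := by
  constructor
  · rintro ⟨h⟩ B
    constructor
    · intro f g e
      exact BinaryCofan.IsColimit.hom_ext h (congrArg Prod.fst e) (congrArg Prod.snd e)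
    · rintro ⟨f, g⟩
      obtain ⟨l, hl⟩ := BinaryCofan.IsColimit.desc' h f g
      exact ⟨l, Prod.ext hl.1 hl.2⟩
  · intro h
    refine ⟨BinaryCofan.IsColimit.mk _ (fun f g => ((h _).2 (f, g)).choose) (fun f g => ?_)
      (fun f g => ?_) (fun f g m hf hg => ?_)⟩
    · exact congrArg Prod.fst ((h _).2 (f, g)).choose_spec
    · exact congrArg Prod.snd ((h _).2 (f, g)).choose_spec
    · exact (h _).1 ((Prod.ext hf hg).trans ((h _).2 (f, g)).choose_spec.symm)

theorem CircuitSetting.isBinaryCoproduct_iff {X Y Z : 𝒮.Ob} (i : 𝒮.Q.Hom X Z)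
    (j : 𝒮.Q.Hom Y Z) : IsBinaryCoproduct (C := 𝒮.Q.Carrier) i j ↔
      ∀ B : 𝒮.Ob, Function.Bijective fun f : 𝒮.Q.Hom Z B => (𝒮.Q.comp i f, 𝒮.Q.comp j f) :=
  ProtoQuipper.isBinaryCoproduct_iff (C := 𝒮.Q.Carrier) i j

/-- The binary coproduct cocones of `Q`. -/
def CircuitSetting.coproducts (𝒮 : CircuitSetting.{u}) : CoverClass 𝒮.Q where
  cov i j := IsBinaryCoproduct (C := 𝒮.Q.Carrier) i j
  tensor_left h W := 𝒮.distributive _ _ h W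
  tensor_right {X Y Z i j} h W := by
    have h' := (𝒮.isBinaryCoproduct_iff _ _).1 (𝒮.distributive (W := W) i j h)
    refine (𝒮.isBinaryCoproduct_iff _ _).2 fun B => ?_
    -- Distributivity is assumed only for tensoring on the left; conjugating with the symmetry,
    -- which acts bijectively on hom-sets, gives the other side.
    have swap_bij : ∀ A B : 𝒮.Ob, Function.Bijective fun f : 𝒮.Q.Hom (𝒮.tensorObj A W) B =>
        𝒮.Q.comp (𝒮.Q.swap W A) f := fun A B => Function.bijective_iff_has_inverse.2
      ⟨fun f => 𝒮.Q.comp (𝒮.Q.swap A W) f,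
        fun f => by simp [← 𝒮.Q.comp_assoc, 𝒮.Q.symmetry],
        fun f => by simp [← 𝒮.Q.comp_assoc, 𝒮.Q.symmetry]⟩
    refine (Function.Bijective.of_comp_iff' ((swap_bij X B).prodMap (swap_bij Y B)) _).1 ?_
    refine Eq.mp (congrArg Function.Bijective (funext fun f => ?_)) ((h' B).comp (swap_bij Z B))
    refine Prod.ext ?_ ?_
    · change 𝒮.Q.comp (𝒮.Q.tensor (𝒮.Q.id W) i) (𝒮.Q.comp (𝒮.Q.swap W Z) f) =
        𝒮.Q.comp (𝒮.Q.swap W X) (𝒮.Q.comp (𝒮.Q.tensor i (𝒮.Q.id W)) f)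
      rw [← 𝒮.Q.comp_assoc, 𝒮.Q.swap_naturality, 𝒮.Q.comp_assoc]
    · change 𝒮.Q.comp (𝒮.Q.tensor (𝒮.Q.id W) j) (𝒮.Q.comp (𝒮.Q.swap W Z) f) =
        𝒮.Q.comp (𝒮.Q.swap W Y) (𝒮.Q.comp (𝒮.Q.tensor j (𝒮.Q.id W)) f)
      rw [← 𝒮.Q.comp_assoc, 𝒮.Q.swap_naturality, 𝒮.Q.comp_assoc]
  desc h B := (𝒮.isBinaryCoproduct_iff _ _).1 h B

/-- The empty class of cocones of `M`. -/
abbrev CircuitSetting.noCocones (𝒮 : CircuitSetting.{u}) : CoverClass 𝒮.M := .empty 𝒮.M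

namespace Sheaf

/-- Restriction along `J : M → Q`. -/
abbrev pull (F : Sheaf 𝒮.coproducts) : Sheaf 𝒮.noCocones where
  obj := F.obj
  res f := F.res (𝒮.J.map f)
  res_id A x := by rw [𝒮.J.map_id, F.res_id]
  res_comp f g x := by rw [𝒮.J.map_comp, F.res_comp]
  bij _ _ h := h.elim

theorem pull_res (F : Sheaf 𝒮.coproducts) {A B : 𝒮.Ob} (f : 𝒮.M.Hom B A) (x : F.obj A) :
    F.pull.res f x = F.res (𝒮.J.map f) x := rfl

/-- Restriction of morphisms along `J : M → Q`. -/
def pullMap {F G : Sheaf 𝒮.coproducts} (α : F.Hom G) : F.pull.Hom G.pull :=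
  ⟨α.1, fun A B _ x => α.2 A B _ x⟩

@[simp] theorem pullMap_app {F G : Sheaf 𝒮.coproducts} (α : F.Hom G) {A : 𝒮.Ob} (x : F.obj A) :
    (pullMap α).1 A x = α.1 A x := rfl

end Sheaf

open Sheaf

namespace CircuitSetting.SmoothPresheaf

/-- The sheaf on `Q` underlying a smooth presheaf. -/
def lev₀ (X : 𝒮.SmoothPresheaf) : Sheaf 𝒮.coproducts where
  obj A := (X.presheaf.obj (Opposite.op A)).obj₀
  res f := X.presheaf.act₀ f
  res_id A x := ConcreteCategory.congr_hom
    (X.presheaf.levelZero.map_id (Opposite.op (A : 𝒮.Q.Carrier))) x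
  res_comp {A B C} f g x := ConcreteCategory.congr_hom
    (X.presheaf.levelZero.map_comp (Quiver.Hom.op (V := 𝒮.Q.Carrier) (X := B) (Y := A) f)
      (Quiver.Hom.op (V := 𝒮.Q.Carrier) (X := C) (Y := B) g)) x
  bij i j h := X.smooth i j h

theorem act₁_h₀ (F : 𝒮.Presheaf) {A B : 𝒮.C} (f : 𝒮.M.Hom B A) :
    (F.act₁ f).h₀ = F.act₀ (𝒮.J.map f) :=
  (F.map (Opposite.op A) (Opposite.op B)).comm f

/-- The presheaf on `M` underlying a smooth presheaf. -/
def lev₁ (X : 𝒮.SmoothPresheaf) : Sheaf 𝒮.noCocones where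
  obj A := (X.presheaf.obj (Opposite.op A)).obj₁
  res f := (X.presheaf.act₁ f).h₁
  res_id A x := congrFun (congrArg Biset.Hom.h₁ (congrFun (congrArg Biset.Hom.h₁
    (X.presheaf.map_id (Opposite.op A))) PUnit.unit)) x
  res_comp {A B C} f g x := congrFun (congrArg Biset.Hom.h₁ (congrFun (congrArg Biset.Hom.h₁
    (X.presheaf.map_comp (Opposite.op A) (Opposite.op B) (Opposite.op C))) (f, g))) x
  bij _ _ h := h.elim

/-- The comparison between the two levels of a smooth presheaf. -/
def lmap (X : 𝒮.SmoothPresheaf) : X.lev₁.Hom X.lev₀.pull :=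
  ⟨fun A => (X.presheaf.obj (Opposite.op A)).map, fun _ _ f x =>
    ((X.presheaf.act₁ f).comm x).trans (congrFun (act₁_h₀ X.presheaf f) _)⟩

/-- The smooth presheaf with given levels. -/
def ofLevels (F₀ : Sheaf 𝒮.coproducts) (F₁ : Sheaf 𝒮.noCocones) (m : F₁.Hom F₀.pull) :
    𝒮.SmoothPresheaf where
  presheaf :=
    { obj := fun A => ⟨F₀.obj A.unop, F₁.obj A.unop, m.1 A.unop⟩
      map := fun _ _ => ⟨fun f => F₀.res f, fun f => ⟨F₀.res (𝒮.J.map f), F₁.res f,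
        fun x => m.2 _ _ f x⟩, fun _ => rfl⟩
      map_id := fun _ => Biset.hom_ext (fun _ => funext fun x => F₀.res_id _ x)
        (fun _ => Biset.hom_ext (fun x => (F₀.pull).res_id _ x) fun x => F₁.res_id _ x)
      map_comp := fun _ _ _ => Biset.hom_ext (fun f => funext fun x => F₀.res_comp f.1 f.2 x)
        (fun f => Biset.hom_ext (fun x => (F₀.pull).res_comp f.1 f.2 x)
          fun x => F₁.res_comp f.1 f.2 x) }
  smooth i j h := F₀.bij i j h

variable {X Y Z : 𝒮.SmoothPresheaf}

/-- The morphism on level one underlying a map of smooth presheaves. -/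
def homLev₁ (a : (X.presheaf.natBiset Y.presheaf).obj₁) : X.lev₁.Hom Y.lev₁ :=
  ⟨fun A => (a.1 A).h₁, fun A B f x => congrFun (congrArg Biset.Hom.h₁ (a.2.1 A B f)) x⟩

/-- The morphism on level zero underlying a map of smooth presheaves. -/
def homLev₀ (a : (X.presheaf.natBiset Y.presheaf).obj₁) : X.lev₀.Hom Y.lev₀ :=
  (X.presheaf.natBiset Y.presheaf).map a

theorem homLev_comm (a : (X.presheaf.natBiset Y.presheaf).obj₁) :
    (homLev₁ a).comp Y.lmap = X.lmap.comp (pullMap (homLev₀ a)) :=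
  Hom.ext fun A x => (a.1 A).comm x

/-- The map of smooth presheaves with given levels. -/
def homMk (a₀ : X.lev₀.Hom Y.lev₀) (a₁ : X.lev₁.Hom Y.lev₁)
    (h : a₁.comp Y.lmap = X.lmap.comp (pullMap a₀)) : (X.presheaf.natBiset Y.presheaf).obj₁ :=
  ⟨fun A => ⟨a₀.1 A, a₁.1 A, fun x => congrFun (congrFun (congrArg Subtype.val h) A) x⟩,
    fun A B f => Biset.hom_ext
      (fun x => (congrArg (a₀.1 B) (congrFun (act₁_h₀ X.presheaf f) x)).trans
        ((a₀.2 A B _ x).trans (congrFun (act₁_h₀ Y.presheaf f) _).symm))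
      (fun x => a₁.2 A B f x), fun A B g x => a₀.2 A B g x⟩

/-- Reduces every equation of 1-elements to one equation of sheaves over `Q` and one over `M`;
`emap_ext` does the same for maps. -/
theorem hom_ext {a b : (X.presheaf.natBiset Y.presheaf).obj₁} (h₀ : homLev₀ a = homLev₀ b)
    (h₁ : homLev₁ a = homLev₁ b) : a = b :=
  Subtype.ext (funext fun A => Biset.hom_ext
    (fun x => congrFun (congrFun (congrArg Subtype.val h₀) A) x)
    (fun x => congrFun (congrFun (congrArg Subtype.val h₁) A) x))

/-- The level zero of a map in the biset-enriched category of smooth presheaves. -/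
def eLev₀ (e : EMap Biset.{u} X Y) : X.lev₀.Hom Y.lev₀ := e.h₀ PUnit.unit

/-- The level one of a map in the biset-enriched category of smooth presheaves. -/
def eLev₁ (e : EMap Biset.{u} X Y) : X.lev₁.Hom Y.lev₁ := homLev₁ (e.h₁ PUnit.unit)

theorem homLev₀_emap (e : EMap Biset.{u} X Y) : homLev₀ (e.h₁ PUnit.unit) = eLev₀ e :=
  e.comm PUnit.unit

theorem eLev_comm (e : EMap Biset.{u} X Y) :
    (eLev₁ e).comp Y.lmap = X.lmap.comp (pullMap (eLev₀ e)) := by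
  rw [← homLev₀_emap]
  exact homLev_comm _

theorem emap_ext {e e' : EMap Biset.{u} X Y} (h₀ : eLev₀ e = eLev₀ e')
    (h₁ : eLev₁ e = eLev₁ e') : e = e' :=
  Biset.hom_ext (fun _ => h₀) fun _ => hom_ext
    ((homLev₀_emap e).trans (h₀.trans (homLev₀_emap e').symm)) h₁

/-- A level-one element of a hom-biset, as a map. -/
def emapOf (a : (X.presheaf.natBiset Y.presheaf).obj₁) : EMap Biset.{u} X Y :=
  ⟨fun _ => (X.presheaf.natBiset Y.presheaf).map a, fun _ => a, fun _ => rfl⟩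

/-- The map of smooth presheaves with given levels. -/
def emapMk (a₀ : X.lev₀.Hom Y.lev₀) (a₁ : X.lev₁.Hom Y.lev₁)
    (h : a₁.comp Y.lmap = X.lmap.comp (pullMap a₀)) : EMap Biset.{u} X Y :=
  emapOf (homMk a₀ a₁ h)

/-- An isomorphism of smooth presheaves, given levelwise. -/
def eisoMk (a₀ : X.lev₀.Hom Y.lev₀) (a₁ : X.lev₁.Hom Y.lev₁) (b₀ : Y.lev₀.Hom X.lev₀)
    (b₁ : Y.lev₁.Hom X.lev₁) (h : a₁.comp Y.lmap = X.lmap.comp (pullMap a₀))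
    (hab₀ : a₀.comp b₀ = Hom.id _) (hba₀ : b₀.comp a₀ = Hom.id _)
    (hab₁ : a₁.comp b₁ = Hom.id _) (hba₁ : b₁.comp a₁ = Hom.id _) : EIso Biset.{u} X Y where
  hom := emapMk a₀ a₁ h
  inv := emapMk b₀ b₁ (by
    -- Compatibility of the inverse is automatic: in the composite of `b₁`, `a₁`, the comparison of
    -- `Y` and `b₀`, compatibility of `a` moves the comparison past it, and the inverse laws cancel
    -- both pairs.
    have e₁ : b₁.comp ((a₁.comp Y.lmap).comp (pullMap b₀)) =
        (b₁.comp a₁).comp (Y.lmap.comp (pullMap b₀)) := rfl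
    have e₂ : b₁.comp ((X.lmap.comp (pullMap a₀)).comp (pullMap b₀)) =
        (b₁.comp X.lmap).comp (pullMap (a₀.comp b₀)) := rfl
    rw [h, e₂, hab₀, hba₁] at e₁
    exact e₁)
  hom_inv_id := emap_ext hab₀ hab₁
  inv_hom_id := emap_ext hba₀ hba₁

end CircuitSetting.SmoothPresheaf

end Levels

/-! ### The monoidal structure on smooth presheaves, assembled from the two levels. -/

section SmoothMonoidal

variable {𝒮 : CircuitSetting.{u}}

open Sheaf

namespace Sheaf

variable {F₀ G₀ H₀ F₀' G₀' : Sheaf 𝒮.coproducts} {F₁ G₁ H₁ F₁' G₁' : Sheaf 𝒮.noCocones}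

/-- The comparison between the tensor products over `M` and over `Q`. -/
noncomputable def pullTensor (m : F₁.Hom F₀.pull) (n : G₁.Hom G₀.pull) :
    (tensor F₁ G₁).Hom (tensor F₀ G₀).pull :=
  lift (fun x y => tmul (F := F₀) (G := G₀) (m.1 _ x) (n.1 _ y)) fun f g x y => by
    rw [m.app_res, n.app_res, pull_res (tensor F₀ G₀), 𝒮.J.map_tensor]
    exact tmul_res_res (F := F₀) (G := G₀) _ _ _ _

/-- The action of `J` on hom-sets. -/
def pullRep (A : 𝒮.Ob) : (rep 𝒮.noCocones A).Hom (rep 𝒮.coproducts A).pull :=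
  ⟨fun _ f => 𝒮.J.map f, fun _ _ _ _ => 𝒮.J.map_comp _ _⟩

/-- Ensures that tensoring two compatible pairs gives a compatible pair. The lemmas that follow do
the same for the structural isomorphisms, using that `J` is strict. -/
theorem pullTensor_naturality {m : F₁.Hom F₀.pull} {n : G₁.Hom G₀.pull}
    {m' : F₁'.Hom F₀'.pull} {n' : G₁'.Hom G₀'.pull} {a₀ : F₀.Hom F₀'} {a₁ : F₁.Hom F₁'}
    {b₀ : G₀.Hom G₀'} {b₁ : G₁.Hom G₁'} (ha : a₁.comp m' = m.comp (pullMap a₀))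
    (hb : b₁.comp n' = n.comp (pullMap b₀)) :
    (tensorHom a₁ b₁).comp (pullTensor m' n') =
      (pullTensor m n).comp (pullMap (tensorHom a₀ b₀)) := by
  apply tensor_ext
  intro B C x y
  have ha' := congrFun (congrFun (congrArg Subtype.val ha) B) x
  have hb' := congrFun (congrFun (congrArg Subtype.val hb) C) y
  exact congrArg₂ (tmul (F := F₀') (G := G₀')) ha' hb'

theorem pullTensor_left (m : F₁.Hom F₀.pull) :
    (left F₁).comp m = (pullTensor (pullRep 𝒮.I) m).comp (pullMap (left F₀)) :=
  tensor_ext fun f x => by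
    rw [Hom.comp_app, left_tmul, m.app_res, pull_res, 𝒮.J.map_comp, 𝒮.J.map_tensor, 𝒮.J.map_id,
      𝒮.J.map_left]
    rfl

theorem pullTensor_right (m : F₁.Hom F₀.pull) :
    (right F₁).comp m = (pullTensor m (pullRep 𝒮.I)).comp (pullMap (right F₀)) :=
  tensor_ext fun f x => by
    rw [Hom.comp_app, right_tmul, m.app_res, pull_res, 𝒮.J.map_comp, 𝒮.J.map_tensor, 𝒮.J.map_id,
      𝒮.J.map_right]
    rfl

theorem pullTensor_swap (m : F₁.Hom F₀.pull) (n : G₁.Hom G₀.pull) :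
    (swap F₁ G₁).comp (pullTensor n m) = (pullTensor m n).comp (pullMap (swap F₀ G₀)) :=
  tensor_ext fun f x => by
    rw [Hom.comp_app, swap_tmul, Hom.app_res, pull_res, 𝒮.J.map_swap]
    rfl

theorem pullTensor_assoc (m : F₁.Hom F₀.pull) (n : G₁.Hom G₀.pull) (k : H₁.Hom H₀.pull) :
    (assoc F₁ G₁ H₁).comp (pullTensor m (pullTensor n k)) =
      (pullTensor (pullTensor m n) k).comp (pullMap (assoc F₀ G₀ H₀)) :=
  tensor_ext₃ fun x y z => by
    rw [Hom.comp_app, assoc_tmul, Hom.app_res, pull_res, 𝒮.J.map_assoc]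
    rfl

end Sheaf

namespace CircuitSetting.SmoothPresheaf

/-- The tensor product of smooth presheaves. -/
noncomputable def tensorObj (X Y : 𝒮.SmoothPresheaf) : 𝒮.SmoothPresheaf :=
  ofLevels (tensor X.lev₀ Y.lev₀) (tensor X.lev₁ Y.lev₁) (pullTensor X.lmap Y.lmap)

/-- The representable smooth presheaves. -/
def rep (A : 𝒮.Ob) : 𝒮.SmoothPresheaf :=
  ofLevels (Sheaf.rep _ A) (Sheaf.rep _ A) (pullRep A)

/-- The tensor product as a morphism of hom-bisets. -/
noncomputable def tensorMap (X₁ Y₁ X₂ Y₂ : 𝒮.SmoothPresheaf) :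
    EnrichedCategory.Hom (V := Biset.{u}) X₁ Y₁ ⊗ EnrichedCategory.Hom (V := Biset.{u}) X₂ Y₂ ⟶
      EnrichedCategory.Hom (V := Biset.{u}) (tensorObj X₁ X₂) (tensorObj Y₁ Y₂) :=
  Biset.Hom.mk (A := Biset.prod (X₁.presheaf.natBiset Y₁.presheaf)
      (X₂.presheaf.natBiset Y₂.presheaf))
    (B := (tensorObj X₁ X₂).presheaf.natBiset (tensorObj Y₁ Y₂).presheaf)
    (fun x => tensorHom (F := X₁.lev₀) (F' := Y₁.lev₀) (G := X₂.lev₀) (G' := Y₂.lev₀) x.1 x.2)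
    (fun x => homMk (X := tensorObj X₁ X₂) (Y := tensorObj Y₁ Y₂)
      (tensorHom (homLev₀ x.1) (homLev₀ x.2)) (tensorHom (homLev₁ x.1) (homLev₁ x.2))
      (pullTensor_naturality (homLev_comm x.1) (homLev_comm x.2)))
    fun _ => rfl

/-- The symmetric monoidal data of the category of smooth presheaves. -/
noncomputable def monoidalData (𝒮 : CircuitSetting.{u}) :
    EnrichedMonoidalData Biset.{u} 𝒮.SmoothPresheaf where
  unit := rep 𝒮.I
  obj := tensorObj
  tensor := tensorMap
  left X := eisoMk (X := tensorObj (rep 𝒮.I) X) (left X.lev₀) (left X.lev₁) (leftInv X.lev₀)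
    (leftInv X.lev₁) (pullTensor_left X.lmap) (left_leftInv _) (leftInv_left _) (left_leftInv _)
    (leftInv_left _)
  right X := eisoMk (X := tensorObj X (rep 𝒮.I)) (right X.lev₀) (right X.lev₁) (rightInv X.lev₀)
    (rightInv X.lev₁) (pullTensor_right X.lmap) (right_rightInv _) (rightInv_right _)
    (right_rightInv _) (rightInv_right _)
  swap X Y := eisoMk (X := tensorObj X Y) (Y := tensorObj Y X) (swap X.lev₀ Y.lev₀)
    (swap X.lev₁ Y.lev₁) (swap _ _) (swap _ _) (pullTensor_swap X.lmap Y.lmap) (swap_swap _ _)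
    (swap_swap _ _) (swap_swap _ _) (swap_swap _ _)
  assoc X Y Z := eisoMk (X := tensorObj (tensorObj X Y) Z) (Y := tensorObj X (tensorObj Y Z))
    (assoc X.lev₀ Y.lev₀ Z.lev₀) (assoc X.lev₁ Y.lev₁ Z.lev₁) (assocInv _ _ _) (assocInv _ _ _)
    (pullTensor_assoc X.lmap Y.lmap Z.lmap) (assoc_assocInv _ _ _) (assocInv_assoc _ _ _)
    (assoc_assocInv _ _ _) (assocInv_assoc _ _ _)

/-- The symmetric monoidal structure of the category of smooth presheaves. -/
noncomputable def monoidal (𝒮 : CircuitSetting.{u}) :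
    EnrichedSymmetricMonoidal Biset.{u} 𝒮.SmoothPresheaf where
  toEnrichedMonoidalData := monoidalData 𝒮
  tensor_id X Y := emap_ext (tensorHom_id X.lev₀ Y.lev₀) (tensorHom_id X.lev₁ Y.lev₁)
  tensor_comp X₁ X₂ Y₁ Y₂ Z₁ Z₂ := Biset.hom_ext
    (fun x => tensorHom_comp (F := X₁.lev₀) (F' := Y₁.lev₀) (F'' := Z₁.lev₀) (G := X₂.lev₀)
      (G' := Y₂.lev₀) (G'' := Z₂.lev₀) x.1.1 x.1.2 x.2.1 x.2.2)
    (fun x => hom_ext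
      (tensorHom_comp (homLev₀ x.1.1) (homLev₀ x.1.2) (homLev₀ x.2.1) (homLev₀ x.2.2))
      (tensorHom_comp (homLev₁ x.1.1) (homLev₁ x.1.2) (homLev₁ x.2.1) (homLev₁ x.2.2)))
  left_naturality X Y := Biset.hom_ext
    (fun x => left_naturality (F := X.lev₀) (G := Y.lev₀) x)
    (fun x => hom_ext (left_naturality (homLev₀ x)) (left_naturality (homLev₁ x)))
  right_naturality X Y := Biset.hom_ext
    (fun x => right_naturality (F := X.lev₀) (G := Y.lev₀) x)
    (fun x => hom_ext (right_naturality (homLev₀ x)) (right_naturality (homLev₁ x)))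
  swap_naturality X₁ Y₁ X₂ Y₂ := Biset.hom_ext
    (fun x => swap_naturality (F := X₁.lev₀) (F' := Y₁.lev₀) (G := X₂.lev₀) (G' := Y₂.lev₀)
      x.1 x.2)
    (fun x => hom_ext (swap_naturality (homLev₀ x.1) (homLev₀ x.2))
      (swap_naturality (homLev₁ x.1) (homLev₁ x.2)))
  assoc_naturality X₁ Y₁ X₂ Y₂ X₃ Y₃ := Biset.hom_ext
    (fun x => assoc_naturality (F := X₁.lev₀) (F' := Y₁.lev₀) (G := X₂.lev₀) (G' := Y₂.lev₀)
      (H := X₃.lev₀) (H' := Y₃.lev₀) x.1.1 x.1.2 x.2)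
    (fun x => hom_ext (assoc_naturality (homLev₀ x.1.1) (homLev₀ x.1.2) (homLev₀ x.2))
      (assoc_naturality (homLev₁ x.1.1) (homLev₁ x.1.2) (homLev₁ x.2)))
  pentagon _ _ _ _ := emap_ext (pentagon _ _ _ _) (pentagon _ _ _ _)
  triangle _ _ := emap_ext (triangle _ _) (triangle _ _)
  hexagon _ _ _ := emap_ext (hexagon _ _ _) (hexagon _ _ _)
  symmetry _ _ := emap_ext (swap_swap _ _) (swap_swap _ _)

/-- The internal hom of smooth presheaves: at level one it consists of the compatible pairs. -/
def ihomObj (X Z : 𝒮.SmoothPresheaf) : 𝒮.SmoothPresheaf :=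
  ofLevels (ihom X.lev₀ Z.lev₀)
    -- A level-one transformation does not determine one on level zero, so both are recorded; the
    -- comparison is then the first projection.
    { obj := fun A => { b : (ihom X.lev₀ Z.lev₀).obj A × (ihom X.lev₁ Z.lev₁).obj A //
        ∀ B x, Z.lmap.1 _ (b.2.1 B x) = b.1.1 B (X.lmap.1 B x) }
      res := fun f b => ⟨((ihom X.lev₀ Z.lev₀).pull.res f b.1.1, (ihom X.lev₁ Z.lev₁).res f b.1.2),
        fun B x => by
          refine (Z.lmap.app_res _ _).trans ?_
          rw [b.2 B x, pull_res, 𝒮.J.map_tensor, 𝒮.J.map_id]⟩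
      res_id := fun A b => Subtype.ext
        (Prod.ext ((ihom X.lev₀ Z.lev₀).pull.res_id A _) ((ihom X.lev₁ Z.lev₁).res_id A _))
      res_comp := fun f g b => Subtype.ext
        (Prod.ext ((ihom X.lev₀ Z.lev₀).pull.res_comp f g _)
          ((ihom X.lev₁ Z.lev₁).res_comp f g _))
      bij := fun _ _ h => h.elim }
    ⟨fun _ b => b.1.1, fun _ _ _ _ => rfl⟩

end CircuitSetting.SmoothPresheaf

end SmoothMonoidal

/-! ### The closed structure and coproducts of smooth presheaves. -/

section SmoothClosed

variable {𝒮 : CircuitSetting.{u}}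

open Sheaf

namespace Sheaf

variable {Ob : Type u} {I : Ob} {t : Ob → Ob → Ob} {K : SymmetricMonoidalOn Ob I t}
  {W : CoverClass K}

/-- The functorial action of shifting. -/
def shiftLeftMap {F G : Sheaf W} (α : F.Hom G) (A : Ob) : (F.shiftLeft A).Hom (G.shiftLeft A) :=
  ⟨fun _ x => α.1 _ x, fun _ _ _ x => α.app_res _ x⟩

/-- The functorial action of the internal hom. -/
def ihomMap (G : Sheaf W) {Z Z' : Sheaf W} (α : Z.Hom Z') : (ihom G Z).Hom (ihom G Z') :=
  ⟨fun A β => β.comp (shiftLeftMap α A), fun _ _ f β => Hom.ext fun C x => by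
    simp [shiftLeftMap]⟩

end Sheaf

namespace CircuitSetting.SmoothPresheaf

/-- The functor `X ⊸ -`. -/
def ihomFunctor (X : 𝒮.SmoothPresheaf) :
    EnrichedFunctor Biset.{u} 𝒮.SmoothPresheaf 𝒮.SmoothPresheaf where
  obj := ihomObj X
  map Z Z' := Biset.Hom.mk (A := Z.presheaf.natBiset Z'.presheaf)
    (B := (ihomObj X Z).presheaf.natBiset (ihomObj X Z').presheaf)
    (fun α => ihomMap X.lev₀ (Z := Z.lev₀) (Z' := Z'.lev₀) α)
    (fun a => homMk (X := ihomObj X Z) (Y := ihomObj X Z') (ihomMap X.lev₀ (homLev₀ a))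
      ⟨fun A b => ⟨((ihomMap X.lev₀ (homLev₀ a)).1 A b.1.1, (ihomMap X.lev₁ (homLev₁ a)).1 A b.1.2),
        fun B x => (congrFun (congrFun (congrArg Subtype.val (homLev_comm a)) _) _).trans
          (congrArg ((homLev₀ a).1 _) (b.2 B x))⟩,
        fun _ _ f b => Subtype.ext (Prod.ext
          ((pullMap (ihomMap X.lev₀ (homLev₀ a))).app_res f b.1.1)
          ((ihomMap X.lev₁ (homLev₁ a)).app_res f b.1.2))⟩ rfl)
    fun _ => rfl
  map_id _ := rfl
  map_comp _ _ _ := rfl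

/-- The adjunction `- ⊗ X ⊣ X ⊸ -`. -/
noncomputable def ihomAdj (X : 𝒮.SmoothPresheaf) :
    EnrichedAdjunction ((monoidal 𝒮).tensorRight X) (ihomFunctor X) where
  homIso Y Z :=
    { hom := Biset.Hom.mk (A := (tensorObj Y X).presheaf.natBiset Z.presheaf)
        (B := Y.presheaf.natBiset (ihomObj X Z).presheaf)
        (fun α => curry (F := Y.lev₀) (G := X.lev₀) (Z := Z.lev₀) α)
        (fun a => homMk (Y := ihomObj X Z)
          (curry (F := Y.lev₀) (G := X.lev₀) (Z := Z.lev₀) (homLev₀ a))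
          -- The level-zero half of the pair is forced: the comparison is the first projection, so
          -- it must be the curried level-zero map at the image of `y`.
          ⟨fun A y => ⟨((curry (F := Y.lev₀) (G := X.lev₀) (homLev₀ a)).1 A (Y.lmap.1 A y),
              (curry (F := Y.lev₁) (G := X.lev₁) (homLev₁ a)).1 A y),
            fun _ x => congrFun (congrFun (congrArg Subtype.val (homLev_comm a)) _) (tmul y x)⟩,
            fun _ _ f y => Subtype.ext (Prod.ext
              ((congrArg _ (Y.lmap.app_res f y)).trans
                ((curry (F := Y.lev₀) (G := X.lev₀) (Z := Z.lev₀) (homLev₀ a)).app_res _ _))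
              ((curry (F := Y.lev₁) (G := X.lev₁) (Z := Z.lev₁) (homLev₁ a)).app_res f y))⟩ rfl)
        fun _ => rfl
      inv := Biset.Hom.mk (A := Y.presheaf.natBiset (ihomObj X Z).presheaf)
        (B := (tensorObj Y X).presheaf.natBiset Z.presheaf)
        (fun β => uncurry (F := Y.lev₀) (G := X.lev₀) (Z := Z.lev₀) β)
        (fun b => homMk (X := tensorObj Y X)
          (uncurry (F := Y.lev₀) (G := X.lev₀) (Z := Z.lev₀) (homLev₀ b))
          -- Only the level-one half of each pair is uncurried here; the level-zero half is already
          -- accounted for by `homLev₀ b`.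
          (uncurry (F := Y.lev₁) (G := X.lev₁) (Z := Z.lev₁)
            ⟨fun A y => ((homLev₁ b).1 A y).1.2,
              fun _ _ f y => congrArg (fun c => c.1.2) ((homLev₁ b).app_res f y)⟩)
          (tensor_ext fun y x => (((homLev₁ b).1 _ y).2 _ x).trans
            (congrArg (fun c : (ihom X.lev₀ Z.lev₀).obj _ => c.1 _ (X.lmap.1 _ x))
              (congrFun (congrFun (congrArg Subtype.val (homLev_comm b)) _) y))))
        fun _ => rfl
      hom_inv_id := Biset.hom_ext (fun _ => uncurry_curry _) fun _ => hom_ext (uncurry_curry _)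
        (uncurry_curry _)
      inv_hom_id := Biset.hom_ext (fun _ => rfl) fun b => hom_ext rfl
        -- The discarded first half of the pair is recovered from compatibility of `b` with the
        -- comparisons.
        (Hom.ext fun _ y => Subtype.ext (Prod.ext
          (congrFun (congrFun (congrArg Subtype.val (homLev_comm b)) _) y).symm rfl)) }
  naturality_right _ _ _ := rfl
  naturality_left _ _ _ := Biset.hom_ext (fun _ => rfl) fun x => hom_ext rfl
    (Hom.ext fun A y => Subtype.ext (Prod.ext
      (congrArg ((curry (F := _) (G := X.lev₀) (homLev₀ x.2)).1 A)
        (congrFun (congrFun (congrArg Subtype.val (homLev_comm x.1)) A) y).symm) rfl))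

/-- The coproduct of a family of smooth presheaves. -/
noncomputable def coprodObj {ι : Type u} (X : ι → 𝒮.SmoothPresheaf) : 𝒮.SmoothPresheaf :=
  ofLevels (coprod fun i => (X i).lev₀) (coprod fun i => (X i).lev₁)
    (coprod.desc fun i => (X i).lmap.comp (pullMap (coprod.inj (fun i => (X i).lev₀) i)))

/-- Coproducts are formed separately at each level. A cone of bisets over the hom-bisets consists of
compatible families at 0- and 1-elements, and `coprod.desc` assembles each of them. -/
theorem hasEnrichedCoproducts (𝒮 : CircuitSetting.{u}) :
    HasEnrichedCoproducts Biset.{u} 𝒮.SmoothPresheaf := by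
  intro ι X
  refine ⟨coprodObj X, fun i => emapMk (Y := coprodObj X) (coprod.inj (fun i => (X i).lev₀) i)
    (coprod.inj (fun i => (X i).lev₁) i) rfl, fun Z => ⟨Fan.IsLimit.mk _ (fun s => ?_) ?_ ?_⟩⟩
  · let p : ∀ i, Biset.Hom s.pt ((X i).presheaf.natBiset Z.presheaf) := fun i => s.proj i
    exact Biset.Hom.mk (A := s.pt) (B := (coprodObj X).presheaf.natBiset Z.presheaf)
      (fun x => coprod.desc (F := Z.lev₀) (X := fun i => (X i).lev₀) fun i => (p i).h₀ x)
      (fun x => homMk (X := coprodObj X) (coprod.desc fun i => homLev₀ ((p i).h₁ x))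
        (coprod.desc fun i => homLev₁ ((p i).h₁ x))
        (coprod.hom_ext fun i => homLev_comm ((p i).h₁ x)))
      fun x => congrArg (coprod.desc (F := Z.lev₀) (X := fun i => (X i).lev₀))
        (funext fun i => (p i).comm x)
  · intro s i
    exact Biset.hom_ext (fun _ => rfl) fun _ => rfl
  · intro s m h
    have h' : ∀ i, m ≫ (emapMk (Y := coprodObj X) (coprod.inj (fun i => (X i).lev₀) i)
      (coprod.inj (fun i => (X i).lev₁) i) rfl).pre Z = s.proj i := h
    exact Biset.hom_ext
      (fun x => Sheaf.coprod.hom_ext (F := Z.lev₀) (X := fun i => (X i).lev₀) fun i =>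
        congrFun (congrArg Biset.Hom.h₀ (h' i)) x)
      (fun x => hom_ext
        (Sheaf.coprod.hom_ext fun i => congrArg homLev₀ (congrFun (congrArg Biset.Hom.h₁ (h' i)) x))
        (Sheaf.coprod.hom_ext fun i =>
          congrArg homLev₁ (congrFun (congrArg Biset.Hom.h₁ (h' i)) x)))

end CircuitSetting.SmoothPresheaf

end SmoothClosed

/-! ### The linear-non-linear adjunction between copowers of the unit and evaluation at the unit. -/

section LinearNonLinear

namespace Sheaf

variable {Ob : Type u} {I : Ob} {t : Ob → Ob → Ob} {K : SymmetricMonoidalOn Ob I t}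
  {W : CoverClass K} {F G Z : Sheaf W} {S S' S'' : Type u}

/-- Lets maps out of a tensor product be compared one factor at a time: once curried, the
extensionality principle of the first factor (copower or representable) applies, then that of the
second. -/
theorem curry_injective {α β : (tensor F G).Hom Z} (h : curry α = curry β) : α = β := by
  rw [← uncurry_curry α, h, uncurry_curry]

theorem copower_ext₂ {α β : (tensor (copower W S) (copower W S')).Hom Z}
    (h : ∀ s s', α.1 _ (tmul (copower.gen s) (copower.gen s')) =
      β.1 _ (tmul (copower.gen s) (copower.gen s'))) : α = β :=
  curry_injective (copower.hom_ext fun s => copower.hom_ext fun s' => h s s')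

theorem copower_ext₃ {α β : (tensor (tensor (copower W S) (copower W S')) (copower W S'')).Hom Z}
    (h : ∀ s s' s'', α.1 _ (tmul (tmul (copower.gen s) (copower.gen s')) (copower.gen s'')) =
      β.1 _ (tmul (tmul (copower.gen s) (copower.gen s')) (copower.gen s''))) : α = β :=
  curry_injective (copower_ext₂ fun s s' => copower.hom_ext fun s'' => h s s' s'')

theorem rep_tensor_copower_ext {A : Ob} {α β : (tensor (rep W A) (copower W S)).Hom Z}
    (h : ∀ s, α.1 _ (tmul (F := rep W A) (K.id A) (copower.gen s)) =
      β.1 _ (tmul (F := rep W A) (K.id A) (copower.gen s))) : α = β :=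
  curry_injective (rep_ext (copower.hom_ext fun s => h s))

theorem copower_tensor_rep_ext {A : Ob} {α β : (tensor (copower W S) (rep W A)).Hom Z}
    (h : ∀ s, α.1 _ (tmul (G := rep W A) (copower.gen s) (K.id A)) =
      β.1 _ (tmul (G := rep W A) (copower.gen s) (K.id A))) : α = β :=
  curry_injective (copower.hom_ext fun s => rep_ext (h s))

/-- The functorial action of copowers. -/
noncomputable def copowerMap (W : CoverClass K) (f : S → S') : (copower W S).Hom (copower W S') :=
  copower.desc fun s => copower.gen (f s)

@[simp] theorem copowerMap_gen (f : S → S') (s : S) :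
    (copowerMap W f).1 I (copower.gen s) = copower.gen (f s) := rfl

/-- The comparison `(S · I) ⊗ (S' · I) → (S × S') · I`. -/
noncomputable def copowerTensor (W : CoverClass K) (S S' : Type u) :
    (tensor (copower W S) (copower W S')).Hom (copower W (S × S')) :=
  uncurry (copower.desc (F := ihom (copower W S') (copower W (S × S'))) fun s =>
    copower.desc (F := (copower W (S × S')).shiftLeft I) fun s' =>
      (copower W (S × S')).res (K.left I) (copower.gen (s, s')))

@[simp]
theorem copowerTensor_gen (s : S) (s' : S') :
    (copowerTensor W S S').1 _ (tmul (copower.gen s) (copower.gen s')) =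
      (copower W (S × S')).res (K.left I) (copower.gen (s, s')) := rfl

/-- The generators live over `I`, but the tensor of two generators lives over `I ⊗ I`; the unitor of
`I` mediates between the two. -/
noncomputable def copowerTensorInv (W : CoverClass K) (S S' : Type u) :
    (copower W (S × S')).Hom (tensor (copower W S) (copower W S')) :=
  copower.desc fun s => (tensor _ _).res (K.leftInv I) (tmul (copower.gen s.1) (copower.gen s.2))

@[simp]
theorem copowerTensorInv_gen (s : S × S') : (copowerTensorInv W S S').1 _ (copower.gen s) =
    (tensor _ _).res (K.leftInv I) (tmul (copower.gen s.1) (copower.gen s.2)) := rfl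

theorem copowerTensor_inv (S S' : Type u) :
    (copowerTensor W S S').comp (copowerTensorInv W S S') = Hom.id _ :=
  copower_ext₂ fun s s' => by simp [K.left_inv]

theorem copowerTensorInv_copowerTensor (S S' : Type u) :
    (copowerTensorInv W S S').comp (copowerTensor W S S') = Hom.id _ :=
  copower.hom_ext fun s => by simp [K.inv_left]

/-- The comparison `I → 1 · I`. -/
def copowerUnit (W : CoverClass K) : (rep W I).Hom (copower W PUnit) :=
  yoneda (copower.gen PUnit.unit)

noncomputable def copowerUnitInv (W : CoverClass K) : (copower W PUnit).Hom (rep W I) :=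
  copower.desc (F := rep W I) fun _ => K.id I

theorem copowerUnit_inv : (copowerUnit W).comp (copowerUnitInv W) = Hom.id _ :=
  rep_ext (by simp [copowerUnit, copowerUnitInv])

theorem copowerUnitInv_copowerUnit : (copowerUnitInv W).comp (copowerUnit W) = Hom.id _ :=
  copower.hom_ext fun s => by simp [copowerUnit, copowerUnitInv]

theorem copowerTensor_naturality {T T' : Type u} (f : S → T) (g : S' → T') :
    (tensorHom (copowerMap W f) (copowerMap W g)).comp (copowerTensor W T T') =
      (copowerTensor W S S').comp (copowerMap W (Prod.map f g)) :=
  copower_ext₂ fun s s' => by simp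

/-- The copower comparisons are built with the left unitor of `I`, while associativity and right
unitality produce the right one; this coherence fact reconciles them. -/
theorem _root_.ProtoQuipper.SymmetricMonoidalOn.left_unit_eq_right_unit
    (K : SymmetricMonoidalOn Ob I t) : K.left I = K.right I :=
  MonoidalCategory.unitors_equal (C := K.Carrier)

theorem copowerTensor_assoc (S S' S'' : Type u) :
    (tensorHom (copowerTensor W S S') (Hom.id (copower W S''))).comp
        ((copowerTensor W (S × S') S'').comp
          (copowerMap W fun x => (x.1.1, x.1.2, x.2))) =
      (assoc _ _ _).comp ((tensorHom (Hom.id _) (copowerTensor W S' S'')).comp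
        (copowerTensor W S (S' × S''))) :=
  copower_ext₃ fun s s' s'' => by
    simp
    -- On generators the claim concerns two composites from `(I ⊗ I) ⊗ I` to `I`, and the triangle
    -- identity equates them.
    rw [← K.comp_assoc, K.triangle, ← K.left_unit_eq_right_unit]

theorem left_copower (S : Type u) :
    left (copower W S) = (tensorHom (copowerUnit W) (Hom.id _)).comp
      ((copowerTensor W PUnit S).comp (copowerMap W fun x => x.2)) :=
  rep_tensor_copower_ext fun s => by simp [copowerUnit]

theorem right_copower (S : Type u) :
    right (copower W S) = (tensorHom (Hom.id _) (copowerUnit W)).comp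
      ((copowerTensor W S PUnit).comp (copowerMap W fun x => x.1)) :=
  copower_tensor_rep_ext fun s => by simp [copowerUnit, K.left_unit_eq_right_unit]

variable {𝒮 : CircuitSetting.{u}}

/-- The comparison between copowers over `M` and over `Q`. -/
noncomputable def pullCopower {S₁ S₀ : Type u} (f : S₁ → S₀) :
    (copower 𝒮.noCocones S₁).Hom (copower 𝒮.coproducts S₀).pull :=
  copower.desc (F := (copower 𝒮.coproducts S₀).pull) fun s => copower.gen (f s)

theorem pullCopower_gen {S₁ S₀ : Type u} (f : S₁ → S₀) (s : S₁) :
    (pullCopower (𝒮 := 𝒮) f).1 _ (copower.gen s) = copower.gen (W := 𝒮.coproducts) (f s) := rfl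

theorem pullCopower_tensor {S₁ S₀ T₁ T₀ : Type u} (f : S₁ → S₀) (g : T₁ → T₀) :
    (copowerTensor 𝒮.noCocones S₁ T₁).comp (pullCopower (𝒮 := 𝒮) fun x => (f x.1, g x.2)) =
      (pullTensor (pullCopower f) (pullCopower g)).comp
        (pullMap (copowerTensor 𝒮.coproducts S₀ T₀)) :=
  copower_ext₂ fun s s' => by
    rw [Hom.comp_app, copowerTensor_gen, Hom.app_res, pull_res, 𝒮.J.map_left]
    rfl

theorem pullCopower_unit :
    (copowerUnit 𝒮.noCocones).comp (pullCopower fun x => x) =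
      (pullRep 𝒮.I).comp (pullMap (copowerUnit 𝒮.coproducts)) :=
  rep_ext (by
    simp only [copowerUnit, Hom.comp_app, yoneda_app, res_id, pullRep, pullMap_app,
      pullCopower_gen, 𝒮.J.map_id])

end Sheaf

namespace CircuitSetting.SmoothPresheaf

open Sheaf

variable {𝒮 : CircuitSetting.{u}}

/-- The copower `B · I` of the tensor unit by a biset. -/
noncomputable def copowerObj (𝒮 : CircuitSetting.{u}) (B : Biset.{u}) : 𝒮.SmoothPresheaf :=
  ofLevels (copower _ B.obj₀) (copower _ B.obj₁) (pullCopower B.map)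

theorem copowerMap_comm {B B' : Biset.{u}} (g : Biset.Hom B B') :
    (copowerMap 𝒮.noCocones g.h₁).comp (pullCopower B'.map) =
      (pullCopower B.map).comp (pullMap (copowerMap 𝒮.coproducts g.h₀)) :=
  copower.hom_ext fun s => congrArg (copower.gen (W := 𝒮.coproducts)) (g.comm s)

/-- The functor `p`. -/
noncomputable def copowerFunctor (𝒮 : CircuitSetting.{u}) :
    EnrichedFunctor Biset.{u} Biset.{u} 𝒮.SmoothPresheaf where
  obj := copowerObj 𝒮
  map B B' := Biset.Hom.mk (A := Biset.exp B B')
    (B := (copowerObj 𝒮 B).presheaf.natBiset (copowerObj 𝒮 B').presheaf)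
    (fun f => copowerMap 𝒮.coproducts f)
    (fun g => homMk (X := copowerObj 𝒮 B) (Y := copowerObj 𝒮 B') (copowerMap _ g.h₀)
      (copowerMap _ g.h₁) (copowerMap_comm g))
    fun _ => rfl
  map_id _ := emap_ext (copower.hom_ext fun _ => rfl) (copower.hom_ext fun _ => rfl)
  map_comp _ _ _ := Biset.hom_ext (fun _ => copower.hom_ext fun _ => rfl)
    fun _ => hom_ext (copower.hom_ext fun _ => rfl) (copower.hom_ext fun _ => rfl)

/-- The functor `♭`: evaluation at the tensor unit. -/
def flatFunctor (𝒮 : CircuitSetting.{u}) :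
    EnrichedFunctor Biset.{u} 𝒮.SmoothPresheaf Biset.{u} where
  obj X := X.presheaf.obj (Opposite.op 𝒮.I)
  map X Y := Biset.Hom.mk (A := X.presheaf.natBiset Y.presheaf)
    (B := Biset.exp (X.presheaf.obj (Opposite.op 𝒮.I)) (Y.presheaf.obj (Opposite.op 𝒮.I)))
    (fun α => α.1 𝒮.I) (fun a => a.1 𝒮.I) fun _ => rfl
  map_id _ := rfl
  map_comp _ _ _ := rfl

/-- The adjunction `p ⊣ ♭`. -/
noncomputable def copowerAdj (𝒮 : CircuitSetting.{u}) :
    EnrichedAdjunction (copowerFunctor 𝒮) (flatFunctor 𝒮) where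
  homIso B Y :=
    { hom := Biset.Hom.mk (A := (copowerObj 𝒮 B).presheaf.natBiset Y.presheaf)
        (B := Biset.exp B (Y.presheaf.obj (Opposite.op 𝒮.I)))
        (fun α b => α.1 𝒮.I (copower.gen b))
        (fun a => ⟨fun b => (a.1 𝒮.I).h₀ (copower.gen b), fun b => (a.1 𝒮.I).h₁ (copower.gen b),
          fun b => (a.1 𝒮.I).comm (copower.gen b)⟩) fun _ => rfl
      inv := Biset.Hom.mk (A := Biset.exp B (Y.presheaf.obj (Opposite.op 𝒮.I)))
        (B := (copowerObj 𝒮 B).presheaf.natBiset Y.presheaf)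
        (fun v => copower.desc (F := Y.lev₀) v)
        (fun v => homMk (X := copowerObj 𝒮 B) (copower.desc (F := Y.lev₀) v.h₀)
          (copower.desc (F := Y.lev₁) v.h₁) (copower.hom_ext fun s => v.comm s))
        fun _ => rfl
      hom_inv_id := Biset.hom_ext
        (fun _ => copower.hom_ext (F := Y.lev₀) fun _ => rfl)
        fun _ => hom_ext (copower.hom_ext (F := Y.lev₀) fun _ => rfl)
          (copower.hom_ext (F := Y.lev₁) fun _ => rfl)
      inv_hom_id := rfl }
  naturality_right _ _ _ := rfl
  naturality_left _ _ _ := rfl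

/-- The functor `p` is strong monoidal. -/
noncomputable def copowerMonoidal (𝒮 : CircuitSetting.{u}) :
    EnrichedStrongMonoidal (selfMonoidalData Biset.{u}) (monoidalData 𝒮) (copowerFunctor 𝒮) where
  ε := eisoMk (X := rep 𝒮.I) (Y := copowerObj 𝒮 Biset.one) (copowerUnit _) (copowerUnit _)
    (copowerUnitInv _) (copowerUnitInv _) pullCopower_unit copowerUnit_inv
    copowerUnitInv_copowerUnit copowerUnit_inv copowerUnitInv_copowerUnit
  μ B B' := eisoMk (X := tensorObj (copowerObj 𝒮 B) (copowerObj 𝒮 B'))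
    (Y := copowerObj 𝒮 (Biset.prod B B')) (copowerTensor _ _ _) (copowerTensor _ _ _)
    (copowerTensorInv _ _ _) (copowerTensorInv _ _ _) (pullCopower_tensor B.map B'.map)
    (copowerTensor_inv _ _) (copowerTensorInv_copowerTensor _ _) (copowerTensor_inv _ _)
    (copowerTensorInv_copowerTensor _ _)
  μ_naturality X₁ Y₁ X₂ Y₂ := Biset.hom_ext
    (fun x => copowerTensor_naturality (W := 𝒮.coproducts) (S := X₁.obj₀) (T := Y₁.obj₀)
      (S' := X₂.obj₀) (T' := Y₂.obj₀) x.1 x.2)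
    (fun x => hom_ext
      (copowerTensor_naturality (S := X₁.obj₀) (T := Y₁.obj₀)
        (S' := X₂.obj₀) (T' := Y₂.obj₀) (Biset.Hom.h₀ x.1) (Biset.Hom.h₀ x.2))
      (copowerTensor_naturality (S := X₁.obj₁) (T := Y₁.obj₁)
        (S' := X₂.obj₁) (T' := Y₂.obj₁) (Biset.Hom.h₁ x.1) (Biset.Hom.h₁ x.2)))
  associativity _ _ _ := emap_ext (copowerTensor_assoc _ _ _) (copowerTensor_assoc _ _ _)
  left_unitality _ := emap_ext (left_copower _) (left_copower _)
  right_unitality _ := emap_ext (right_copower _) (right_copower _)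

end CircuitSetting.SmoothPresheaf

end LinearNonLinear

/-! ### Convex sums of elements and of transformations, from gluing over `A ⊗ Bit`. -/

section ConvexSums

variable {𝒮 : CircuitSetting.{u}}

/-- Transport of a convexity structure along a bijection. -/
def ConvexStructure.ofEquiv {X Y : Type*} (e : X ≃ Y) (c : ConvexStructure Y) :
    ConvexStructure X where
  sum p q hp hq h x y := e.symm (c.sum p q hp hq h (e x) (e y))
  sum_self p q hp hq h x := by rw [c.sum_self, e.symm_apply_apply]
  sum_comm p q hp hq h x y := by rw [c.sum_comm]
  zero_one x y := by rw [c.zero_one, e.symm_apply_apply]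
  interchange a b c' d ha hb hc hd h hab hcd hac hbd x y z w := by
    simp only [e.apply_symm_apply]
    exact congrArg e.symm (c.interchange a b c' d ha hb hc hd h hab hcd hac hbd _ _ _ _)

namespace CircuitSetting

/-- Convex sums in `Q`. -/
def convexSum (𝒮 : CircuitSetting.{u}) (p q : ℝ) (hp : 0 ≤ p) (hq : 0 ≤ q) (h : p + q = 1)
    {A B : 𝒮.Ob} (f g : 𝒮.Q.Hom A B) : 𝒮.Q.Hom A B :=
  (𝒮.convex.conv (A : 𝒮.Q.Carrier) (B : 𝒮.Q.Carrier)).sum p q hp hq h f g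

theorem convexSum_comp (p q : ℝ) (hp : 0 ≤ p) (hq : 0 ≤ q) (h : p + q = 1)
    {A B C : 𝒮.Ob} (f g : 𝒮.Q.Hom A B) (k : 𝒮.Q.Hom B C) :
    𝒮.Q.comp (𝒮.convexSum p q hp hq h f g) k =
      𝒮.convexSum p q hp hq h (𝒮.Q.comp f k) (𝒮.Q.comp g k) :=
  𝒮.convex.sum_comp p q hp hq h (X := (A : 𝒮.Q.Carrier)) (Y := (B : 𝒮.Q.Carrier))
    (Z := (C : 𝒮.Q.Carrier)) f g k

theorem comp_convexSum (p q : ℝ) (hp : 0 ≤ p) (hq : 0 ≤ q) (h : p + q = 1)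
    {A B C : 𝒮.Ob} (k : 𝒮.Q.Hom A B) (f g : 𝒮.Q.Hom B C) :
    𝒮.Q.comp k (𝒮.convexSum p q hp hq h f g) =
      𝒮.convexSum p q hp hq h (𝒮.Q.comp k f) (𝒮.Q.comp k g) :=
  𝒮.convex.comp_sum p q hp hq h (X := (A : 𝒮.Q.Carrier)) (Y := (B : 𝒮.Q.Carrier))
    (Z := (C : 𝒮.Q.Carrier)) k f g

/-- The left injection `A → A ⊗ Bit`. -/
def inl (𝒮 : CircuitSetting.{u}) (A : 𝒮.Ob) : 𝒮.Q.Hom A (𝒮.tensorObj A 𝒮.Bit) :=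
  𝒮.Q.comp (𝒮.Q.rightInv A) (𝒮.Q.tensor (𝒮.Q.id A) (𝒮.J.map 𝒮.zero))

/-- The right injection `A → A ⊗ Bit`. -/
def inr (𝒮 : CircuitSetting.{u}) (A : 𝒮.Ob) : 𝒮.Q.Hom A (𝒮.tensorObj A 𝒮.Bit) :=
  𝒮.Q.comp (𝒮.Q.rightInv A) (𝒮.Q.tensor (𝒮.Q.id A) (𝒮.J.map 𝒮.one))

/-- Distributivity turns `Bit = I + I` into `A ⊗ Bit = A ⊗ I + A ⊗ I`, and the right unitor replaces
`A ⊗ I` by `A`. -/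
theorem cov_inl_inr (A : 𝒮.Ob) : 𝒮.coproducts.cov (𝒮.inl A) (𝒮.inr A) := by
  have h := (𝒮.isBinaryCoproduct_iff _ _).1
    (𝒮.distributive (W := (A : 𝒮.Q.Carrier)) _ _ 𝒮.bit_coproduct)
  refine (𝒮.isBinaryCoproduct_iff _ _).2 fun B => ?_
  have right_bij : Function.Bijective fun f : 𝒮.Q.Hom (𝒮.tensorObj A 𝒮.I) B =>
      𝒮.Q.comp (𝒮.Q.rightInv A) f := Function.bijective_iff_has_inverse.2
    ⟨fun f => 𝒮.Q.comp (𝒮.Q.right A) f,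
      fun f => by simp [← 𝒮.Q.comp_assoc, 𝒮.Q.right_inv],
      fun f => by simp [← 𝒮.Q.comp_assoc, 𝒮.Q.inv_right]⟩
  refine Eq.mp (congrArg Function.Bijective (funext fun f => ?_))
    ((right_bij.prodMap right_bij).comp (h B))
  exact Prod.ext (𝒮.Q.comp_assoc _ _ _).symm (𝒮.Q.comp_assoc _ _ _).symm

end CircuitSetting

namespace Sheaf

variable {F G H : Sheaf 𝒮.coproducts}

/-- Convex sums of elements, obtained by gluing over `A ⊗ Bit = A + A`. -/
noncomputable def convexSum (F : Sheaf 𝒮.coproducts) (p q : ℝ) (hp : 0 ≤ p) (hq : 0 ≤ q)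
    (h : p + q = 1) {A : 𝒮.Ob} (x y : F.obj A) : F.obj A :=
  F.res (𝒮.convexSum p q hp hq h (𝒮.inl A) (𝒮.inr A)) (F.glue (𝒮.cov_inl_inr A) x y)

/-- The bridge between convexity in `Q` and in a sheaf: the definition covers only the universal
pair `inl`, `inr`, and every other pair of morphisms factors through it. -/
theorem res_convexSum_hom (p q : ℝ) (hp : 0 ≤ p) (hq : 0 ≤ q) (h : p + q = 1) {A B : 𝒮.Ob}
    (f g : 𝒮.Q.Hom A B) (u : F.obj B) : F.res (𝒮.convexSum p q hp hq h f g) u =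
      F.convexSum p q hp hq h (F.res f u) (F.res g u) := by
  -- Here `k : A ⊗ Bit → B` is the copairing of `f` and `g`. By uniqueness of gluing, `F.res k u` is
  -- the element glued from the restrictions of `u` along `f` and `g`.
  obtain ⟨k, hk⟩ := (𝒮.coproducts.desc (𝒮.cov_inl_inr A) B).2 (f, g)
  obtain ⟨rfl, rfl⟩ := Prod.ext_iff.1 hk
  rw [← CircuitSetting.convexSum_comp, F.res_comp, convexSum]
  congr 1
  apply F.cov_ext (𝒮.cov_inl_inr A) <;> simp

theorem res_convexSum (p q : ℝ) (hp : 0 ≤ p) (hq : 0 ≤ q) (h : p + q = 1) {A B : 𝒮.Ob}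
    (k : 𝒮.Q.Hom B A) (x y : F.obj A) : F.res k (F.convexSum p q hp hq h x y) =
      F.convexSum p q hp hq h (F.res k x) (F.res k y) := by
  rw [convexSum, res_res, CircuitSetting.comp_convexSum, res_convexSum_hom, F.res_comp, F.res_comp,
    res_glue_left, res_glue_right]

/-- Convex sums are built from gluing and restriction alone, and natural transformations preserve
both. -/
theorem Hom.app_convexSum (α : F.Hom G) (p q : ℝ) (hp : 0 ≤ p) (hq : 0 ≤ q) (h : p + q = 1)
    {A : 𝒮.Ob} (x y : F.obj A) : α.1 A (F.convexSum p q hp hq h x y) =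
      G.convexSum p q hp hq h (α.1 A x) (α.1 A y) := by
  rw [convexSum, α.app_res, α.app_glue, convexSum]

/-- Reduces convexity laws for elements to laws for morphisms: with `x` and `y` written as
restrictions of one `u`, both sides become restrictions of `u` along convex sums in `Q`. -/
theorem exists_res_inl_inr (F : Sheaf 𝒮.coproducts) {A : 𝒮.Ob} (x y : F.obj A) :
    ∃ u : F.obj (𝒮.tensorObj A 𝒮.Bit), F.res (𝒮.inl A) u = x ∧ F.res (𝒮.inr A) u = y :=
  ⟨F.glue (𝒮.cov_inl_inr A) x y, by simp, by simp⟩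

/-- The convexity structure on the elements of a sheaf on `Q`. -/
noncomputable def convexStructure (F : Sheaf 𝒮.coproducts) (A : 𝒮.Ob) :
    ConvexStructure (F.obj A) where
  sum p q hp hq h x y := F.convexSum p q hp hq h x y
  sum_self p q hp hq h x := by
    -- Viewing `x` as its own restriction along the identity makes this idempotence of convex sums
    -- in `Q`.
    rw [← F.res_id A x, ← res_convexSum_hom]
    exact congrArg (fun f => F.res f x) ((𝒮.convex.conv _ _).sum_self p q hp hq h _)
  sum_comm p q hp hq h x y := by
    obtain ⟨u, rfl, rfl⟩ := F.exists_res_inl_inr x y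
    rw [← res_convexSum_hom, ← res_convexSum_hom]
    exact congrArg (fun f => F.res f u) ((𝒮.convex.conv _ _).sum_comm p q hp hq h _ _)
  zero_one x y := by
    obtain ⟨u, rfl, rfl⟩ := F.exists_res_inl_inr x y
    rw [← res_convexSum_hom]
    exact congrArg (fun f => F.res f u) ((𝒮.convex.conv _ _).zero_one _ _)
  interchange a b c d ha hb hc hd h hab hcd hac hbd x y z w := by
    -- Four elements are obtained from a single `s` over `(A ⊗ Bit) ⊗ Bit`, a fourfold coproduct of
    -- `A`, by applying the two-element case twice.
    obtain ⟨u, rfl, rfl⟩ := F.exists_res_inl_inr x y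
    obtain ⟨v, rfl, rfl⟩ := F.exists_res_inl_inr z w
    obtain ⟨s, rfl, rfl⟩ := F.exists_res_inl_inr u v
    simp only [res_res, ← res_convexSum_hom]
    exact congrArg (fun f => F.res f s) ((𝒮.convex.conv _ _).interchange a b c d ha hb hc hd h hab
      hcd hac hbd _ _ _ _)

/-- The convexity structure on the natural transformations between sheaves on `Q`. -/
noncomputable def homConvexStructure (F G : Sheaf 𝒮.coproducts) : ConvexStructure (F.Hom G) where
  sum p q hp hq h α β := ⟨fun A x => (G.convexStructure A).sum p q hp hq h (α.1 A x) (β.1 A x),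
    fun _ _ g x => (congrArg₂ (G.convexSum p q hp hq h) (α.app_res g x) (β.app_res g x)).trans
      (res_convexSum p q hp hq h g _ _).symm⟩
  sum_self p q hp hq h _ := Hom.ext fun A _ => (G.convexStructure A).sum_self p q hp hq h _
  sum_comm p q hp hq h _ _ := Hom.ext fun A _ => (G.convexStructure A).sum_comm p q hp hq h _ _
  zero_one _ _ := Hom.ext fun A _ => (G.convexStructure A).zero_one _ _
  interchange a b c d ha hb hc hd h hab hcd hac hbd _ _ _ _ := Hom.ext fun A _ =>
    (G.convexStructure A).interchange a b c d ha hb hc hd h hab hcd hac hbd _ _ _ _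

theorem comp_homConvexStructure_sum (p q : ℝ) (hp : 0 ≤ p) (hq : 0 ≤ q) (h : p + q = 1)
    (κ : F.Hom G) (α β : G.Hom H) : κ.comp ((homConvexStructure G H).sum p q hp hq h α β) =
      (homConvexStructure F H).sum p q hp hq h (κ.comp α) (κ.comp β) := rfl

theorem homConvexStructure_sum_comp (p q : ℝ) (hp : 0 ≤ p) (hq : 0 ≤ q) (h : p + q = 1)
    (α β : F.Hom G) (κ : G.Hom H) : ((homConvexStructure F G).sum p q hp hq h α β).comp κ =
      (homConvexStructure F H).sum p q hp hq h (α.comp κ) (β.comp κ) :=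
  Hom.ext fun _ _ => κ.app_convexSum p q hp hq h _ _

/-- By Yoneda only the value at the identity matters, and there it is `res_convexSum_hom` for a
representable. -/
theorem repMap_convexSum (p q : ℝ) (hp : 0 ≤ p) (hq : 0 ≤ q) (h : p + q = 1) {A B : 𝒮.Ob}
    (f g : 𝒮.Q.Hom A B) : repMap (W := 𝒮.coproducts) (𝒮.convexSum p q hp hq h f g) =
      (homConvexStructure (rep 𝒮.coproducts A) (rep 𝒮.coproducts B)).sum p q hp hq h
        (repMap f) (repMap g) := by
  apply rep_ext
  have e := res_convexSum_hom (F := rep 𝒮.coproducts B) p q hp hq h f g (𝒮.Q.id B)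
  simp only [SymmetricMonoidalOn.comp_id] at e
  refine (𝒮.Q.id_comp _).trans (e.trans ?_)
  exact (congrArg₂ _ (𝒮.Q.id_comp f) (𝒮.Q.id_comp g)).symm

end Sheaf

end ConvexSums

/-! ### Global elements of the internal hom. -/

section IhomUnit

namespace Sheaf

section

variable {Ob : Type u} {I : Ob} {t : Ob → Ob → Ob} {K : SymmetricMonoidalOn Ob I t}
  {W : CoverClass K} {F Z : Sheaf W}

/-- The morphism corresponding to an element of the internal hom over the tensor unit. -/
def ofIhomUnit (β : (ihom F Z).obj I) : F.Hom Z :=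
  ⟨fun A x => Z.res (K.leftInv A) (β.1 A x), fun A B f x => by
    simp [K.leftInv_naturality]⟩

/-- The element of the internal hom over the tensor unit corresponding to a morphism. -/
def toIhomUnit (α : F.Hom Z) : (ihom F Z).obj I :=
  ⟨fun A x => Z.res (K.left A) (α.1 A x), fun A B f x => by
    simp [K.left_naturality]⟩

theorem toIhomUnit_ofIhomUnit (β : (ihom F Z).obj I) : toIhomUnit (ofIhomUnit β) = β :=
  Hom.ext fun A x => by simp [toIhomUnit, ofIhomUnit, K.left_inv]

theorem ofIhomUnit_toIhomUnit (α : F.Hom Z) : ofIhomUnit (toIhomUnit α) = α :=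
  Hom.ext fun A x => by simp [toIhomUnit, ofIhomUnit, K.inv_left]

end

variable {𝒮 : CircuitSetting.{u}} {F₀ Z₀ : Sheaf 𝒮.coproducts} {F₁ Z₁ : Sheaf 𝒮.noCocones}
  {m : F₁.Hom F₀.pull} {n : Z₁.Hom Z₀.pull}

theorem ofIhomUnit_comm {β₀ : (ihom F₀ Z₀).obj 𝒮.I} {β₁ : (ihom F₁ Z₁).obj 𝒮.I}
    (h : ∀ B x, n.1 _ (β₁.1 B x) = β₀.1 B (m.1 B x)) :
    (ofIhomUnit β₁).comp n = m.comp (pullMap (ofIhomUnit β₀)) :=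
  Hom.ext fun A x => by
    -- Strictness is stated for the unitor only; for its inverse it follows by uniqueness of
    -- inverses.
    have e : 𝒮.J.map (𝒮.M.leftInv A) = 𝒮.Q.leftInv A := by
      rw [← 𝒮.Q.id_comp (𝒮.J.map _), ← 𝒮.Q.inv_left, 𝒮.Q.comp_assoc, ← 𝒮.J.map_left,
        ← 𝒮.J.map_comp, 𝒮.M.left_inv, 𝒮.J.map_id, 𝒮.Q.comp_id]
    change n.1 A (Z₁.res (𝒮.M.leftInv A) (β₁.1 A x)) = Z₀.res (𝒮.Q.leftInv A) (β₀.1 A (m.1 A x))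
    rw [n.app_res, h, pull_res, e]

theorem toIhomUnit_comm {α₀ : F₀.Hom Z₀} {α₁ : F₁.Hom Z₁}
    (h : α₁.comp n = m.comp (pullMap α₀)) (B : 𝒮.Ob) (x : F₁.obj B) :
    n.1 _ ((toIhomUnit α₁).1 B x) = (toIhomUnit α₀).1 B (m.1 B x) := by
  have h' : n.1 B (α₁.1 B x) = α₀.1 B (m.1 B x) :=
    congrFun (congrFun (congrArg Subtype.val h) B) x
  change n.1 _ (Z₁.res (𝒮.M.left B) (α₁.1 B x)) = Z₀.res (𝒮.Q.left B) (α₀.1 B (m.1 B x))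
  rw [n.app_res, h', pull_res, 𝒮.J.map_left]

end Sheaf

end IhomUnit

/-! ### The monad and its Kleisli category. -/

section DynamicLifting

namespace CircuitSetting.SmoothPresheaf

open Sheaf

variable {𝒮 : CircuitSetting.{u}} {X Y Z : 𝒮.SmoothPresheaf}

/-- The object part of the monad: level one is replaced by level zero. -/
def liftObj (X : 𝒮.SmoothPresheaf) : 𝒮.SmoothPresheaf :=
  ofLevels X.lev₀ X.lev₀.pull (Hom.id _)

/-- The comparison of `liftObj Y` is the identity, so compatibility determines the level-one part of
a map into it from the level-zero part. -/
theorem hom_ext_liftObj {a b : (X.presheaf.natBiset (liftObj Y).presheaf).obj₁}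
    (h : homLev₀ a = homLev₀ b) : a = b :=
  hom_ext h ((homLev_comm a).trans
    ((congrArg (fun α => X.lmap.comp (pullMap α)) h).trans (homLev_comm b).symm))

theorem emap_ext_liftObj {e e' : EMap Biset.{u} X (liftObj Y)} (h : eLev₀ e = eLev₀ e') :
    e = e' :=
  emap_ext h ((eLev_comm e).trans
    ((congrArg (fun α => X.lmap.comp (pullMap α)) h).trans (eLev_comm e').symm))

/-- The map `X → T Y` given by a natural transformation on level zero. -/
def emapLift (α : X.lev₀.Hom Y.lev₀) : EMap Biset.{u} X (liftObj Y) :=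
  emapMk (Y := liftObj Y) α (X.lmap.comp (pullMap α)) rfl

/-- The functor `T`. -/
def liftFunctor (𝒮 : CircuitSetting.{u}) :
    EnrichedFunctor Biset.{u} 𝒮.SmoothPresheaf 𝒮.SmoothPresheaf where
  obj := liftObj
  map X Y := Biset.Hom.mk (A := X.presheaf.natBiset Y.presheaf)
    (B := (liftObj X).presheaf.natBiset (liftObj Y).presheaf) (fun α => α)
    (fun a => homMk (X := liftObj X) (Y := liftObj Y) (homLev₀ (X := X) (Y := Y) a)
      (pullMap (homLev₀ (X := X) (Y := Y) a)) rfl)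
    fun _ => rfl
  map_id _ := rfl
  map_comp _ _ _ := rfl

/-- The monad `T`. -/
def liftMonad (𝒮 : CircuitSetting.{u}) : EnrichedMonad Biset.{u} 𝒮.SmoothPresheaf where
  T := liftFunctor 𝒮
  η X := emapLift (X := X) (Y := X) (Hom.id _)
  μ X := emapLift (X := liftObj (liftObj X)) (Y := X) (Hom.id _)
  η_naturality _ _ := Biset.hom_ext (fun _ => rfl) fun _ => hom_ext_liftObj rfl
  μ_naturality _ _ := Biset.hom_ext (fun _ => rfl) fun _ => hom_ext_liftObj rfl
  assoc _ := emap_ext_liftObj rfl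
  left_unit _ := emap_ext_liftObj rfl
  right_unit _ := emap_ext_liftObj rfl

/-- The strength of `T`. -/
noncomputable def liftStrength (𝒮 : CircuitSetting.{u}) :
    StrengthData (monoidalData 𝒮) (liftMonad 𝒮) :=
  fun X Y => emapLift (X := tensorObj X (liftObj Y)) (Y := tensorObj X Y) (Hom.id _)

/-- All targets are of the form `T Z`, so only level zero matters. There `T` acts as the identity
and unit, multiplication and strength are identities, so what remains is `tensorHom_id`. Both
composites in the commutativity law are the same double swap. -/
theorem liftStrength_isCommutative (𝒮 : CircuitSetting.{u}) :
    IsCommutativeStrength (monoidalData 𝒮) (liftMonad 𝒮) (liftStrength 𝒮) where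
  naturality _ _ _ _ := Biset.hom_ext (fun _ => rfl) fun _ => hom_ext_liftObj rfl
  unit X Y := emap_ext_liftObj (Sheaf.tensorHom_id X.lev₀ Y.lev₀)
  mult X Y := emap_ext_liftObj (Sheaf.tensorHom_id X.lev₀ Y.lev₀)
  assoc X Y Z := emap_ext_liftObj (congrArg (fun α => (assoc X.lev₀ Y.lev₀ Z.lev₀).comp α)
    (Sheaf.tensorHom_id X.lev₀ (tensor Y.lev₀ Z.lev₀)).symm)
  left _ := emap_ext_liftObj rfl
  comm _ _ := emap_ext_liftObj rfl

/-- On level zero the only nontrivial part of the Kleisli tensor besides `tensorHom α β` is the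
costrength, which consists of two mutually inverse swaps. -/
theorem eLev₀_kleisliTensor {X₁ Y₁ X₂ Y₂ : 𝒮.SmoothPresheaf} (α : X₁.lev₀.Hom Y₁.lev₀)
    (β : X₂.lev₀.Hom Y₂.lev₀) : eLev₀ (Y := liftObj (tensorObj Y₁ Y₂))
      (kleisliTensor (liftStrength 𝒮) (emapLift α) (emapLift β)) = tensorHom α β :=
  congrArg (fun γ => (tensorHom α β).comp γ) (swap_swap Y₁.lev₀ Y₂.lev₀)

/-- The Kleisli category of `T`. -/
abbrev LiftKleisli (𝒮 : CircuitSetting.{u}) := Kleisli (liftMonad 𝒮).underlying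

/-- The smooth presheaf underlying an object of the Kleisli category. -/
abbrev kleisliObj (X : LiftKleisli 𝒮) : 𝒮.SmoothPresheaf := ForgetEnrichment.to Biset.{u} X.of

/-- Kleisli maps are natural transformations on level zero. -/
def kleisliEquiv (X Y : LiftKleisli 𝒮) : (X ⟶ Y) ≃ (kleisliObj X).lev₀.Hom (kleisliObj Y).lev₀ where
  toFun f := eLev₀ (X := kleisliObj X) (Y := liftObj (kleisliObj Y))
    (ForgetEnrichment.homTo Biset.{u} f.of)
  invFun α := Kleisli.Hom.mk (ForgetEnrichment.homOf Biset.{u}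
    (emapLift (X := kleisliObj X) (Y := kleisliObj Y) α))
  left_inv _ := Kleisli.hom_ext (emap_ext_liftObj rfl)
  right_inv _ := rfl

/-- Holds by definition, because `T` and its multiplication are trivial on level zero. With
`kleisliEquiv`, equations in the Kleisli category become equations of sheaves on `Q`. -/
theorem kleisliEquiv_comp {X Y Z : LiftKleisli 𝒮} (f : X ⟶ Y) (g : Y ⟶ Z) :
    kleisliEquiv X Z (f ≫ g) = (kleisliEquiv X Y f).comp (kleisliEquiv Y Z g) := rfl

/-- The convex enrichment of the Kleisli category. -/
noncomputable def kleisliConvex (𝒮 : CircuitSetting.{u}) : ConvexEnrichment (LiftKleisli 𝒮) where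
  conv X Y := (homConvexStructure _ _).ofEquiv (kleisliEquiv X Y)
  sum_comp p q hp hq h X Y Z f g k := (kleisliEquiv X Z).injective <| by
    simp only [ConvexStructure.ofEquiv, kleisliEquiv_comp, Equiv.apply_symm_apply,
      homConvexStructure_sum_comp]
  comp_sum p q hp hq h X Y Z k f g := (kleisliEquiv X Z).injective <| by
    simp only [ConvexStructure.ofEquiv, kleisliEquiv_comp, Equiv.apply_symm_apply,
      comp_homConvexStructure_sum]

/-! ### The Yoneda embeddings of `M` and `Q`, and the box isomorphism. -/

theorem pullRep_repMap {A B : 𝒮.Ob} (f : 𝒮.M.Hom A B) :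
    (repMap (W := 𝒮.noCocones) f).comp (pullRep B) =
      (pullRep A).comp (pullMap (repMap (W := 𝒮.coproducts) (𝒮.J.map f))) :=
  Hom.ext fun _ _ => 𝒮.J.map_comp _ _

/-- The embedding of `M`. -/
def circuitEmbedding (𝒮 : CircuitSetting.{u}) :
    𝒮.M.Carrier ⥤ ForgetEnrichment Biset.{u} 𝒮.SmoothPresheaf where
  obj A := ForgetEnrichment.of Biset.{u} (rep A : 𝒮.SmoothPresheaf)
  map {A B} f := ForgetEnrichment.homOf Biset.{u}
    (emapMk (X := rep A) (Y := rep B) (repMap (𝒮.J.map f)) (repMap f) (pullRep_repMap f))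
  map_id A := emap_ext (X := rep A) (Y := rep A)
    (rep_ext ((𝒮.Q.id_comp _).trans (𝒮.J.map_id A))) (rep_ext (𝒮.M.id_comp _))
  map_comp {A _ C} f g := emap_ext (X := rep A) (Y := rep C)
    (rep_ext ((congrArg _ (𝒮.J.map_comp f g)).trans (𝒮.Q.comp_assoc _ _ _).symm))
    (rep_ext (𝒮.M.comp_assoc _ _ _).symm)

/-- The embedding of `M` is fully faithful. -/
def circuitEmbeddingFullyFaithful (𝒮 : CircuitSetting.{u}) :
    (circuitEmbedding 𝒮).FullyFaithful where
  preimage {A B} e := (eLev₁ (X := rep A) (Y := rep B)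
    (ForgetEnrichment.homTo Biset.{u} e)).1 A (𝒮.M.id A)
  map_preimage {A B} e := by
    -- The preimage is read off at level one. Compatibility at the identity shows that the
    -- level-zero map sends the identity to the image under `J` of that preimage, so Yoneda settles
    -- both levels.
    have h := congrFun (congrFun (congrArg Subtype.val (eLev_comm (X := rep A) (Y := rep B)
      (ForgetEnrichment.homTo Biset.{u} e))) A) (𝒮.M.id A)
    refine emap_ext (X := rep A) (Y := rep B) (rep_ext ((𝒮.Q.id_comp _).trans (h.trans ?_)))
      (rep_ext (𝒮.M.id_comp _))
    exact congrArg ((eLev₀ (X := rep A) (Y := rep B)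
      (ForgetEnrichment.homTo Biset.{u} e)).1 A) (𝒮.J.map_id A)
  preimage_map f := 𝒮.M.id_comp f

theorem pullRep_tensor (A B : 𝒮.Ob) :
    (repTensor (W := 𝒮.noCocones) A B).comp (pullRep (𝒮.tensorObj A B)) =
      (pullTensor (pullRep A) (pullRep B)).comp (pullMap (repTensor (W := 𝒮.coproducts) A B)) :=
  tensor_ext fun f g => 𝒮.J.map_tensor f g

/-- The embedding of `M` is strong monoidal. -/
noncomputable def circuitEmbeddingMonoidal (𝒮 : CircuitSetting.{u}) :
    StrongMonoidal inferInstance (monoidalData 𝒮).underlying (circuitEmbedding 𝒮) where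
  ε := Iso.refl _
  μ A B := (eisoMk (X := tensorObj (rep A) (rep B)) (Y := rep (𝒮.tensorObj A B))
    (repTensor _ _) (repTensor _ _) (repTensorInv _ _) (repTensorInv _ _) (pullRep_tensor A B)
    (repTensor_inv _ _) (repTensorInv_repTensor _ _) (repTensor_inv _ _)
    (repTensorInv_repTensor _ _)).toIso
  μ_naturality {X₁ Y₁ X₂ Y₂} f g := emap_ext (X := tensorObj (rep X₁) (rep X₂))
    (Y := rep (𝒮.tensorObj Y₁ Y₂))
    ((repTensor_naturality _ _).trans (congrArg
      (fun k => (repTensor (W := 𝒮.coproducts) X₁ X₂).comp (repMap k)) (𝒮.J.map_tensor f g).symm))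
    (repTensor_naturality _ _)
  associativity X Y Z := emap_ext (X := tensorObj (tensorObj (rep X) (rep Y)) (rep Z))
    (Y := rep (𝒮.tensorObj X (𝒮.tensorObj Y Z)))
    ((congrArg (fun k => (tensorHom (repTensor (W := 𝒮.coproducts) X Y) (Hom.id _)).comp
      ((repTensor _ Z).comp (repMap k))) (𝒮.J.map_assoc X Y Z)).trans (repTensor_assoc _ _ _))
    (repTensor_assoc _ _ _)
  left_unitality X := emap_ext (X := tensorObj (rep 𝒮.I) (rep X)) (Y := rep X)
    ((left_rep X).trans ((congrArg (fun k => (repTensor (W := 𝒮.coproducts) 𝒮.I X).comp (repMap k))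
      (𝒮.J.map_left X).symm).trans
      -- The unit comparison is the identity, since the unit of the model is itself the
      -- representable at `I`; its tensor with an identity is inserted here.
      (congrArg (fun α => α.comp ((repTensor (W := 𝒮.coproducts) 𝒮.I X).comp
        (repMap (𝒮.J.map (𝒮.M.left X))))) (Sheaf.tensorHom_id _ _).symm)))
    ((left_rep X).trans (congrArg (fun α => α.comp ((repTensor (W := 𝒮.noCocones) 𝒮.I X).comp
        (repMap (𝒮.M.left X)))) (Sheaf.tensorHom_id _ _).symm))
  right_unitality X := emap_ext (X := tensorObj (rep X) (rep 𝒮.I)) (Y := rep X)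
    ((right_rep X).trans ((congrArg (fun k => (repTensor (W := 𝒮.coproducts) X 𝒮.I).comp (repMap k))
      (𝒮.J.map_right X).symm).trans
      (congrArg (fun α => α.comp ((repTensor (W := 𝒮.coproducts) X 𝒮.I).comp
        (repMap (𝒮.J.map (𝒮.M.right X))))) (Sheaf.tensorHom_id _ _).symm)))
    ((right_rep X).trans (congrArg (fun α => α.comp ((repTensor (W := 𝒮.noCocones) X 𝒮.I).comp
        (repMap (𝒮.M.right X)))) (Sheaf.tensorHom_id _ _).symm))

/-- Isomorphisms of the Kleisli category are isomorphisms on level zero. -/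
def kleisliIso {X Y : LiftKleisli 𝒮} (α : (kleisliObj X).lev₀.Hom (kleisliObj Y).lev₀)
    (β : (kleisliObj Y).lev₀.Hom (kleisliObj X).lev₀) (h : α.comp β = Hom.id _)
    (h' : β.comp α = Hom.id _) : X ≅ Y where
  hom := (kleisliEquiv X Y).symm α
  inv := (kleisliEquiv Y X).symm β
  hom_inv_id := (kleisliEquiv X X).injective h
  inv_hom_id := (kleisliEquiv Y Y).injective h'

/-- The embedding of `Q`. -/
def quantumEmbedding (𝒮 : CircuitSetting.{u}) : 𝒮.Q.Carrier ⥤ LiftKleisli 𝒮 where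
  obj A := Kleisli.mk _ (ForgetEnrichment.of Biset.{u} (rep A : 𝒮.SmoothPresheaf))
  map f := (kleisliEquiv _ _).symm (repMap (W := 𝒮.coproducts) f)
  map_id _ := (kleisliEquiv _ _).injective (rep_ext (𝒮.Q.id_comp _))
  map_comp _ _ := (kleisliEquiv _ _).injective (rep_ext (𝒮.Q.comp_assoc _ _ _).symm)

/-- The embedding of `Q` is fully faithful. -/
def quantumEmbeddingFullyFaithful (𝒮 : CircuitSetting.{u}) :
    (quantumEmbedding 𝒮).FullyFaithful where
  preimage {A _} e := (kleisliEquiv _ _ e).1 A (𝒮.Q.id A)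
  map_preimage _ := (kleisliEquiv _ _).injective (rep_ext (𝒮.Q.id_comp _))
  preimage_map f := 𝒮.Q.id_comp f

/-- The embedding of `Q` is strong monoidal. -/
noncomputable def quantumEmbeddingMonoidal (𝒮 : CircuitSetting.{u}) :
    StrongMonoidal inferInstance (kleisliMonoidal (liftStrength 𝒮)) (quantumEmbedding 𝒮) where
  ε := Iso.refl _
  μ A B := kleisliIso (repTensor (W := 𝒮.coproducts) A B) (repTensorInv _ _)
    (repTensor_inv _ _) (repTensorInv_repTensor _ _)
  μ_naturality {X₁ Y₁ X₂ Y₂} f g := (kleisliEquiv _ _).injective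
    -- The Kleisli tensor is first replaced by the ordinary tensor on level zero; the rest is the
    -- statement for representable sheaves.
    ((congrArg (fun α : (tensor (Sheaf.rep 𝒮.coproducts X₁) (Sheaf.rep 𝒮.coproducts X₂)).Hom
        (tensor (Sheaf.rep 𝒮.coproducts Y₁) (Sheaf.rep 𝒮.coproducts Y₂)) =>
        α.comp (repTensor (W := 𝒮.coproducts) Y₁ Y₂))
      (eLev₀_kleisliTensor (𝒮 := 𝒮) (X₁ := rep X₁) (X₂ := rep X₂) (Y₁ := rep Y₁) (Y₂ := rep Y₂)
        (repMap (W := 𝒮.coproducts) f) (repMap (W := 𝒮.coproducts) g))).trans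
      (repTensor_naturality f g))
  associativity X Y Z := (kleisliEquiv _ _).injective
    (((congrArg (fun α : (tensor (tensor (Sheaf.rep 𝒮.coproducts X)
        (Sheaf.rep 𝒮.coproducts Y)) (Sheaf.rep 𝒮.coproducts Z)).Hom
        (tensor (Sheaf.rep 𝒮.coproducts (𝒮.tensorObj X Y)) (Sheaf.rep 𝒮.coproducts Z)) =>
        α.comp ((repTensor (W := 𝒮.coproducts) (𝒮.tensorObj X Y) Z).comp
        (repMap (𝒮.Q.assoc X Y Z))))
      (eLev₀_kleisliTensor (𝒮 := 𝒮) (X₁ := tensorObj (rep X) (rep Y)) (X₂ := rep Z)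
        (Y₁ := rep (𝒮.tensorObj X Y)) (Y₂ := rep Z)
        (repTensor (W := 𝒮.coproducts) X Y) (Hom.id _))).trans
      (repTensor_assoc (W := 𝒮.coproducts) X Y Z)).trans
    (congrArg (fun α : (tensor (Sheaf.rep 𝒮.coproducts X)
        (tensor (Sheaf.rep 𝒮.coproducts Y) (Sheaf.rep 𝒮.coproducts Z))).Hom
        (tensor (Sheaf.rep 𝒮.coproducts X) (Sheaf.rep 𝒮.coproducts (𝒮.tensorObj Y Z))) =>
        (assoc (Sheaf.rep 𝒮.coproducts X) (Sheaf.rep 𝒮.coproducts Y)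
          (Sheaf.rep 𝒮.coproducts Z)).comp (α.comp (repTensor (W := 𝒮.coproducts) X
        (𝒮.tensorObj Y Z))))
      (eLev₀_kleisliTensor (𝒮 := 𝒮) (X₁ := rep X) (X₂ := tensorObj (rep Y) (rep Z))
        (Y₁ := rep X) (Y₂ := rep (𝒮.tensorObj Y Z)) (Hom.id _)
        (repTensor (W := 𝒮.coproducts) Y Z)).symm))
  left_unitality X := (kleisliEquiv _ _).injective ((left_rep X).trans
    (congrArg (fun α : (tensor (Sheaf.rep 𝒮.coproducts 𝒮.I) (Sheaf.rep 𝒮.coproducts X)).Hom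
        (tensor (Sheaf.rep 𝒮.coproducts 𝒮.I) (Sheaf.rep 𝒮.coproducts X)) =>
        α.comp ((repTensor (W := 𝒮.coproducts) 𝒮.I X).comp (repMap (𝒮.Q.left X))))
      ((Sheaf.tensorHom_id _ _).symm.trans
        (eLev₀_kleisliTensor (𝒮 := 𝒮) (X₁ := rep 𝒮.I) (X₂ := rep X)
        (Y₁ := rep 𝒮.I) (Y₂ := rep X) (Hom.id _) (Hom.id _)).symm)))
  right_unitality X := (kleisliEquiv _ _).injective ((right_rep X).trans
    (congrArg (fun α : (tensor (Sheaf.rep 𝒮.coproducts X) (Sheaf.rep 𝒮.coproducts 𝒮.I)).Hom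
        (tensor (Sheaf.rep 𝒮.coproducts X) (Sheaf.rep 𝒮.coproducts 𝒮.I)) =>
        α.comp ((repTensor (W := 𝒮.coproducts) X 𝒮.I).comp (repMap (𝒮.Q.right X))))
      ((Sheaf.tensorHom_id _ _).symm.trans
        (eLev₀_kleisliTensor (𝒮 := 𝒮) (X₁ := rep X) (X₂ := rep 𝒮.I)
        (Y₁ := rep X) (Y₂ := rep 𝒮.I) (Hom.id _) (Hom.id _)).symm)))

/-- The isomorphism `♭(X ⊸ Y) ≅ A(X, Y)`. -/
def flatIhomIso (X Y : 𝒮.SmoothPresheaf) : (ihomObj X Y).presheaf.obj (Opposite.op 𝒮.I) ≅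
    EnrichedCategory.Hom (V := Biset.{u}) X Y where
  hom := Biset.Hom.mk (A := (ihomObj X Y).presheaf.obj (Opposite.op 𝒮.I))
    (B := X.presheaf.natBiset Y.presheaf) (fun β => ofIhomUnit (F := X.lev₀) (Z := Y.lev₀) β)
    (fun b => homMk (ofIhomUnit (F := X.lev₀) (Z := Y.lev₀) b.1.1)
      (ofIhomUnit (F := X.lev₁) (Z := Y.lev₁) b.1.2) (ofIhomUnit_comm b.2)) fun _ => rfl
  inv := Biset.Hom.mk (A := X.presheaf.natBiset Y.presheaf)
    (B := (ihomObj X Y).presheaf.obj (Opposite.op 𝒮.I))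
    (fun α => toIhomUnit (F := X.lev₀) (Z := Y.lev₀) α)
    (fun a => ⟨(toIhomUnit (homLev₀ a), toIhomUnit (homLev₁ a)), toIhomUnit_comm (homLev_comm a)⟩)
    fun _ => rfl
  hom_inv_id := Biset.hom_ext (fun _ => toIhomUnit_ofIhomUnit _) fun _ => Subtype.ext
    (Prod.ext (toIhomUnit_ofIhomUnit _) (toIhomUnit_ofIhomUnit _))
  inv_hom_id := Biset.hom_ext (fun _ => ofIhomUnit_toIhomUnit _) fun a => hom_ext
    (ofIhomUnit_toIhomUnit (homLev₀ a)) (ofIhomUnit_toIhomUnit (homLev₁ a))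

end CircuitSetting.SmoothPresheaf

end DynamicLifting

/-! ### Dynamic lifting and assembly of the model. -/

section Model

namespace IsEnrichedCoproduct

universe v w a
variable {V : Type w} [Category.{v} V] [MonoidalCategory V] {A : Type a} [EnrichedCategory V A]
  {ι : Type*} {X : ι → A} {P : A} {inj : ∀ i, EMap V (X i) P}

/-- A family of maps is a cone with vertex the unit of `V`, so the product property of the
hom-objects already gives the ordinary universal property. -/
theorem exists_comp_eq (h : IsEnrichedCoproduct X P inj) {Z : A} (g : ∀ i, EMap V (X i) Z) :
    ∃ e : EMap V P Z, ∀ i, (inj i).comp e = g i := by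
  obtain ⟨l⟩ := h Z
  refine ⟨Fan.IsLimit.lift l g, fun i => ?_⟩
  rw [EMap.comp_eq_pre]
  exact Fan.IsLimit.fac l g i

theorem emap_ext (h : IsEnrichedCoproduct X P inj) {Z : A} {e e' : EMap V P Z}
    (he : ∀ i, (inj i).comp e = (inj i).comp e') : e = e' := by
  obtain ⟨l⟩ := h Z
  refine Fan.IsLimit.hom_ext l _ _ fun i => ?_
  have := he i
  rwa [EMap.comp_eq_pre, EMap.comp_eq_pre] at this

end IsEnrichedCoproduct

namespace CircuitSetting.SmoothPresheaf

open Sheaf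

variable {𝒮 : CircuitSetting.{u}}

/-- The map `rep A → rep B` given by a morphism of `M`. -/
def emapRep {A B : 𝒮.Ob} (f : 𝒮.M.Hom A B) :
    EMap Biset.{u} (rep A : 𝒮.SmoothPresheaf) (rep B : 𝒮.SmoothPresheaf) :=
  emapMk (X := rep A) (Y := rep B) (repMap (𝒮.J.map f)) (repMap f) (pullRep_repMap f)

/-- In the model `Bit` need not be a coproduct, but on level zero every smooth presheaf treats it as
`I + I`. A map from `Bit` into `T B` sees only level zero, so it can be defined by its values on the
two bits; the required equation is then tested on the two injections of `B`. -/
theorem exists_dynamicLifting (B : 𝒮.SmoothPresheaf)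
    (inj : Bool → EMap Biset.{u} (rep 𝒮.I : 𝒮.SmoothPresheaf) B)
    (h : IsEnrichedCoproduct (fun _ => (rep 𝒮.I : 𝒮.SmoothPresheaf)) B inj) :
    ∃ (init : EMap Biset.{u} B (rep 𝒮.Bit : 𝒮.SmoothPresheaf))
      (dyn : EMap Biset.{u} (rep 𝒮.Bit : 𝒮.SmoothPresheaf) (liftObj B)),
      init.comp dyn = (liftMonad 𝒮).η B := by
  obtain ⟨init, h_init⟩ := h.exists_comp_eq fun b => bif b then emapRep 𝒮.one else emapRep 𝒮.zero
  have hc : 𝒮.coproducts.cov (𝒮.J.map 𝒮.zero) (𝒮.J.map 𝒮.one) := 𝒮.bit_coproduct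
  -- These are the Yoneda elements of the two injections on level zero; `false` goes with `zero` and
  -- `true` with `one`, as in `init`.
  let x : Bool → B.lev₀.obj 𝒮.I := fun b => (eLev₀ (X := rep 𝒮.I) (inj b)).1 𝒮.I (𝒮.Q.id 𝒮.I)
  let dyn : EMap Biset.{u} (rep 𝒮.Bit : 𝒮.SmoothPresheaf) (liftObj B) :=
    emapLift (X := rep 𝒮.Bit) (yoneda (F := B.lev₀) (B.lev₀.glue hc (x false) (x true)))
  refine ⟨init, dyn, h.emap_ext fun b => emap_ext_liftObj (X := rep 𝒮.I) ?_⟩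
  have e : ∀ b, (inj b).comp (init.comp dyn) =
      EMap.comp (bif b then emapRep 𝒮.one else emapRep 𝒮.zero) dyn := fun b => by
    rw [← h_init b]
    rfl
  rw [e b]
  apply rep_ext
  cases b
  · exact (congrArg (fun f => B.lev₀.res f _) (𝒮.Q.id_comp _)).trans
      (B.lev₀.res_glue_left hc (x false) (x true))
  · exact (congrArg (fun f => B.lev₀.res f _) (𝒮.Q.id_comp _)).trans
      (B.lev₀.res_glue_right hc (x false) (x true))

/-- The category of smooth presheaves is a model for Proto-Quipper with dynamic lifting. -/
noncomputable def model (𝒮 : CircuitSetting.{u}) :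
    ProtoQuipperModel 𝒮 Biset.{u} 𝒮.SmoothPresheaf where
  monoidal := monoidal 𝒮
  hom := ihomFunctor
  homAdj := ihomAdj
  coproducts := hasEnrichedCoproducts 𝒮
  p := copowerFunctor 𝒮
  flat := flatFunctor 𝒮
  adj := copowerAdj 𝒮
  pMonoidal := copowerMonoidal 𝒮
  monad := liftMonad 𝒮
  strength := liftStrength 𝒮
  commutativeStrong := liftStrength_isCommutative 𝒮
  convex := kleisliConvex 𝒮
  ψ := circuitEmbedding 𝒮
  ψFullyFaithful := circuitEmbeddingFullyFaithful 𝒮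
  ψMonoidal := circuitEmbeddingMonoidal 𝒮
  φ := quantumEmbedding 𝒮
  φFullyFaithful := quantumEmbeddingFullyFaithful 𝒮
  φMonoidal := quantumEmbeddingMonoidal 𝒮
  φ_sum p q hp hq h _ _ f g :=
    congrArg (kleisliEquiv _ _).symm (repMap_convexSum p q hp hq h f g)
  -- Both composites send an object to the same representable by definition, so the heterogeneous
  -- equation of morphisms is an honest one, decided on level zero.
  interp_comp_φ := Functor.hext (fun _ => rfl) fun _ _ _ =>
    heq_of_eq ((kleisliEquiv _ _).injective rfl)
  box S U := flatIhomIso (rep S) (rep U)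
  dynamicLifting := exists_dynamicLifting

end CircuitSetting.SmoothPresheaf

end Model

end ProtoQuipper

theorem mainTheorem1 (𝒮 : ProtoQuipper.CircuitSetting.{u}) :
    Nonempty (ProtoQuipper.ProtoQuipperModel 𝒮 ProtoQuipper.Biset.{u} 𝒮.SmoothPresheaf) :=
  ⟨ProtoQuipper.CircuitSetting.SmoothPresheaf.model 𝒮⟩
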